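/- Let $d=-A^{-2}-A^{2}$. For a virtual link diagram $D$ let $\langle D\rangle=\sum_{s}A^{c(s)}d^{|s|-1}\in\mathbb Z[A,A^{-1}]$ be its bracket polynomial, where $s$ runs over all choices of a smoothing of type $\alpha$ or $\beta$ at each classical crossing, $c(s)$ is the number of $\alpha$-smoothings minus the number of $\beta$-smoothings, and $|s|$ is the number of closed curves after smoothing (virtual crossings are kept). An $\alpha$-smoothing joins the two regions swept out by the overstrand when it is turned counterclockwise. For a virtual knot diagram $K$ let $\langle K\rangle_N$ be the bracket polynomial of the diagram formed by $N$ parallel copies of $K$ in the plane, in which each classical (virtual) crossing of $K$ is replaced by an $N\times N$ grid of classical (virtual) crossings of the same kind. Two virtual knot diagrams are equivalent if they are related by planar isotopy, the classical Reidemeister moves I, II, III and the virtual Reidemeister moves I, II, III, IV (the last one moves a strand with virtual crossings across a classical crossing). Let $K_m$ be the virtual knot diagram in the plane with classical crossings $1,\dots,6$ and virtual crossings $7,8$ that is traversed in the order $$U1^+\;O2^+\;V7\;O1^+\;O3^-\;U4^-\;U2^+\;V7\;O4^-\;U3^-\;U5^-\;V8\;O6^+\;O5^-\;V8\;U6^+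 ,$$ where $O$, $U$, $V$ stand for an over-, under- and virtual passage and the exponent is the sign of the crossing (the plane diagram with these two virtual crossings is fixed on the sphere by this data). Let $\bigcirc$ be the unknot diagram, the round circle without crossings. Then: 1. $\langle K_m\rangle=1=\langle \bigcirc\rangle$ and $\langle K_m\rangle_2=d=\langle \bigcirc\rangle_2$, so $K_m$ is not detected by the bracket polynomial or the 2-strand bracket polynomial. 2. $K_m$ is detected by the 3-strand bracket polynomial: $\langle \bigcirc\rangle_3=d^2$, but $\langle K_m\rangle_3\ne\langle \bigcirc\rangle_3$, namely $$\begin{aligned}\langle K_m\rangle_3={}&-A^{-60}+A^{-56}+2A^{-54}+5A^{-52}+10A^{-50}+21A^{-48}+25A^{-46}+26A^{-44}\\ &+21A^{-42}+8A^{-40}-19A^{-38}-69A^{-36}-115A^{-34}-155A^{-32}-175A^{-30}-172A^{-28}\\ &-127A^{-26}-23A^{-24}+109A^{-22}+244A^{-20}+366A^{-18}+440A^{-16}+452A^{-14}+372A^{-12}\\ &+207A^{-10}+23A^{-8}-199A^{-6}-358A^{-4}-486A^{-2}-527-460A^{2}-364A^{4}\\ &-187A^{6}-58A^{8}+96A^{10}+208A^{12}+250A^{14}+269A^{16}+222A^{18}+200A^{20}\\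 &+131A^{22}+71A^{24}+21A^{26}-15A^{28}-29A^{30}-54A^{32}-51A^{34}-48A^{36}\\ &-36A^{38}-28A^{40}-22A^{42}-10A^{44}-6A^{46}-2A^{48}-A^{50}+A^{54}.\end{aligned}$$ 3. $K_m$ is non-trivial: it is not equivalent to the unknot. -/

import Mathlib

namespace VirtualKnotTheory

/-! ### Diagrams

A diagram is recorded by its vertices. Each edge with label `e` has the two ends `(e, true)` and
`(e, false)`, and a vertex lists the ends that meet there in counterclockwise order in the plane. -/

/-- One of the two ends of the edge with label `h.1`. -/
abbrev HalfEdge (L : Type) : Type := L × Bool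

/-- The other end of the same edge. -/
def HalfEdge.flip {L : Type} (h : HalfEdge L) : HalfEdge L := (h.1, !h.2)

/-- The vertices of a diagram, with the ends at the vertex in counterclockwise order.
`classical a b c d`: the strand from `a` to `c` passes under the strand from `b` to `d`.
`virtual a b c d`: the strand from `a` to `c` and the strand from `b` to `d` cross virtually.
`point a b`: a marked point in the interior of a strand, where `a` and `b` meet (no crossing);
a marked point makes it possible to draw a circle without crossings. -/
inductive Vertex (L : Type) : Type
  | classical (a b c d : HalfEdge L)
  | virtual (a b c d : HalfEdge L)
  | point (a b : HalfEdge L)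

/-- A virtual link diagram, as the list of its vertices. -/
abbrev Diagram (L : Type) : Type := List (Vertex L)

/-- The ends at a vertex, counterclockwise. -/
def Vertex.ends {L : Type} : Vertex L → List (HalfEdge L)
  | .classical a b c d => [a, b, c, d]
  | .virtual a b c d => [a, b, c, d]
  | .point a b => [a, b]

/-- Rename the ends at a vertex. -/
def Vertex.map {L M : Type} (f : HalfEdge L → HalfEdge M) : Vertex L → Vertex M
  | .classical a b c d => .classical (f a) (f b) (f c) (f d)
  | .virtual a b c d => .virtual (f a) (f b) (f c) (f d)
  | .point a b => .point (f a) (f b)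

/-- The pairs of ends that are joined when one walks straight through a vertex. -/
def Vertex.strands {L : Type} : Vertex L → List (HalfEdge L × HalfEdge L)
  | .classical a b c d => [(a, c), (b, d)]
  | .virtual a b c d => [(a, c), (b, d)]
  | .point a b => [(a, b)]

/-- All ends of all vertices of a diagram. -/
def ends {L : Type} (D : Diagram L) : List (HalfEdge L) := D.flatMap Vertex.ends

/-- The number of classes of the equivalence relation generated by a list of pairs, on the
elements that occur in the list. -/
noncomputable def numClasses {α : Type} (l : List (α × α)) : ℕ :=
  (Quot.mk (fun x y => (x, y) ∈ l) '' {x | ∃ p ∈ l, x = p.1 ∨ x = p.2}).ncard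

/-- The number of closed curves that arise when the ends of the edges are joined as listed: two
edges lie on the same curve if they are connected by a chain of joins. -/
noncomputable def numCurves {L : Type} (joins : List (HalfEdge L × HalfEdge L)) : ℕ :=
  numClasses (joins.map fun p => (p.1.1, p.2.1))

/-- The number of components of the link that a diagram shows. -/
noncomputable def numComponents {L : Type} (D : Diagram L) : ℕ :=
  numCurves (D.flatMap Vertex.strands)

/-- Pairs `(p, q.flip)`, where `q` is the counterclockwise successor of `p` at the vertex. If `p`
stands for the corner between `p` and `q`, the two entries are consecutive corners of a face. -/
def Vertex.corners {L : Type} : Vertex L → List (HalfEdge L × HalfEdge L)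
  | .classical a b c d => [(a, b.flip), (b, c.flip), (c, d.flip), (d, a.flip)]
  | .virtual a b c d => [(a, b.flip), (b, c.flip), (c, d.flip), (d, a.flip)]
  | .point a b => [(a, b.flip), (b, a.flip)]

/-- The number of faces of a diagram (its complementary regions, if it is connected). -/
noncomputable def numFaces {L : Type} (D : Diagram L) : ℕ :=
  numClasses (D.flatMap Vertex.corners)

/-- The vertex list describes an immersed circle in the plane with classical and virtual crossings:
the ends of the edges are used exactly once each, walking along the strands there is only one
component, and the diagram is planar, `V - E + F = 2`. -/
structure IsVirtualKnotDiagram {L : Type} (D : Diagram L) : Prop where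
  nodup : (ends D).Nodup
  flip_mem : ∀ h ∈ ends D, h.flip ∈ ends D
  one_component : numComponents D = 1
  planar : D.length + numFaces D = (ends D).length / 2 + 2

/-- A virtual knot diagram in the plane. -/
structure VirtualKnotDiagram : Type where
  vertices : Diagram ℕ
  isDiagram : IsVirtualKnotDiagram vertices

/-! ### Reidemeister moves and virtual equivalence -/

/-- The local moves: the first tangle is replaced by the second one. The ends `a, b, c, ...` lead
out of the tangle, the edges `x, y, z` lie inside. -/
inductive LocalMove : Diagram ℕ → Diagram ℕ → Prop
  -- The presentation of a vertex: the ends may be listed from any starting point.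
  | rotateClassical (a b c d : HalfEdge ℕ) :
      LocalMove [.classical a b c d] [.classical c d a b]
  | rotateVirtual (a b c d : HalfEdge ℕ) :
      LocalMove [.virtual a b c d] [.virtual b c d a]
  | rotatePoint (a b : HalfEdge ℕ) : LocalMove [.point a b] [.point b a]
  -- A marked point is inserted on the edge with end `a` at the vertex `v`.
  | subdivide (v : Vertex ℕ) (a : HalfEdge ℕ) (x : ℕ) (ha : a ∈ v.ends) :
      LocalMove [v] [v.map (fun h => if h = a then (x, true) else h), .point (x, false) a]
  -- Reidemeister I, for the two kinds of kinks.
  | reidemeister1 (a b : HalfEdge ℕ) (x : ℕ) :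
      LocalMove [.classical (x, true) (x, false) a b] [.point a b]
  | reidemeister1' (a b : HalfEdge ℕ) (x : ℕ) :
      LocalMove [.classical a (x, true) (x, false) b] [.point a b]
  -- Reidemeister II: the strand `c`-`d` passes over the strand `a`-`b` and back.
  | reidemeister2 (a b c d : HalfEdge ℕ) (x y : ℕ) :
      LocalMove [.classical a c (x, true) (y, true), .classical (x, false) d b (y, false)]
        [.point a b, .point c d]
  -- Reidemeister III: the strand `f`-`c` passes over the crossing of `a`-`d` and `b`-`e`
  -- (the ends of the tangle are `a, b, c, d, e, f` in counterclockwise order).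
  | reidemeister3 (a b c d e f : HalfEdge ℕ) (x y z : ℕ) :
      LocalMove
        [.classical a (y, true) (x, true) f, .classical b c (z, true) (y, false),
          .classical (x, false) (z, false) d e]
        [.classical a b (x, true) (z, true), .classical (z, false) (y, true) e f,
          .classical (x, false) c d (y, false)]
  | reidemeister3' (a b c d e f : HalfEdge ℕ) (x y z : ℕ) :
      LocalMove
        [.classical a (y, true) (x, true) f, .classical b c (z, true) (y, false),
          .classical (z, false) d e (x, false)]
        [.classical b (x, true) (z, true) a, .classical (z, false) (y, true) e f,
          .classical (x, false) c d (y, false)]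
  -- Virtual Reidemeister moves I, II and III: all crossings are virtual.
  | virtual1 (a b : HalfEdge ℕ) (x : ℕ) :
      LocalMove [.virtual (x, true) (x, false) a b] [.point a b]
  | virtual2 (a b c d : HalfEdge ℕ) (x y : ℕ) :
      LocalMove [.virtual a c (x, true) (y, true), .virtual (x, false) d b (y, false)]
        [.point a b, .point c d]
  | virtual3 (a b c d e f : HalfEdge ℕ) (x y z : ℕ) :
      LocalMove
        [.virtual a (y, true) (x, true) f, .virtual b c (z, true) (y, false),
          .virtual (x, false) (z, false) d e]
        [.virtual a b (x, true) (z, true), .virtual (z, false) (y, true) e f,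
          .virtual (x, false) c d (y, false)]
  -- Virtual Reidemeister move IV: the strand `f`-`c` passes virtually across a classical crossing.
  | virtual4 (a b c d e f : HalfEdge ℕ) (x y z : ℕ) :
      LocalMove
        [.virtual a (y, true) (x, true) f, .virtual b c (z, true) (y, false),
          .classical (x, false) (z, false) d e]
        [.classical a b (x, true) (z, true), .virtual (z, false) (y, true) e f,
          .virtual (x, false) c d (y, false)]
  | virtual4' (a b c d e f : HalfEdge ℕ) (x y z : ℕ) :
      LocalMove
        [.virtual a (y, true) (x, true) f, .virtual b c (z, true) (y, false),
          .classical (z, false) d e (x, false)]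
        [.classical b (x, true) (z, true) a, .virtual (z, false) (y, true) e f,
          .virtual (x, false) c d (y, false)]

/-- One step between vertex lists: reorder the list, rename the edges, or apply a local move. -/
inductive Step : Diagram ℕ → Diagram ℕ → Prop
  | perm {D D' : Diagram ℕ} (h : D.Perm D') : Step D D'
  | rename (D : Diagram ℕ) (f : Equiv.Perm (HalfEdge ℕ)) (hf : ∀ h, f h.flip = (f h).flip) :
      Step D (D.map (Vertex.map f))
  | move {T T' : Diagram ℕ} (h : LocalMove T T') (rest : Diagram ℕ) : Step (T ++ rest) (T' ++ rest)

/-- Virtual equivalence: a sequence of moves, or of their inverses, through virtual knot diagrams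
in the plane leads from one diagram to the other. -/
def VirtuallyEquivalent : VirtualKnotDiagram → VirtualKnotDiagram → Prop :=
  Relation.EqvGen fun K K' => Step K.vertices K'.vertices

/-! ### The bracket polynomial -/

/-- A smoothing of all classical crossings of a diagram: `c` is the number of smoothings of type
`α` minus the number of smoothings of type `β`, and `joins` lists the ends that are joined. -/
structure State (L : Type) : Type where
  c : ℤ
  joins : List (HalfEdge L × HalfEdge L)

/-- All states of a diagram; a diagram with `n` classical crossings has `2 ^ n` states. The smoothing
of type `α` of `classical a b c d` opens the two regions that the overstrand `b`-`d` sweeps out when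
it is turned counterclockwise: it joins `a` to `b` and `c` to `d`. -/
def states {L : Type} : Diagram L → List (State L)
  | [] => [⟨0, []⟩]
  | .classical a b c d :: D => (states D).flatMap fun s =>
      [⟨s.c + 1, (a, b) :: (c, d) :: s.joins⟩, ⟨s.c - 1, (a, d) :: (b, c) :: s.joins⟩]
  | .virtual a b c d :: D => (states D).map fun s => ⟨s.c, (a, c) :: (b, d) :: s.joins⟩
  | .point a b :: D => (states D).map fun s => ⟨s.c, (a, b) :: s.joins⟩

open LaurentPolynomial in
/-- The loop value `d = -A ^ (-2) - A ^ 2`, where `A` is `T 1`. -/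
noncomputable def d : LaurentPolynomial ℤ := -T (-2) - T 2

open LaurentPolynomial in
/-- The bracket polynomial: the sum over all states `s` of `A ^ c(s) * d ^ (|s| - 1)`, where `|s|` is
the number of closed curves of `s`. -/
noncomputable def bracket {L : Type} (D : Diagram L) : LaurentPolynomial ℤ :=
  ((states D).map fun s => T s.c * d ^ (numCurves s.joins - 1)).sum

/-! ### The `N`-strand bracket polynomial -/

/-- Labels for the edges of the diagram formed by `N` parallel copies: the copies of an old edge, and
the edges in the grid of `N * N` crossings that replaces a crossing. A grid is identified by the
first end `g` of the old crossing. -/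
inductive CableLabel (L : Type) : Type
  | strand (e : L) (m : ℕ)
  | vertical (g : HalfEdge L) (i j : ℕ)
  | horizontal (g : HalfEdge L) (i j : ℕ)

/-- The ends of the `N` copies of an edge are numbered `0, ..., N - 1` counterclockwise around the
vertex where they arrive. Parallel copies appear in opposite orders at the two ends of an edge. -/
def copy {L : Type} (N : ℕ) (h : HalfEdge L) (m : ℕ) : HalfEdge (CableLabel L) :=
  (.strand h.1 (if h.2 then m else N - 1 - m), h.2)

/-- The grid of `N * N` crossings that replaces a crossing with ends `a` (bottom), `b` (right),
`c` (top), `e` (left). The crossing in column `i` (from the left) and row `j` (from the bottom) has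
the ends bottom, right, top, left. -/
def grid {L : Type} (N : ℕ)
    (mk : HalfEdge (CableLabel L) → HalfEdge (CableLabel L) → HalfEdge (CableLabel L) →
      HalfEdge (CableLabel L) → Vertex (CableLabel L))
    (a b c e : HalfEdge L) : Diagram (CableLabel L) :=
  (List.range N).flatMap fun i => (List.range N).map fun j =>
    mk (if j = 0 then copy N a i else (.vertical a i j, false))
      (if i + 1 = N then copy N b j else (.horizontal a (i + 1) j, true))
      (if j + 1 = N then copy N c (N - 1 - i) else (.vertical a i (j + 1), true))
      (if i = 0 then copy N e (N - 1 - j) else (.horizontal a i j, false))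

/-- The part of the `N`-strand diagram that replaces a vertex. -/
def cableVertex {L : Type} (N : ℕ) : Vertex L → Diagram (CableLabel L)
  | .classical a b c e => grid N .classical a b c e
  | .virtual a b c e => grid N .virtual a b c e
  | .point a b => (List.range N).map fun m => .point (copy N a m) (copy N b (N - 1 - m))

/-- The diagram formed by `N` parallel copies of a diagram. -/
def cable {L : Type} (N : ℕ) (D : Diagram L) : Diagram (CableLabel L) :=
  D.flatMap (cableVertex N)

/-- The bracket polynomial of a virtual knot diagram. -/
noncomputable def VirtualKnotDiagram.bracket (K : VirtualKnotDiagram) : LaurentPolynomial ℤ :=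
  VirtualKnotTheory.bracket K.vertices

/-- The `N`-strand bracket polynomial of a virtual knot diagram. -/
noncomputable def VirtualKnotDiagram.bracketN (K : VirtualKnotDiagram) (N : ℕ) :
    LaurentPolynomial ℤ :=
  VirtualKnotTheory.bracket (cable N K.vertices)

/-! ### The two diagrams -/

/-- A criterion to count classes: `par` moves each element along a listed pair or fixes it, and
iterating it `k` times has the same result on both entries of a pair. -/
theorem numClasses_eq {α : Type} [DecidableEq α] (l : List (α × α)) (par : α → α) (k n : ℕ)
    (h1 : ∀ p ∈ l, par^[k] p.1 = par^[k] p.2)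
    (h2 : ∀ x ∈ l.map Prod.fst ++ l.map Prod.snd, par x = x ∨ (x, par x) ∈ l ∨ (par x, x) ∈ l)
    (h3 : (((l.map Prod.fst ++ l.map Prod.snd).map par^[k]).dedup).length = n) :
    numClasses l = n := by
  have hS : {x | ∃ p ∈ l, x = p.1 ∨ x = p.2} = {x | x ∈ l.map Prod.fst ++ l.map Prod.snd} := by
    ext x
    simp only [Set.mem_ofPred_eq, List.mem_append, List.mem_map]
    constructor
    · rintro ⟨p, hp, h | h⟩
      · exact Or.inl ⟨p, hp, h.symm⟩
      · exact Or.inr ⟨p, hp, h.symm⟩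
    · rintro (⟨p, hp, h⟩ | ⟨p, hp, h⟩)
      · exact ⟨p, hp, Or.inl h.symm⟩
      · exact ⟨p, hp, Or.inr h.symm⟩
  have hpar : ∀ x ∈ l.map Prod.fst ++ l.map Prod.snd,
      par x ∈ l.map Prod.fst ++ l.map Prod.snd ∧
        Quot.mk (fun x y => (x, y) ∈ l) (par x) = Quot.mk (fun x y => (x, y) ∈ l) x := by
    intro x hx
    rcases h2 x hx with h | h | h
    · rw [h]; exact ⟨hx, rfl⟩
    · exact ⟨List.mem_append_right _ (List.mem_map.2 ⟨_, h, rfl⟩), (Quot.sound h).symm⟩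
    · exact ⟨List.mem_append_left _ (List.mem_map.2 ⟨_, h, rfl⟩), Quot.sound h⟩
  have hit : ∀ m : ℕ, ∀ x ∈ l.map Prod.fst ++ l.map Prod.snd,
      Quot.mk (fun x y => (x, y) ∈ l) (par^[m] x) = Quot.mk (fun x y => (x, y) ∈ l) x := by
    intro m
    induction m with
    | zero => intro x _; rfl
    | succ m ih =>
      intro x hx
      rw [Function.iterate_succ_apply, ih _ (hpar x hx).1, (hpar x hx).2]
  let F : Quot (fun x y => (x, y) ∈ l) → α := Quot.lift par^[k] (fun x y h => h1 (x, y) h)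
  have hinj : Set.InjOn F (Quot.mk (fun x y => (x, y) ∈ l) ''
      {x | x ∈ l.map Prod.fst ++ l.map Prod.snd}) := by
    rintro _ ⟨x, hx, rfl⟩ _ ⟨y, hy, rfl⟩ hxy
    have hxy' : par^[k] x = par^[k] y := hxy
    rw [← hit k x hx, ← hit k y hy, hxy']
  unfold numClasses
  rw [hS, ← hinj.ncard_image, Set.image_image, ← h3, ← List.card_toFinset,
    ← Set.ncard_coe_finset]
  congr 1
  ext z
  simp only [Set.mem_image, List.coe_toFinset, Set.mem_ofPred_eq, List.mem_map]
  rfl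

/-- The round circle: the standard diagram of the unknot. -/
def unknotVertices : Diagram ℕ := [.point (0, true) (0, false)]

/-- The vertices of `K_m`: six classical crossings and two virtual crossings. The edges are numbered
`0, ..., 15` along the knot, which runs from `(i, true)` to `(i, false)` on the edge `i`. With the
crossings numbered in the order of the list (7 and 8 are virtual, O is over, U is under, followed by
the sign), the knot runs through
U1+ O2+ V7 O1+ O3- U4- U2+ V7 O4- U3- U5- V8 O6+ O5- V8 U6+. -/
def kmVertices : Diagram ℕ :=
  [.classical (0, false) (4, true) (1, true) (3, false),
    .classical (6, false) (2, true) (7, true) (1, false),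
    .classical (9, false) (4, false) (10, true) (5, true),
    .classical (5, false) (8, false) (6, true) (9, true),
    .classical (10, false) (13, false) (11, true) (14, true),
    .classical (15, false) (13, true) (0, true) (12, false),
    .virtual (2, false) (8, true) (3, true) (7, false),
    .virtual (11, false) (15, true) (12, true) (14, false)]

/-- The unknot. -/
def unknot : VirtualKnotDiagram where
  vertices := unknotVertices
  isDiagram :=
    { nodup := by decide
      flip_mem := by decide
      one_component := numClasses_eq _ id 0 1 (by decide) (by decide) (by decide)
      planar := by
        have h : numFaces unknotVertices = 2 :=
          numClasses_eq _ id 0 2 (by decide) (by decide) (by decide)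
        rw [h]; rfl }

/-- A step along the face of `kmVertices`, which stops at a chosen corner of the face. -/
def kmFaceStep (h : HalfEdge ℕ) : HalfEdge ℕ :=
  if h ∈ [(0, false), (4, true), (1, true), (3, false), (6, false), (2, true), (5, true),
    (13, false), (11, true), (12, false)] then h
  else ((kmVertices.flatMap Vertex.corners).lookup h).getD h

/-- The virtual knot diagram `K_m`. -/
def Km : VirtualKnotDiagram where
  vertices := kmVertices
  isDiagram :=
    { nodup := by decide
      flip_mem := by decide
      one_component := numClasses_eq _ Nat.pred 15 1 (by decide) (by decide) (by decide)
      planar := by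
        have h : numFaces kmVertices = 10 :=
          numClasses_eq _ kmFaceStep 6 10 (by decide +kernel) (by decide +kernel)
            (by decide +kernel)
        rw [h]; rfl }

end VirtualKnotTheory

/-! The theorem has two independent halves.

Non-triviality comes from linear colourings over the field with three elements. The colour of an
edge changes sign with its direction. Along a strand it is negated by every over-passage, changes by
the colour of an overstrand end at every under-passage, and is unaffected by virtual passages; this
is an Alexander biquandle. In each local move the colours at the outer ends determine the inner
ones, and both tangles impose the same relation on the outer ends; for Reidemeister I and III this
needs `3 = 0`. So colourings before and after a move correspond linearly, and the property that any
two of them are dependent (`HasRankOne`) is invariant. It holds for the circle, whereas `K_m` has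
two independent colourings, one on edges 1 to 9 and one on edges 11 to 15.

The bracket values are a verified computation. The 3-strand diagram has 54 classical crossings, so
its `2 ^ 54` states cannot be listed. Instead crossings are smoothed one at a time. A partial
smoothing matters only through the pairing it induces on the edges used so far exactly once, and
partial states with the same pairing are merged, their coefficients being added.
`numClasses_joinPairing` is the combinatorial core: joining two labels updates the pairing and
closes a curve exactly when the two resulting arc ends coincide. `stateSum_shift` turns this into a
statement about weighted sums, and `run_eq` says that the merged table represents the full state
sum.

Coefficients are integers modulo a single large `M`, not polynomials. After multiplication by `d`
and a power of `A`, the bracket is a Laurent polynomial in `X = A ^ 2`; it is evaluated at `X = 2 ^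
200` modulo `M = X * y - 1`, so that `y` is the inverse of `X`. The coefficients and exponents are
bounded a priori, and `M` exceeds every integer that a polynomial within these bounds can produce.
Hence the residue determines the polynomial, as digits in base `X` (`IsBounded.eq_zero`).
`bracket_eq_of_check` combines everything, and the kernel evaluates `check`. -/

namespace VirtualKnotTheory

/-! ### Colourings and linear dependence -/

/-- The condition that a colouring of the ends has to satisfy at a vertex. -/
def Vertex.Colored {F : Type} [CommRing F] (y : HalfEdge ℕ → F) : Vertex ℕ → Prop
  | .classical a b c d => y b = y d ∧ y a + y c = y b
  | .virtual a b c d => y c = -y a ∧ y d = -y b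
  | .point a b => y b = -y a

/-- A colouring of a diagram: reversing an end negates its colour, the ends of an overstrand have
the same colour, and this is the sum of the colours at the ends of the understrand. -/
structure IsColoring {F : Type} [CommRing F] (D : Diagram ℕ) (y : HalfEdge ℕ → F) : Prop where
  flip : ∀ h, y h.flip = -y h
  colored : ∀ v ∈ D, v.Colored y

/-- Any two colourings are linearly dependent. -/
def HasRankOne (F : Type) [CommRing F] (D : Diagram ℕ) : Prop :=
  ∀ y₁ y₂ : HalfEdge ℕ → F, IsColoring D y₁ → IsColoring D y₂ →
    ∃ r s : F, (r ≠ 0 ∨ s ≠ 0) ∧ ∀ h ∈ ends D, r * y₁ h + s * y₂ h = 0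

section Coloring

variable {F : Type} [CommRing F]

theorem IsColoring.combination {D : Diagram ℕ} {y₁ y₂ : HalfEdge ℕ → F}
    (h₁ : IsColoring D y₁) (h₂ : IsColoring D y₂) (r s : F) :
    IsColoring D (fun h => r * y₁ h + s * y₂ h) where
  flip h := by rw [h₁.flip, h₂.flip]; ring
  colored v hv := by
    have e₁ := h₁.colored v hv
    have e₂ := h₂.colored v hv
    cases v with
    | classical a b c d =>
      refine ⟨?_, ?_⟩
      · linear_combination r * e₁.1 + s * e₂.1
      · linear_combination r * e₁.2 + s * e₂.2
    | virtual a b c d =>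
      refine ⟨?_, ?_⟩
      · linear_combination r * e₁.1 + s * e₂.1
      · linear_combination r * e₁.2 + s * e₂.2
    | point a b =>
      simp only [Vertex.Colored] at *
      linear_combination r * e₁ + s * e₂

/-- A linear map between the colourings of two diagrams, injective on the ends of the diagrams,
transports linear dependence. -/
theorem HasRankOne.of_linear {D D' : Diagram ℕ} (h : HasRankOne F D')
    (φ : (HalfEdge ℕ → F) →ₗ[F] (HalfEdge ℕ → F))
    (hφ : ∀ y, IsColoring D y → IsColoring D' (φ y))
    (hinj : ∀ y, IsColoring D y → (∀ e ∈ ends D', φ y e = 0) → ∀ e ∈ ends D, y e = 0) :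
    HasRankOne F D := by
  intro y₁ y₂ h₁ h₂
  obtain ⟨r, s, hrs, h0⟩ := h _ _ (hφ _ h₁) (hφ _ h₂)
  refine ⟨r, s, hrs, hinj _ (h₁.combination h₂ r s) fun e he => ?_⟩
  have : (fun h => r * y₁ h + s * y₂ h) = r • y₁ + s • y₂ := by
    funext h; simp
  rw [this, map_add, map_smul, map_smul]
  simpa using h0 e he

theorem Vertex.Colored.congr {v : Vertex ℕ} {y y' : HalfEdge ℕ → F} (hv : v.Colored y)
    (h : ∀ e ∈ v.ends, y' e = y e) : v.Colored y' := by
  cases v <;> simp_all [Vertex.Colored, Vertex.ends]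

/-- Replacing a tangle preserves linear dependence if the colours of the edges inside the new
tangle are determined linearly by the colours outside, and vice versa. -/
theorem HasRankOne.of_tangle {T T' rest : Diagram ℕ} (h : HasRankOne F (T' ++ rest))
    (φ : (HalfEdge ℕ → F) →ₗ[F] (HalfEdge ℕ → F))
    (hrest : ∀ y, ∀ e ∈ ends rest, φ y e = y e)
    (hφ : ∀ y, IsColoring T y → IsColoring T' (φ y))
    (hinj : ∀ y, IsColoring T y → (∀ e ∈ ends T', φ y e = 0) → ∀ e ∈ ends T, y e = 0) :
    HasRankOne F (T ++ rest) := by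
  have hT : ∀ y : HalfEdge ℕ → F, IsColoring (T ++ rest) y → IsColoring T y := fun y hy =>
    ⟨hy.flip, fun v hv => hy.colored v (List.mem_append_left _ hv)⟩
  refine h.of_linear φ (fun y hy => ⟨(hφ y (hT y hy)).flip, fun v hv => ?_⟩) fun y hy h0 e he => ?_
  · rcases List.mem_append.1 hv with hv | hv
    · exact (hφ y (hT y hy)).colored v hv
    · exact (hy.colored v (List.mem_append_right _ hv)).congr fun e he =>
        hrest y e (List.mem_flatMap.2 ⟨v, hv, he⟩)
  · simp only [ends, List.flatMap_append, List.mem_append] at he h0 hrest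
    rcases he with he | he
    · exact hinj y (hT y hy) (fun e he => h0 e (Or.inl he)) e he
    · rw [← hrest y e he]
      exact h0 e (Or.inr he)


/-- Change the colours of the edges in `X`. -/
def recolor (X : List ℕ) (G : ℕ → (HalfEdge ℕ → F) →ₗ[F] F) :
    (HalfEdge ℕ → F) →ₗ[F] (HalfEdge ℕ → F) where
  toFun y h := if h.1 ∈ X then (if h.2 then G h.1 y else -G h.1 y) else y h
  map_add' y z := by
    funext h
    by_cases h1 : h.1 ∈ X <;> by_cases h2 : h.2 <;> simp [h1, h2, add_comm]
  map_smul' r y := by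
    funext h
    by_cases h1 : h.1 ∈ X <;> by_cases h2 : h.2 <;> simp [h1, h2]

theorem recolor_flip (X : List ℕ) (G : ℕ → (HalfEdge ℕ → F) →ₗ[F] F) {y : HalfEdge ℕ → F}
    (hy : ∀ h, y h.flip = -y h) (h : HalfEdge ℕ) : recolor X G y h.flip = -recolor X G y h := by
  rcases h with ⟨e, b⟩
  have h2 := hy (e, b)
  simp only [HalfEdge.flip] at h2
  cases b <;> by_cases h1 : e ∈ X <;> simp [recolor, HalfEdge.flip, h1, ← h2]

/-- The two ends of each edge in a list. -/
def bothEnds (X : List ℕ) : List (HalfEdge ℕ) := X.flatMap fun x => [(x, true), (x, false)]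

theorem mem_bothEnds {X : List ℕ} {h : HalfEdge ℕ} : h ∈ bothEnds X ↔ h.1 ∈ X := by
  rcases h with ⟨e, b⟩
  cases b <;> simp [bothEnds]

/-- Since no end is used twice in the new diagram, the labels in `X` occur neither among the outer
ends nor in `rest`, so changing their colours disturbs nothing outside the tangle. `G` expresses the
inner colours of `T'` through the given colouring. `hinj` says that the outer colours determine all
colours of `T`, which makes the transport injective. -/
theorem HasRankOne.of_outer {T T' rest : Diagram ℕ} (X : List ℕ) (outer : List (HalfEdge ℕ))
    (G : ℕ → (HalfEdge ℕ → F) →ₗ[F] F) (hT' : (ends T').Perm (bothEnds X ++ outer))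
    (hn : (ends (T' ++ rest)).Nodup)
    (hφ : ∀ w w' : HalfEdge ℕ → F, (∀ h, w h.flip = -w h) → (∀ h, w' h.flip = -w' h) →
      (∀ e ∈ outer, w' e = w e) → (∀ x ∈ X, w' (x, true) = G x w) →
      (∀ v ∈ T, v.Colored w) → ∀ v ∈ T', v.Colored w')
    (hinj : ∀ w : HalfEdge ℕ → F, (∀ h, w h.flip = -w h) → (∀ v ∈ T, v.Colored w) →
      (∀ e ∈ outer, w e = 0) → ∀ e ∈ ends T, w e = 0)
    (h : HasRankOne F (T' ++ rest)) : HasRankOne F (T ++ rest) := by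
  rw [ends, List.flatMap_append, List.nodup_append] at hn
  have hn1 := hT'.nodup_iff.1 hn.1
  rw [List.nodup_append] at hn1
  have houter : ∀ y, ∀ e ∈ outer, recolor X G y e = y e := fun y e he =>
    if_neg fun h1 => hn1.2.2 e (mem_bothEnds.2 h1) e he rfl
  refine h.of_tangle (recolor X G) (fun y e he => if_neg fun h1 => ?_)
    (fun y hy => ⟨recolor_flip X G hy.flip, hφ y _ hy.flip (recolor_flip X G hy.flip) (houter y)
      (fun x hx => ?_) hy.colored⟩)
    fun y hy h0 => hinj y hy.flip hy.colored fun e he => ?_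
  · exact hn.2.2 e (hT'.mem_iff.2 (List.mem_append_left _ (mem_bothEnds.2 h1))) e he rfl
  · simp [recolor, hx]
  · rw [← houter y e he]
    exact h0 e (hT'.mem_iff.2 (List.mem_append_right _ he))

theorem ne_label {x : ℕ} {h : HalfEdge ℕ} (h1 : h ≠ (x, true)) (h2 : h ≠ (x, false)) :
    h.1 ≠ x := by
  rcases h with ⟨e, b⟩
  cases b <;> simp_all

theorem fresh_rest {T rest : Diagram ℕ} (h : (ends (T ++ rest)).Nodup) (x : ℕ)
    (h1 : (x, true) ∈ ends T) (h2 : (x, false) ∈ ends T) : ∀ e ∈ ends rest, e.1 ≠ x := by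
  intro e he
  rw [ends, List.flatMap_append, List.nodup_append] at h
  exact ne_label (h.2.2 _ h1 _ he).symm (h.2.2 _ h2 _ he).symm

theorem nodup_left {T rest : Diagram ℕ} (h : (ends (T ++ rest)).Nodup) : (ends T).Nodup := by
  rw [ends, List.flatMap_append, List.nodup_append] at h
  exact h.1

/-- The common shape of all third and fourth moves: six outer ends and three inner edges. The
membership conditions of `of_outer` are unpacked into separate equations, which leaves finite linear
systems. -/
theorem HasRankOne.of_triangle {T T' rest : Diagram ℕ} (x y z : ℕ) (a b c d e f : HalfEdge ℕ)
    (gx gy gz : (HalfEdge ℕ → F) →ₗ[F] F)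
    (hT' : (ends T').Perm [(x, true), (x, false), (y, true), (y, false), (z, true), (z, false),
      a, b, c, d, e, f])
    (hn : (ends (T' ++ rest)).Nodup)
    (hφ : ∀ w w' : HalfEdge ℕ → F, (∀ i, w (i, false) = -w (i, true)) →
      (∀ i, w' (i, false) = -w' (i, true)) →
      w' a = w a → w' b = w b → w' c = w c → w' d = w d → w' e = w e → w' f = w f →
      w' (x, true) = gx w → w' (y, true) = gy w → w' (z, true) = gz w →
      (∀ v ∈ T, v.Colored w) → ∀ v ∈ T', v.Colored w')
    (hinj : ∀ w : HalfEdge ℕ → F, (∀ i, w (i, false) = -w (i, true)) → (∀ v ∈ T, v.Colored w) →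
      w a = 0 → w b = 0 → w c = 0 → w d = 0 → w e = 0 → w f = 0 → ∀ e ∈ ends T, w e = 0)
    (h : HasRankOne F (T' ++ rest)) : HasRankOne F (T ++ rest) := by
  have hxyz := hT'.nodup_iff.1 (nodup_left hn)
  simp only [List.nodup_cons, List.mem_cons, Prod.mk.injEq, not_or] at hxyz
  have hyx : y ≠ x := fun h => by simp [h] at hxyz
  have hzx : z ≠ x := fun h => by simp [h] at hxyz
  have hzy : z ≠ y := fun h => by simp [h] at hxyz
  refine h.of_outer [x, y, z] [a, b, c, d, e, f]
    (fun i => if i = x then gx else if i = y then gy else gz) hT' hn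
    (fun w w' hw hw' ho hX => ?_) fun w hw hc ho => ?_
  · simp only [List.forall_mem_cons, if_true, if_neg hyx, if_neg hzx, if_neg hzy] at ho hX
    exact hφ w w' (fun i => hw (i, true)) (fun i => hw' (i, true)) ho.1 ho.2.1 ho.2.2.1 ho.2.2.2.1
      ho.2.2.2.2.1 ho.2.2.2.2.2.1 hX.1 hX.2.1 hX.2.2.1
  · simp only [List.forall_mem_cons] at ho
    exact hinj w (fun i => hw (i, true)) hc ho.1 ho.2.1 ho.2.2.1 ho.2.2.2.1 ho.2.2.2.2.1
      ho.2.2.2.2.2.1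

end Coloring
end VirtualKnotTheory

namespace VirtualKnotTheory
-- Invariance of linear dependence under each local move
section Moves

set_option linter.unusedSimpArgs false

variable {F : Type} [CommRing F]

/-- Solving both tangles in terms of `a, b, f` gives the same colours at `c` and `e`. At `d` the
first gives `2f + b - a` and the second `-f + b - a`, which agree because `3 = 0`. -/
theorem hasRankOne_reidemeister3 (h3 : (3 : F) = 0) (a b c d e f : HalfEdge ℕ) (x y z : ℕ)
    (rest : Diagram ℕ)
    (hn₁ : (ends ([.classical a (y, true) (x, true) f, .classical b c (z, true) (y, false),
      .classical (x, false) (z, false) d e] ++ rest)).Nodup)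
    (hn₂ : (ends ([.classical a b (x, true) (z, true), .classical (z, false) (y, true) e f,
      .classical (x, false) c d (y, false)] ++ rest)).Nodup) :
    HasRankOne F ([.classical a (y, true) (x, true) f, .classical b c (z, true) (y, false),
      .classical (x, false) (z, false) d e] ++ rest) ↔
      HasRankOne F ([.classical a b (x, true) (z, true), .classical (z, false) (y, true) e f,
      .classical (x, false) c d (y, false)] ++ rest) := by
  refine ⟨fun h => ?_, fun h => ?_⟩
  -- The three linear forms are the inner colours of the target tangle, solved from its vertex
  -- equations; the other moves use the same recipe.
  · refine h.of_triangle x y z a b c d e f (.proj f - .proj a) (.proj f) (-.proj e) ?_ hn₁ ?_ ?_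
    · refine List.perm_iff_count.2 fun t => ?_
      simp only [ends, bothEnds, Vertex.ends, List.flatMap_cons, List.flatMap_nil, List.cons_append,
        List.nil_append, List.append_nil, List.count_cons]
      ring
    · clear h hn₁ hn₂
      intro w w' hw hw' ha hb hc hd he hf hx hy hz
      simp only [Vertex.Colored, List.forall_mem_cons, List.not_mem_nil, false_implies,
        implies_true, and_true, LinearMap.sub_apply, LinearMap.neg_apply, LinearMap.proj_apply] at *
      grind only
    · clear h hn₁ hn₂
      intro w hw hc
      simp only [Vertex.Colored, List.forall_mem_cons, List.not_mem_nil, false_implies,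
        implies_true, and_true, LinearMap.sub_apply, LinearMap.neg_apply, LinearMap.proj_apply,
        ends, Vertex.ends, List.flatMap_cons, List.flatMap_nil, List.cons_append,
        List.nil_append] at *
      grind only
  · refine h.of_triangle x y z a b c d e f (.proj b - .proj a) (.proj f) (.proj b) ?_ hn₂ ?_ ?_
    · refine List.perm_iff_count.2 fun t => ?_
      simp only [ends, bothEnds, Vertex.ends, List.flatMap_cons, List.flatMap_nil, List.cons_append,
        List.nil_append, List.append_nil, List.count_cons]
      ring
    · clear h hn₁ hn₂
      intro w w' hw hw' ha hb hc hd he hf hx hy hz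
      simp only [Vertex.Colored, List.forall_mem_cons, List.not_mem_nil, false_implies,
        implies_true, and_true, LinearMap.sub_apply, LinearMap.neg_apply, LinearMap.proj_apply] at *
      grind only
    · clear h hn₁ hn₂
      intro w hw hc
      simp only [Vertex.Colored, List.forall_mem_cons, List.not_mem_nil, false_implies,
        implies_true, and_true, LinearMap.sub_apply, LinearMap.neg_apply, LinearMap.proj_apply,
        ends, Vertex.ends, List.flatMap_cons, List.flatMap_nil, List.cons_append,
        List.nil_append] at *
      grind only


theorem hasRankOne_reidemeister3' (h3 : (3 : F) = 0) (a b c d e f : HalfEdge ℕ) (x y z : ℕ)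
    (rest : Diagram ℕ)
    (hn₁ : (ends ([.classical a (y, true) (x, true) f, .classical b c (z, true) (y, false),
      .classical (z, false) d e (x, false)] ++ rest)).Nodup)
    (hn₂ : (ends ([.classical b (x, true) (z, true) a, .classical (z, false) (y, true) e f,
      .classical (x, false) c d (y, false)] ++ rest)).Nodup) :
    HasRankOne F ([.classical a (y, true) (x, true) f, .classical b c (z, true) (y, false),
      .classical (z, false) d e (x, false)] ++ rest) ↔
      HasRankOne F ([.classical b (x, true) (z, true) a, .classical (z, false) (y, true) e f,
      .classical (x, false) c d (y, false)] ++ rest) := by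
  refine ⟨fun h => ?_, fun h => ?_⟩
  · refine h.of_triangle x y z a b c d e f (.proj f - .proj a) (.proj f) (.proj c - .proj b) ?_ hn₁ ?_ ?_
    · refine List.perm_iff_count.2 fun t => ?_
      simp only [ends, bothEnds, Vertex.ends, List.flatMap_cons, List.flatMap_nil, List.cons_append,
        List.nil_append, List.append_nil, List.count_cons]
      ring
    · clear h hn₁ hn₂
      intro w w' hw hw' ha hb hc hd he hf hx hy hz
      simp only [Vertex.Colored, List.forall_mem_cons, List.not_mem_nil, false_implies,
        implies_true, and_true, LinearMap.sub_apply, LinearMap.neg_apply, LinearMap.proj_apply] at *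
      grind only
    · clear h hn₁ hn₂
      intro w hw hc
      simp only [Vertex.Colored, List.forall_mem_cons, List.not_mem_nil, false_implies,
        implies_true, and_true, LinearMap.sub_apply, LinearMap.neg_apply, LinearMap.proj_apply,
        ends, Vertex.ends, List.flatMap_cons, List.flatMap_nil, List.cons_append,
        List.nil_append] at *
      grind only
  · refine h.of_triangle x y z a b c d e f (.proj a) (.proj f) (.proj a - .proj b) ?_ hn₂ ?_ ?_
    · refine List.perm_iff_count.2 fun t => ?_
      simp only [ends, bothEnds, Vertex.ends, List.flatMap_cons, List.flatMap_nil, List.cons_append,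
        List.nil_append, List.append_nil, List.count_cons]
      ring
    · clear h hn₁ hn₂
      intro w w' hw hw' ha hb hc hd he hf hx hy hz
      simp only [Vertex.Colored, List.forall_mem_cons, List.not_mem_nil, false_implies,
        implies_true, and_true, LinearMap.sub_apply, LinearMap.neg_apply, LinearMap.proj_apply] at *
      grind only
    · clear h hn₁ hn₂
      intro w hw hc
      simp only [Vertex.Colored, List.forall_mem_cons, List.not_mem_nil, false_implies,
        implies_true, and_true, LinearMap.sub_apply, LinearMap.neg_apply, LinearMap.proj_apply,
        ends, Vertex.ends, List.flatMap_cons, List.flatMap_nil, List.cons_append,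
        List.nil_append] at *
      grind only


theorem hasRankOne_virtual3 (h3 : (3 : F) = 0) (a b c d e f : HalfEdge ℕ) (x y z : ℕ)
    (rest : Diagram ℕ)
    (hn₁ : (ends ([.virtual a (y, true) (x, true) f, .virtual b c (z, true) (y, false),
      .virtual (x, false) (z, false) d e] ++ rest)).Nodup)
    (hn₂ : (ends ([.virtual a b (x, true) (z, true), .virtual (z, false) (y, true) e f,
      .virtual (x, false) c d (y, false)] ++ rest)).Nodup) :
    HasRankOne F ([.virtual a (y, true) (x, true) f, .virtual b c (z, true) (y, false),
      .virtual (x, false) (z, false) d e] ++ rest) ↔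
      HasRankOne F ([.virtual a b (x, true) (z, true), .virtual (z, false) (y, true) e f,
      .virtual (x, false) c d (y, false)] ++ rest) := by
  refine ⟨fun h => ?_, fun h => ?_⟩
  · refine h.of_triangle x y z a b c d e f (-.proj a) (-.proj f) (-.proj b) ?_ hn₁ ?_ ?_
    · refine List.perm_iff_count.2 fun t => ?_
      simp only [ends, bothEnds, Vertex.ends, List.flatMap_cons, List.flatMap_nil, List.cons_append,
        List.nil_append, List.append_nil, List.count_cons]
      ring
    · clear h hn₁ hn₂
      intro w w' hw hw' ha hb hc hd he hf hx hy hz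
      simp only [Vertex.Colored, List.forall_mem_cons, List.not_mem_nil, false_implies,
        implies_true, and_true, LinearMap.sub_apply, LinearMap.neg_apply, LinearMap.proj_apply] at *
      grind only
    · clear h hn₁ hn₂
      intro w hw hc
      simp only [Vertex.Colored, List.forall_mem_cons, List.not_mem_nil, false_implies,
        implies_true, and_true, LinearMap.sub_apply, LinearMap.neg_apply, LinearMap.proj_apply,
        ends, Vertex.ends, List.flatMap_cons, List.flatMap_nil, List.cons_append,
        List.nil_append] at *
      grind only
  · refine h.of_triangle x y z a b c d e f (-.proj a) (-.proj f) (-.proj b) ?_ hn₂ ?_ ?_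
    · refine List.perm_iff_count.2 fun t => ?_
      simp only [ends, bothEnds, Vertex.ends, List.flatMap_cons, List.flatMap_nil, List.cons_append,
        List.nil_append, List.append_nil, List.count_cons]
      ring
    · clear h hn₁ hn₂
      intro w w' hw hw' ha hb hc hd he hf hx hy hz
      simp only [Vertex.Colored, List.forall_mem_cons, List.not_mem_nil, false_implies,
        implies_true, and_true, LinearMap.sub_apply, LinearMap.neg_apply, LinearMap.proj_apply] at *
      grind only
    · clear h hn₁ hn₂
      intro w hw hc
      simp only [Vertex.Colored, List.forall_mem_cons, List.not_mem_nil, false_implies,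
        implies_true, and_true, LinearMap.sub_apply, LinearMap.neg_apply, LinearMap.proj_apply,
        ends, Vertex.ends, List.flatMap_cons, List.flatMap_nil, List.cons_append,
        List.nil_append] at *
      grind only


theorem hasRankOne_virtual4 (h3 : (3 : F) = 0) (a b c d e f : HalfEdge ℕ) (x y z : ℕ)
    (rest : Diagram ℕ)
    (hn₁ : (ends ([.virtual a (y, true) (x, true) f, .virtual b c (z, true) (y, false),
      .classical (x, false) (z, false) d e] ++ rest)).Nodup)
    (hn₂ : (ends ([.classical a b (x, true) (z, true), .virtual (z, false) (y, true) e f,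
      .virtual (x, false) c d (y, false)] ++ rest)).Nodup) :
    HasRankOne F ([.virtual a (y, true) (x, true) f, .virtual b c (z, true) (y, false),
      .classical (x, false) (z, false) d e] ++ rest) ↔
      HasRankOne F ([.classical a b (x, true) (z, true), .virtual (z, false) (y, true) e f,
      .virtual (x, false) c d (y, false)] ++ rest) := by
  refine ⟨fun h => ?_, fun h => ?_⟩
  · refine h.of_triangle x y z a b c d e f (-.proj a) (-.proj f) (-.proj b) ?_ hn₁ ?_ ?_
    · refine List.perm_iff_count.2 fun t => ?_
      simp only [ends, bothEnds, Vertex.ends, List.flatMap_cons, List.flatMap_nil, List.cons_append,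
        List.nil_append, List.append_nil, List.count_cons]
      ring
    · clear h hn₁ hn₂
      intro w w' hw hw' ha hb hc hd he hf hx hy hz
      simp only [Vertex.Colored, List.forall_mem_cons, List.not_mem_nil, false_implies,
        implies_true, and_true, LinearMap.sub_apply, LinearMap.neg_apply, LinearMap.proj_apply] at *
      grind only
    · clear h hn₁ hn₂
      intro w hw hc
      simp only [Vertex.Colored, List.forall_mem_cons, List.not_mem_nil, false_implies,
        implies_true, and_true, LinearMap.sub_apply, LinearMap.neg_apply, LinearMap.proj_apply,
        ends, Vertex.ends, List.flatMap_cons, List.flatMap_nil, List.cons_append,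
        List.nil_append] at *
      grind only
  · refine h.of_triangle x y z a b c d e f (.proj b - .proj a) (-.proj f) (.proj b) ?_ hn₂ ?_ ?_
    · refine List.perm_iff_count.2 fun t => ?_
      simp only [ends, bothEnds, Vertex.ends, List.flatMap_cons, List.flatMap_nil, List.cons_append,
        List.nil_append, List.append_nil, List.count_cons]
      ring
    · clear h hn₁ hn₂
      intro w w' hw hw' ha hb hc hd he hf hx hy hz
      simp only [Vertex.Colored, List.forall_mem_cons, List.not_mem_nil, false_implies,
        implies_true, and_true, LinearMap.sub_apply, LinearMap.neg_apply, LinearMap.proj_apply] at *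
      grind only
    · clear h hn₁ hn₂
      intro w hw hc
      simp only [Vertex.Colored, List.forall_mem_cons, List.not_mem_nil, false_implies,
        implies_true, and_true, LinearMap.sub_apply, LinearMap.neg_apply, LinearMap.proj_apply,
        ends, Vertex.ends, List.flatMap_cons, List.flatMap_nil, List.cons_append,
        List.nil_append] at *
      grind only


theorem hasRankOne_virtual4' (h3 : (3 : F) = 0) (a b c d e f : HalfEdge ℕ) (x y z : ℕ)
    (rest : Diagram ℕ)
    (hn₁ : (ends ([.virtual a (y, true) (x, true) f, .virtual b c (z, true) (y, false),
      .classical (z, false) d e (x, false)] ++ rest)).Nodup)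
    (hn₂ : (ends ([.classical b (x, true) (z, true) a, .virtual (z, false) (y, true) e f,
      .virtual (x, false) c d (y, false)] ++ rest)).Nodup) :
    HasRankOne F ([.virtual a (y, true) (x, true) f, .virtual b c (z, true) (y, false),
      .classical (z, false) d e (x, false)] ++ rest) ↔
      HasRankOne F ([.classical b (x, true) (z, true) a, .virtual (z, false) (y, true) e f,
      .virtual (x, false) c d (y, false)] ++ rest) := by
  refine ⟨fun h => ?_, fun h => ?_⟩
  · refine h.of_triangle x y z a b c d e f (-.proj a) (-.proj f) (-.proj b) ?_ hn₁ ?_ ?_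
    · refine List.perm_iff_count.2 fun t => ?_
      simp only [ends, bothEnds, Vertex.ends, List.flatMap_cons, List.flatMap_nil, List.cons_append,
        List.nil_append, List.append_nil, List.count_cons]
      ring
    · clear h hn₁ hn₂
      intro w w' hw hw' ha hb hc hd he hf hx hy hz
      simp only [Vertex.Colored, List.forall_mem_cons, List.not_mem_nil, false_implies,
        implies_true, and_true, LinearMap.sub_apply, LinearMap.neg_apply, LinearMap.proj_apply] at *
      grind only
    · clear h hn₁ hn₂
      intro w hw hc
      simp only [Vertex.Colored, List.forall_mem_cons, List.not_mem_nil, false_implies,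
        implies_true, and_true, LinearMap.sub_apply, LinearMap.neg_apply, LinearMap.proj_apply,
        ends, Vertex.ends, List.flatMap_cons, List.flatMap_nil, List.cons_append,
        List.nil_append] at *
      grind only
  · refine h.of_triangle x y z a b c d e f (.proj a) (-.proj f) (.proj a - .proj b) ?_ hn₂ ?_ ?_
    · refine List.perm_iff_count.2 fun t => ?_
      simp only [ends, bothEnds, Vertex.ends, List.flatMap_cons, List.flatMap_nil, List.cons_append,
        List.nil_append, List.append_nil, List.count_cons]
      ring
    · clear h hn₁ hn₂
      intro w w' hw hw' ha hb hc hd he hf hx hy hz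
      simp only [Vertex.Colored, List.forall_mem_cons, List.not_mem_nil, false_implies,
        implies_true, and_true, LinearMap.sub_apply, LinearMap.neg_apply, LinearMap.proj_apply] at *
      grind only
    · clear h hn₁ hn₂
      intro w hw hc
      simp only [Vertex.Colored, List.forall_mem_cons, List.not_mem_nil, false_implies,
        implies_true, and_true, LinearMap.sub_apply, LinearMap.neg_apply, LinearMap.proj_apply,
        ends, Vertex.ends, List.flatMap_cons, List.flatMap_nil, List.cons_append,
        List.nil_append] at *
      grind only


theorem hasRankOne_reidemeister1 (h3 : (3 : F) = 0) (a b : HalfEdge ℕ) (x : ℕ)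
    (rest : Diagram ℕ)
    (hn₁ : (ends ([.classical (x, true) (x, false) a b] ++ rest)).Nodup)
    (hn₂ : (ends ([.point a b] ++ rest)).Nodup) :
    HasRankOne F ([.classical (x, true) (x, false) a b] ++ rest) ↔
      HasRankOne F ([.point a b] ++ rest) := by
  refine ⟨fun h => ?_, fun h => ?_⟩
  · refine h.of_outer [x] [a, b] (fun _ => -.proj b) ?_ hn₁ ?_ ?_
    · exact .refl _
    · clear h hn₁ hn₂
      intro w w' hw hw' ho hX hc
      replace hw := fun i => hw (i, true)
      replace hw' := fun i => hw' (i, true)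
      simp only [Vertex.Colored, List.forall_mem_cons, List.not_mem_nil, false_implies,
        implies_true, and_true, LinearMap.sub_apply, LinearMap.neg_apply, LinearMap.proj_apply, HalfEdge.flip, Bool.not_true] at *
      grind only
    · clear h hn₁ hn₂
      intro w hw hc ho
      replace hw := fun i => hw (i, true)
      simp only [Vertex.Colored, List.forall_mem_cons, List.not_mem_nil, false_implies,
        implies_true, and_true, LinearMap.sub_apply, LinearMap.neg_apply, LinearMap.proj_apply, HalfEdge.flip, Bool.not_true,
        ends, Vertex.ends, List.flatMap_cons, List.flatMap_nil, List.cons_append,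
        List.nil_append] at *
      grind only
  · refine h.of_outer [] [a, b] 0 ?_ hn₂ ?_ ?_
    · exact .refl _
    · clear h hn₁ hn₂
      intro w w' hw hw' ho hX hc
      replace hw := fun i => hw (i, true)
      replace hw' := fun i => hw' (i, true)
      simp only [Vertex.Colored, List.forall_mem_cons, List.not_mem_nil, false_implies,
        implies_true, and_true, LinearMap.sub_apply, LinearMap.neg_apply, LinearMap.proj_apply, HalfEdge.flip, Bool.not_true] at *
      -- The kink forces the colour at `a` to be twice the colour at `b`; without a crossing it
      -- would be the negative. The two conditions agree modulo 3.
      linear_combination ho.1 + ho.2 + hc.2 - hw x + 2 * hc.1 + w b * h3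
    · clear h hn₁ hn₂
      intro w hw hc ho
      replace hw := fun i => hw (i, true)
      simp only [Vertex.Colored, List.forall_mem_cons, List.not_mem_nil, false_implies,
        implies_true, and_true, LinearMap.sub_apply, LinearMap.neg_apply, LinearMap.proj_apply, HalfEdge.flip, Bool.not_true,
        ends, Vertex.ends, List.flatMap_cons, List.flatMap_nil, List.cons_append,
        List.nil_append] at *
      grind only


theorem hasRankOne_reidemeister1' (h3 : (3 : F) = 0) (a b : HalfEdge ℕ) (x : ℕ)
    (rest : Diagram ℕ)
    (hn₁ : (ends ([.classical a (x, true) (x, false) b] ++ rest)).Nodup)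
    (hn₂ : (ends ([.point a b] ++ rest)).Nodup) :
    HasRankOne F ([.classical a (x, true) (x, false) b] ++ rest) ↔
      HasRankOne F ([.point a b] ++ rest) := by
  refine ⟨fun h => ?_, fun h => ?_⟩
  · refine h.of_outer [x] [a, b] (fun _ => .proj b) ?_ hn₁ ?_ ?_
    · refine List.perm_iff_count.2 fun t => ?_
      simp only [ends, bothEnds, Vertex.ends, List.flatMap_cons, List.flatMap_nil, List.cons_append,
        List.nil_append, List.append_nil, List.count_cons]
      ring
    · clear h hn₁ hn₂
      intro w w' hw hw' ho hX hc
      replace hw := fun i => hw (i, true)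
      replace hw' := fun i => hw' (i, true)
      simp only [Vertex.Colored, List.forall_mem_cons, List.not_mem_nil, false_implies,
        implies_true, and_true, LinearMap.sub_apply, LinearMap.neg_apply, LinearMap.proj_apply, HalfEdge.flip, Bool.not_true] at *
      grind only
    · clear h hn₁ hn₂
      intro w hw hc ho
      replace hw := fun i => hw (i, true)
      simp only [Vertex.Colored, List.forall_mem_cons, List.not_mem_nil, false_implies,
        implies_true, and_true, LinearMap.sub_apply, LinearMap.neg_apply, LinearMap.proj_apply, HalfEdge.flip, Bool.not_true,
        ends, Vertex.ends, List.flatMap_cons, List.flatMap_nil, List.cons_append,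
        List.nil_append] at *
      grind only
  · refine h.of_outer [] [a, b] 0 ?_ hn₂ ?_ ?_
    · exact .refl _
    · clear h hn₁ hn₂
      intro w w' hw hw' ho hX hc
      replace hw := fun i => hw (i, true)
      replace hw' := fun i => hw' (i, true)
      simp only [Vertex.Colored, List.forall_mem_cons, List.not_mem_nil, false_implies,
        implies_true, and_true, LinearMap.sub_apply, LinearMap.neg_apply, LinearMap.proj_apply, HalfEdge.flip, Bool.not_true] at *
      grind only
    · clear h hn₁ hn₂
      intro w hw hc ho
      replace hw := fun i => hw (i, true)
      simp only [Vertex.Colored, List.forall_mem_cons, List.not_mem_nil, false_implies,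
        implies_true, and_true, LinearMap.sub_apply, LinearMap.neg_apply, LinearMap.proj_apply, HalfEdge.flip, Bool.not_true,
        ends, Vertex.ends, List.flatMap_cons, List.flatMap_nil, List.cons_append,
        List.nil_append] at *
      grind only


theorem hasRankOne_virtual1 (h3 : (3 : F) = 0) (a b : HalfEdge ℕ) (x : ℕ)
    (rest : Diagram ℕ)
    (hn₁ : (ends ([.virtual (x, true) (x, false) a b] ++ rest)).Nodup)
    (hn₂ : (ends ([.point a b] ++ rest)).Nodup) :
    HasRankOne F ([.virtual (x, true) (x, false) a b] ++ rest) ↔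
      HasRankOne F ([.point a b] ++ rest) := by
  refine ⟨fun h => ?_, fun h => ?_⟩
  · refine h.of_outer [x] [a, b] (fun _ => -.proj a) ?_ hn₁ ?_ ?_
    · exact .refl _
    · clear h hn₁ hn₂
      intro w w' hw hw' ho hX hc
      replace hw := fun i => hw (i, true)
      replace hw' := fun i => hw' (i, true)
      simp only [Vertex.Colored, List.forall_mem_cons, List.not_mem_nil, false_implies,
        implies_true, and_true, LinearMap.sub_apply, LinearMap.neg_apply, LinearMap.proj_apply, HalfEdge.flip, Bool.not_true] at *
      grind only
    · clear h hn₁ hn₂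
      intro w hw hc ho
      replace hw := fun i => hw (i, true)
      simp only [Vertex.Colored, List.forall_mem_cons, List.not_mem_nil, false_implies,
        implies_true, and_true, LinearMap.sub_apply, LinearMap.neg_apply, LinearMap.proj_apply, HalfEdge.flip, Bool.not_true,
        ends, Vertex.ends, List.flatMap_cons, List.flatMap_nil, List.cons_append,
        List.nil_append] at *
      grind only
  · refine h.of_outer [] [a, b] 0 ?_ hn₂ ?_ ?_
    · exact .refl _
    · clear h hn₁ hn₂
      intro w w' hw hw' ho hX hc
      replace hw := fun i => hw (i, true)
      replace hw' := fun i => hw' (i, true)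
      simp only [Vertex.Colored, List.forall_mem_cons, List.not_mem_nil, false_implies,
        implies_true, and_true, LinearMap.sub_apply, LinearMap.neg_apply, LinearMap.proj_apply, HalfEdge.flip, Bool.not_true] at *
      grind only
    · clear h hn₁ hn₂
      intro w hw hc ho
      replace hw := fun i => hw (i, true)
      simp only [Vertex.Colored, List.forall_mem_cons, List.not_mem_nil, false_implies,
        implies_true, and_true, LinearMap.sub_apply, LinearMap.neg_apply, LinearMap.proj_apply, HalfEdge.flip, Bool.not_true,
        ends, Vertex.ends, List.flatMap_cons, List.flatMap_nil, List.cons_append,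
        List.nil_append] at *
      grind only


theorem hasRankOne_reidemeister2 (h3 : (3 : F) = 0) (a b c d : HalfEdge ℕ) (x y : ℕ)
    (rest : Diagram ℕ)
    (hn₁ : (ends ([.classical a c (x, true) (y, true), .classical (x, false) d b (y, false)] ++ rest)).Nodup)
    (hn₂ : (ends ([.point a b, .point c d] ++ rest)).Nodup) :
    HasRankOne F ([.classical a c (x, true) (y, true), .classical (x, false) d b (y, false)] ++ rest) ↔
      HasRankOne F ([.point a b, .point c d] ++ rest) := by
  have hxy : y ≠ x := fun h => by
    have := nodup_left hn₁
    simp [ends, Vertex.ends, h] at this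
  refine ⟨fun h => ?_, fun h => ?_⟩
  · refine h.of_outer [x, y] [a, b, c, d] (fun i => if i = x then .proj c - .proj a else .proj c) ?_ hn₁ ?_ ?_
    · refine List.perm_iff_count.2 fun t => ?_
      simp only [ends, bothEnds, Vertex.ends, List.flatMap_cons, List.flatMap_nil, List.cons_append,
        List.nil_append, List.append_nil, List.count_cons]
      ring
    · clear h hn₁ hn₂
      intro w w' hw hw' ho hX hc
      replace hw := fun i => hw (i, true)
      replace hw' := fun i => hw' (i, true)
      simp only [if_true, if_neg hxy, Vertex.Colored, List.forall_mem_cons, List.not_mem_nil, false_implies,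
        implies_true, and_true, LinearMap.sub_apply, LinearMap.neg_apply, LinearMap.proj_apply, HalfEdge.flip, Bool.not_true] at *
      grind only
    · clear h hn₁ hn₂
      intro w hw hc ho
      replace hw := fun i => hw (i, true)
      simp only [Vertex.Colored, List.forall_mem_cons, List.not_mem_nil, false_implies,
        implies_true, and_true, LinearMap.sub_apply, LinearMap.neg_apply, LinearMap.proj_apply, HalfEdge.flip, Bool.not_true,
        ends, Vertex.ends, List.flatMap_cons, List.flatMap_nil, List.cons_append,
        List.nil_append] at *
      grind only
  · refine h.of_outer [] [a, b, c, d] 0 ?_ hn₂ ?_ ?_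
    · exact .refl _
    · clear h hn₁ hn₂
      intro w w' hw hw' ho hX hc
      replace hw := fun i => hw (i, true)
      replace hw' := fun i => hw' (i, true)
      simp only [Vertex.Colored, List.forall_mem_cons, List.not_mem_nil, false_implies,
        implies_true, and_true, LinearMap.sub_apply, LinearMap.neg_apply, LinearMap.proj_apply, HalfEdge.flip, Bool.not_true] at *
      grind only
    · clear h hn₁ hn₂
      intro w hw hc ho
      replace hw := fun i => hw (i, true)
      simp only [Vertex.Colored, List.forall_mem_cons, List.not_mem_nil, false_implies,
        implies_true, and_true, LinearMap.sub_apply, LinearMap.neg_apply, LinearMap.proj_apply, HalfEdge.flip, Bool.not_true,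
        ends, Vertex.ends, List.flatMap_cons, List.flatMap_nil, List.cons_append,
        List.nil_append] at *
      grind only


theorem hasRankOne_virtual2 (h3 : (3 : F) = 0) (a b c d : HalfEdge ℕ) (x y : ℕ)
    (rest : Diagram ℕ)
    (hn₁ : (ends ([.virtual a c (x, true) (y, true), .virtual (x, false) d b (y, false)] ++ rest)).Nodup)
    (hn₂ : (ends ([.point a b, .point c d] ++ rest)).Nodup) :
    HasRankOne F ([.virtual a c (x, true) (y, true), .virtual (x, false) d b (y, false)] ++ rest) ↔
      HasRankOne F ([.point a b, .point c d] ++ rest) := by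
  have hxy : y ≠ x := fun h => by
    have := nodup_left hn₁
    simp [ends, Vertex.ends, h] at this
  refine ⟨fun h => ?_, fun h => ?_⟩
  · refine h.of_outer [x, y] [a, b, c, d] (fun i => if i = x then -.proj a else -.proj c) ?_ hn₁ ?_ ?_
    · refine List.perm_iff_count.2 fun t => ?_
      simp only [ends, bothEnds, Vertex.ends, List.flatMap_cons, List.flatMap_nil, List.cons_append,
        List.nil_append, List.append_nil, List.count_cons]
      ring
    · clear h hn₁ hn₂
      intro w w' hw hw' ho hX hc
      replace hw := fun i => hw (i, true)
      replace hw' := fun i => hw' (i, true)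
      simp only [if_true, if_neg hxy, Vertex.Colored, List.forall_mem_cons, List.not_mem_nil, false_implies,
        implies_true, and_true, LinearMap.sub_apply, LinearMap.neg_apply, LinearMap.proj_apply, HalfEdge.flip, Bool.not_true] at *
      grind only
    · clear h hn₁ hn₂
      intro w hw hc ho
      replace hw := fun i => hw (i, true)
      simp only [Vertex.Colored, List.forall_mem_cons, List.not_mem_nil, false_implies,
        implies_true, and_true, LinearMap.sub_apply, LinearMap.neg_apply, LinearMap.proj_apply, HalfEdge.flip, Bool.not_true,
        ends, Vertex.ends, List.flatMap_cons, List.flatMap_nil, List.cons_append,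
        List.nil_append] at *
      grind only
  · refine h.of_outer [] [a, b, c, d] 0 ?_ hn₂ ?_ ?_
    · exact .refl _
    · clear h hn₁ hn₂
      intro w w' hw hw' ho hX hc
      replace hw := fun i => hw (i, true)
      replace hw' := fun i => hw' (i, true)
      simp only [Vertex.Colored, List.forall_mem_cons, List.not_mem_nil, false_implies,
        implies_true, and_true, LinearMap.sub_apply, LinearMap.neg_apply, LinearMap.proj_apply, HalfEdge.flip, Bool.not_true] at *
      grind only
    · clear h hn₁ hn₂
      intro w hw hc ho
      replace hw := fun i => hw (i, true)
      simp only [Vertex.Colored, List.forall_mem_cons, List.not_mem_nil, false_implies,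
        implies_true, and_true, LinearMap.sub_apply, LinearMap.neg_apply, LinearMap.proj_apply, HalfEdge.flip, Bool.not_true,
        ends, Vertex.ends, List.flatMap_cons, List.flatMap_nil, List.cons_append,
        List.nil_append] at *
      grind only


theorem hasRankOne_rotateClassical (h3 : (3 : F) = 0) (a b c d : HalfEdge ℕ)
    (rest : Diagram ℕ)
    (hn₁ : (ends ([.classical a b c d] ++ rest)).Nodup)
    (hn₂ : (ends ([.classical c d a b] ++ rest)).Nodup) :
    HasRankOne F ([.classical a b c d] ++ rest) ↔
      HasRankOne F ([.classical c d a b] ++ rest) := by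
  refine ⟨fun h => ?_, fun h => ?_⟩
  · refine h.of_outer [] [a, b, c, d] 0 ?_ hn₁ ?_ ?_
    · exact .refl _
    · clear h hn₁ hn₂
      intro w w' hw hw' ho hX hc
      replace hw := fun i => hw (i, true)
      replace hw' := fun i => hw' (i, true)
      simp only [Vertex.Colored, List.forall_mem_cons, List.not_mem_nil, false_implies,
        implies_true, and_true, LinearMap.sub_apply, LinearMap.neg_apply, LinearMap.proj_apply, HalfEdge.flip, Bool.not_true] at *
      grind only
    · clear h hn₁ hn₂
      intro w hw hc ho
      replace hw := fun i => hw (i, true)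
      simp only [Vertex.Colored, List.forall_mem_cons, List.not_mem_nil, false_implies,
        implies_true, and_true, LinearMap.sub_apply, LinearMap.neg_apply, LinearMap.proj_apply, HalfEdge.flip, Bool.not_true,
        ends, Vertex.ends, List.flatMap_cons, List.flatMap_nil, List.cons_append,
        List.nil_append] at *
      grind only
  · refine h.of_outer [] [a, b, c, d] 0 ?_ hn₂ ?_ ?_
    · refine List.perm_iff_count.2 fun t => ?_
      simp only [ends, bothEnds, Vertex.ends, List.flatMap_cons, List.flatMap_nil, List.cons_append,
        List.nil_append, List.append_nil, List.count_cons]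
      ring
    · clear h hn₁ hn₂
      intro w w' hw hw' ho hX hc
      replace hw := fun i => hw (i, true)
      replace hw' := fun i => hw' (i, true)
      simp only [Vertex.Colored, List.forall_mem_cons, List.not_mem_nil, false_implies,
        implies_true, and_true, LinearMap.sub_apply, LinearMap.neg_apply, LinearMap.proj_apply, HalfEdge.flip, Bool.not_true] at *
      grind only
    · clear h hn₁ hn₂
      intro w hw hc ho
      replace hw := fun i => hw (i, true)
      simp only [Vertex.Colored, List.forall_mem_cons, List.not_mem_nil, false_implies,
        implies_true, and_true, LinearMap.sub_apply, LinearMap.neg_apply, LinearMap.proj_apply, HalfEdge.flip, Bool.not_true,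
        ends, Vertex.ends, List.flatMap_cons, List.flatMap_nil, List.cons_append,
        List.nil_append] at *
      grind only


theorem hasRankOne_rotateVirtual (h3 : (3 : F) = 0) (a b c d : HalfEdge ℕ)
    (rest : Diagram ℕ)
    (hn₁ : (ends ([.virtual a b c d] ++ rest)).Nodup)
    (hn₂ : (ends ([.virtual b c d a] ++ rest)).Nodup) :
    HasRankOne F ([.virtual a b c d] ++ rest) ↔
      HasRankOne F ([.virtual b c d a] ++ rest) := by
  refine ⟨fun h => ?_, fun h => ?_⟩
  · refine h.of_outer [] [a, b, c, d] 0 ?_ hn₁ ?_ ?_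
    · exact .refl _
    · clear h hn₁ hn₂
      intro w w' hw hw' ho hX hc
      replace hw := fun i => hw (i, true)
      replace hw' := fun i => hw' (i, true)
      simp only [Vertex.Colored, List.forall_mem_cons, List.not_mem_nil, false_implies,
        implies_true, and_true, LinearMap.sub_apply, LinearMap.neg_apply, LinearMap.proj_apply, HalfEdge.flip, Bool.not_true] at *
      grind only
    · clear h hn₁ hn₂
      intro w hw hc ho
      replace hw := fun i => hw (i, true)
      simp only [Vertex.Colored, List.forall_mem_cons, List.not_mem_nil, false_implies,
        implies_true, and_true, LinearMap.sub_apply, LinearMap.neg_apply, LinearMap.proj_apply, HalfEdge.flip, Bool.not_true,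
        ends, Vertex.ends, List.flatMap_cons, List.flatMap_nil, List.cons_append,
        List.nil_append] at *
      grind only
  · refine h.of_outer [] [a, b, c, d] 0 ?_ hn₂ ?_ ?_
    · refine List.perm_iff_count.2 fun t => ?_
      simp only [ends, bothEnds, Vertex.ends, List.flatMap_cons, List.flatMap_nil, List.cons_append,
        List.nil_append, List.append_nil, List.count_cons]
      ring
    · clear h hn₁ hn₂
      intro w w' hw hw' ho hX hc
      replace hw := fun i => hw (i, true)
      replace hw' := fun i => hw' (i, true)
      simp only [Vertex.Colored, List.forall_mem_cons, List.not_mem_nil, false_implies,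
        implies_true, and_true, LinearMap.sub_apply, LinearMap.neg_apply, LinearMap.proj_apply, HalfEdge.flip, Bool.not_true] at *
      grind only
    · clear h hn₁ hn₂
      intro w hw hc ho
      replace hw := fun i => hw (i, true)
      simp only [Vertex.Colored, List.forall_mem_cons, List.not_mem_nil, false_implies,
        implies_true, and_true, LinearMap.sub_apply, LinearMap.neg_apply, LinearMap.proj_apply, HalfEdge.flip, Bool.not_true,
        ends, Vertex.ends, List.flatMap_cons, List.flatMap_nil, List.cons_append,
        List.nil_append] at *
      grind only


theorem hasRankOne_rotatePoint (h3 : (3 : F) = 0) (a b : HalfEdge ℕ)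
    (rest : Diagram ℕ)
    (hn₁ : (ends ([.point a b] ++ rest)).Nodup)
    (hn₂ : (ends ([.point b a] ++ rest)).Nodup) :
    HasRankOne F ([.point a b] ++ rest) ↔
      HasRankOne F ([.point b a] ++ rest) := by
  refine ⟨fun h => ?_, fun h => ?_⟩
  · refine h.of_outer [] [a, b] 0 ?_ hn₁ ?_ ?_
    · exact .refl _
    · clear h hn₁ hn₂
      intro w w' hw hw' ho hX hc
      replace hw := fun i => hw (i, true)
      replace hw' := fun i => hw' (i, true)
      simp only [Vertex.Colored, List.forall_mem_cons, List.not_mem_nil, false_implies,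
        implies_true, and_true, LinearMap.sub_apply, LinearMap.neg_apply, LinearMap.proj_apply, HalfEdge.flip, Bool.not_true] at *
      grind only
    · clear h hn₁ hn₂
      intro w hw hc ho
      replace hw := fun i => hw (i, true)
      simp only [Vertex.Colored, List.forall_mem_cons, List.not_mem_nil, false_implies,
        implies_true, and_true, LinearMap.sub_apply, LinearMap.neg_apply, LinearMap.proj_apply, HalfEdge.flip, Bool.not_true,
        ends, Vertex.ends, List.flatMap_cons, List.flatMap_nil, List.cons_append,
        List.nil_append] at *
      grind only
  · refine h.of_outer [] [a, b] 0 ?_ hn₂ ?_ ?_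
    · refine List.perm_iff_count.2 fun t => ?_
      simp only [ends, bothEnds, Vertex.ends, List.flatMap_cons, List.flatMap_nil, List.cons_append,
        List.nil_append, List.append_nil, List.count_cons]
      ring
    · clear h hn₁ hn₂
      intro w w' hw hw' ho hX hc
      replace hw := fun i => hw (i, true)
      replace hw' := fun i => hw' (i, true)
      simp only [Vertex.Colored, List.forall_mem_cons, List.not_mem_nil, false_implies,
        implies_true, and_true, LinearMap.sub_apply, LinearMap.neg_apply, LinearMap.proj_apply, HalfEdge.flip, Bool.not_true] at *
      grind only
    · clear h hn₁ hn₂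
      intro w hw hc ho
      replace hw := fun i => hw (i, true)
      simp only [Vertex.Colored, List.forall_mem_cons, List.not_mem_nil, false_implies,
        implies_true, and_true, LinearMap.sub_apply, LinearMap.neg_apply, LinearMap.proj_apply, HalfEdge.flip, Bool.not_true,
        ends, Vertex.ends, List.flatMap_cons, List.flatMap_nil, List.cons_append,
        List.nil_append] at *
      grind only


end Moves
end VirtualKnotTheory

namespace VirtualKnotTheory
-- Invariance under virtual equivalence, and the two diagrams
section Invariance

variable {F : Type} [CommRing F]

theorem Vertex.colored_map {v : Vertex ℕ} {f : HalfEdge ℕ → HalfEdge ℕ} {y : HalfEdge ℕ → F} :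
    (v.map f).Colored y ↔ v.Colored (y ∘ f) := by
  cases v <;> rfl

theorem Vertex.ends_map {L M : Type} (v : Vertex L) (f : HalfEdge L → HalfEdge M) :
    (v.map f).ends = v.ends.map f := by
  cases v <;> rfl

theorem ends_map {L M : Type} (D : Diagram L) (f : HalfEdge L → HalfEdge M) :
    ends (D.map (Vertex.map f)) = (ends D).map f := by
  simp only [ends, List.flatMap_map, List.map_flatMap, Vertex.ends_map]

/-- The colour is constant along an edge, so the half cut off at `v` must carry the colour of `a`.
That `x` is a fresh label is not part of the move; it follows because the ends of the subdivided
diagram are distinct. -/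
theorem hasRankOne_subdivide (v : Vertex ℕ) (a : HalfEdge ℕ) (x : ℕ) (ha : a ∈ v.ends)
    (rest : Diagram ℕ)
    (hn : (ends ([v.map (fun h => if h = a then (x, true) else h), .point (x, false) a] ++
      rest)).Nodup) :
    HasRankOne F ([v] ++ rest) ↔
      HasRankOne F ([v.map (fun h => if h = a then (x, true) else h), .point (x, false) a] ++
        rest) := by
  set f : HalfEdge ℕ → HalfEdge ℕ := fun h => if h = a then (x, true) else h with hf
  have hfa : f a = (x, true) := if_pos rfl
  have hx1 : (x, true) ∈ v.ends.map f := List.mem_map.2 ⟨a, ha, hfa⟩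
  have hends : ends [v.map f, .point (x, false) a] = v.ends.map f ++ [(x, false), a] := by
    rw [← Vertex.ends_map]
    simp [ends, Vertex.ends]
  have hn' := nodup_left hn
  rw [hends, List.nodup_append] at hn'
  have hfresh : ∀ e ∈ v.ends, e.1 ≠ x := by
    intro e he
    have hfe : f e ∈ v.ends.map f := List.mem_map_of_mem he
    by_cases hea : e = a
    · have := hn'.2.1
      simp only [List.nodup_cons, List.mem_singleton] at this
      exact ne_label (fun h => hn'.2.2 _ hx1 a (by simp) (by rw [← h, hea]))
        fun h => this.1 (by rw [← h, hea])
    · have hfe' : f e = e := if_neg hea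
      refine ne_label (fun h => hea ?_) fun h => ?_
      · exact List.inj_on_of_nodup_map hn'.1 he ha (by rw [hfe', hfa, h])
      · exact hn'.2.2 _ hfe (x, false) (by simp) (by rw [hfe', h])
  have hrest := fresh_rest hn x (by rw [hends]; exact List.mem_append_left _ hx1)
    (by rw [hends]; simp)
  refine ⟨fun h => ?_, fun h => ?_⟩
  · refine h.of_tangle .id (fun y e _ => rfl) (fun y hy => ⟨hy.flip, ?_⟩) fun y hy h0 => ?_
    · have h1 := hy.colored _ List.mem_cons_self
      have h2 : y a = -y (x, false) := hy.colored (.point (x, false) a) (by simp)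
      have h3 : y (x, false) = -y (x, true) := hy.flip (x, true)
      simp only [List.mem_singleton, forall_eq]
      refine (Vertex.colored_map.1 h1).congr fun e he => ?_
      by_cases hea : e = a
      · simp [hea, hfa, h2, h3]
      · simp [hf, hea]
    · have h2 : y a = -y (x, false) := hy.colored (.point (x, false) a) (by simp)
      have h3 : y (x, false) = -y (x, true) := hy.flip (x, true)
      have h4 : ∀ e ∈ v.ends, y e = 0 := fun e he => h0 e (by simpa [ends] using he)
      rw [hends]
      intro e he
      have h5 := h4 a ha
      rw [h5, h3, neg_neg] at h2
      rcases List.mem_append.1 he with he | he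
      · obtain ⟨e', he', rfl⟩ := List.mem_map.1 he
        by_cases hea : e' = a
        · rw [hea, hfa, ← h2]
        · rw [hf]; simpa [hea] using h4 e' he'
      · simp only [List.mem_cons, List.not_mem_nil, or_false] at he
        rcases he with rfl | rfl
        · rw [h3, ← h2, neg_zero]
        · exact h5
  · refine h.of_tangle (recolor [x] fun _ => .proj a)
      (fun y e he => if_neg (by simpa using hrest e he))
      (fun y hy => ⟨recolor_flip _ _ hy.flip, ?_⟩) fun y hy h0 => ?_
    · have h1 : ∀ e ∈ v.ends, recolor [x] (fun _ => .proj a) y e = y e := fun e he =>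
        if_neg (by simpa using hfresh e he)
      have h2 : recolor [x] (fun _ => .proj a) y (x, true) = y a := by simp [recolor]
      have h3 : recolor [x] (fun _ => .proj a) y (x, false) = -y a := by simp [recolor]
      simp only [List.forall_mem_cons, List.not_mem_nil, false_implies, implies_true, and_true]
      refine ⟨Vertex.colored_map.2 ((hy.colored v (by simp)).congr fun e he => ?_), ?_⟩
      · by_cases hea : e = a
        · rw [Function.comp_apply, hea, hfa, h2]
        · rw [Function.comp_apply, hf]
          simpa [hea] using h1 e he
      · rw [Vertex.Colored, h3, neg_neg, h1 a ha]
    · have h1 : ∀ e ∈ v.ends, recolor [x] (fun _ => .proj a) y e = y e := fun e he =>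
        if_neg (by simpa using hfresh e he)
      have h2 : recolor [x] (fun _ => .proj a) y (x, true) = y a := by simp [recolor]
      intro e he
      have he : e ∈ v.ends := by simpa [ends] using he
      rw [hends] at h0
      by_cases hea : e = a
      · rw [hea, ← h2]
        exact h0 _ (List.mem_append_left _ hx1)
      · rw [← h1 e he]
        exact h0 _ (List.mem_append_left _ (List.mem_map.2 ⟨e, he, if_neg hea⟩))

theorem LocalMove.hasRankOne_iff (h3 : (3 : F) = 0) {T T' rest : Diagram ℕ} (h : LocalMove T T')
    (hn : (ends (T ++ rest)).Nodup) (hn' : (ends (T' ++ rest)).Nodup) :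
    HasRankOne F (T ++ rest) ↔ HasRankOne F (T' ++ rest) := by
  cases h with
  | rotateClassical a b c d => exact hasRankOne_rotateClassical h3 a b c d rest hn hn'
  | rotateVirtual a b c d => exact hasRankOne_rotateVirtual h3 a b c d rest hn hn'
  | rotatePoint a b => exact hasRankOne_rotatePoint h3 a b rest hn hn'
  | subdivide v a x ha => exact hasRankOne_subdivide v a x ha rest hn'
  | reidemeister1 a b x => exact hasRankOne_reidemeister1 h3 a b x rest hn hn'
  | reidemeister1' a b x => exact hasRankOne_reidemeister1' h3 a b x rest hn hn'
  | reidemeister2 a b c d x y => exact hasRankOne_reidemeister2 h3 a b c d x y rest hn hn'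
  | reidemeister3 a b c d e f x y z =>
    exact hasRankOne_reidemeister3 h3 a b c d e f x y z rest hn hn'
  | reidemeister3' a b c d e f x y z =>
    exact hasRankOne_reidemeister3' h3 a b c d e f x y z rest hn hn'
  | virtual1 a b x => exact hasRankOne_virtual1 h3 a b x rest hn hn'
  | virtual2 a b c d x y => exact hasRankOne_virtual2 h3 a b c d x y rest hn hn'
  | virtual3 a b c d e f x y z => exact hasRankOne_virtual3 h3 a b c d e f x y z rest hn hn'
  | virtual4 a b c d e f x y z => exact hasRankOne_virtual4 h3 a b c d e f x y z rest hn hn'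
  | virtual4' a b c d e f x y z => exact hasRankOne_virtual4' h3 a b c d e f x y z rest hn hn'

theorem HasRankOne.of_perm {D D' : Diagram ℕ} (hp : D.Perm D') (h : HasRankOne F D') :
    HasRankOne F D :=
  h.of_linear .id (fun _ hy => ⟨hy.flip, fun v hv => hy.colored v (hp.mem_iff.2 hv)⟩)
    fun _ _ h0 e he => h0 e ((hp.flatMap_right _).mem_iff.1 he)

theorem IsColoring.comp_iff {D : Diagram ℕ} (f : Equiv.Perm (HalfEdge ℕ))
    (hf : ∀ h, f h.flip = (f h).flip) {y : HalfEdge ℕ → F} :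
    IsColoring D (y ∘ f) ↔ IsColoring (D.map (Vertex.map f)) y := by
  refine ⟨fun h => ⟨fun e => ?_, ?_⟩, fun h => ⟨fun e => ?_, ?_⟩⟩
  · obtain ⟨e, rfl⟩ := f.surjective e
    rw [← hf]
    exact h.flip e
  · intro v hv
    obtain ⟨v', hv', rfl⟩ := List.mem_map.1 hv
    exact Vertex.colored_map.2 (h.colored v' hv')
  · rw [Function.comp_apply, hf, h.flip, Function.comp_apply]
  · exact fun v hv => Vertex.colored_map.1 (h.colored _ (List.mem_map_of_mem hv))

theorem hasRankOne_rename (D : Diagram ℕ) (f : Equiv.Perm (HalfEdge ℕ))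
    (hf : ∀ h, f h.flip = (f h).flip) :
    HasRankOne F D ↔ HasRankOne F (D.map (Vertex.map f)) := by
  refine ⟨fun h => h.of_linear (LinearMap.funLeft F F f)
    (fun y hy => (IsColoring.comp_iff f hf).2 hy) fun y _ h0 e he => ?_,
    fun h => h.of_linear (LinearMap.funLeft F F f.symm)
      (fun y hy => (IsColoring.comp_iff f hf).1 ?_) fun y _ h0 e he => ?_⟩
  · rw [ends_map] at he
    obtain ⟨e', he', rfl⟩ := List.mem_map.1 he
    exact h0 e' he'
  · have : (LinearMap.funLeft F F f.symm) y ∘ f = y := by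
      funext e
      simp [LinearMap.funLeft_apply]
    rwa [this]
  · rw [ends_map] at h0
    simpa [LinearMap.funLeft_apply] using h0 (f e) (List.mem_map_of_mem he)

theorem Step.hasRankOne_iff (h3 : (3 : F) = 0) {D D' : Diagram ℕ} (h : Step D D')
    (hn : (ends D).Nodup) (hn' : (ends D').Nodup) : HasRankOne F D ↔ HasRankOne F D' := by
  cases h with
  | perm h => exact ⟨HasRankOne.of_perm h.symm, HasRankOne.of_perm h⟩
  | rename _ f hf => exact hasRankOne_rename D f hf
  | move h rest => exact h.hasRankOne_iff h3 hn hn'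

/-- Every intermediate stage is a virtual knot diagram, so its ends are distinct, which is all that
the moves require. -/
theorem VirtuallyEquivalent.hasRankOne_iff (h3 : (3 : F) = 0) {K K' : VirtualKnotDiagram}
    (h : VirtuallyEquivalent K K') : HasRankOne F K.vertices ↔ HasRankOne F K'.vertices := by
  induction h with
  | rel K K' h => exact h.hasRankOne_iff h3 K.isDiagram.nodup K'.isDiagram.nodup
  | refl => rfl
  | symm _ _ _ ih => exact ih.symm
  | trans _ _ _ _ _ ih₁ ih₂ => exact ih₁.trans ih₂

end Invariance

theorem hasRankOne_unknot : HasRankOne (ZMod 3) unknot.vertices := by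
  intro y₁ y₂ h₁ h₂
  have e₁ : y₁ (0, false) = -y₁ (0, true) := h₁.flip (0, true)
  have e₂ : y₂ (0, false) = -y₂ (0, true) := h₂.flip (0, true)
  have h : ∃ r s : ZMod 3, (r ≠ 0 ∨ s ≠ 0) ∧ r * y₁ (0, true) + s * y₂ (0, true) = 0 := by
    generalize y₁ (0, true) = u
    generalize y₂ (0, true) = v
    revert u v
    decide
  obtain ⟨r, s, hrs, h0⟩ := h
  refine ⟨r, s, hrs, fun e he => ?_⟩
  have he : e = (0, true) ∨ e = (0, false) := by
    simpa [unknot, unknotVertices, ends, Vertex.ends] using he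
  rcases he with rfl | rfl
  · exact h0
  · rw [e₁, e₂]
    linear_combination -h0

/-- The colouring of `Km` by the colours of the edges at their starting points. -/
def edgeColoring (l : List (ZMod 3)) (h : HalfEdge ℕ) : ZMod 3 :=
  if h.2 then l.getD h.1 0 else -l.getD h.1 0

theorem edgeColoring_flip (l : List (ZMod 3)) (h : HalfEdge ℕ) :
    edgeColoring l h.flip = -edgeColoring l h := by
  rcases h with ⟨e, b⟩
  cases b <;> simp [edgeColoring, HalfEdge.flip]

instance (y : HalfEdge ℕ → ZMod 3) (v : Vertex ℕ) : Decidable (v.Colored y) := by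
  cases v <;> unfold Vertex.Colored <;> infer_instance

/-- Edges 0 and 10 separate `K_m` into the crossings 1, 2, 3, 4, 7 and the crossings 5, 6, 8. Each
part has a non-zero colouring that vanishes on these two edges, and it extends by zero over the
other part. -/
theorem not_hasRankOne_Km : ¬ HasRankOne (ZMod 3) Km.vertices := by
  intro h
  obtain ⟨r, s, hrs, h0⟩ := h (edgeColoring [0, 1, 2, 2, 1, 2, 0, 2, 2, 1, 0, 0, 0, 0, 0, 0])
    (edgeColoring [0, 0, 0, 0, 0, 0, 0, 0, 0, 0, 0, 1, 1, 2, 1, 1])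
    ⟨edgeColoring_flip _, by decide +kernel⟩ ⟨edgeColoring_flip _, by decide +kernel⟩
  -- At edge 1 only the first colouring is non-zero, at edge 11 only the second, so both
  -- coefficients of a linear relation vanish.
  have h1 := h0 (1, true) (by decide)
  have h2 := h0 (11, true) (by decide)
  simp [edgeColoring] at h1 h2
  exact hrs.elim (· h1) (· h2)

theorem not_virtuallyEquivalent : ¬ VirtuallyEquivalent Km unknot := fun h =>
  not_hasRankOne_Km ((h.hasRankOne_iff (F := ZMod 3) rfl).2 hasRankOne_unknot)

end VirtualKnotTheory

namespace VirtualKnotTheory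

/-! ### Counting the classes generated by a list of pairs -/

section Classes

/-- The elements that occur in a list of pairs. -/
def support {α : Type} (l : List (α × α)) : Set α := {x | ∃ p ∈ l, x = p.1 ∨ x = p.2}

/-- The class of an element for the equivalence relation generated by a list of pairs. -/
def cls {α : Type} (l : List (α × α)) (x : α) : Quot (fun x y => (x, y) ∈ l) := Quot.mk _ x

theorem numClasses_def {α : Type} (l : List (α × α)) :
    numClasses l = (cls l '' support l).ncard := rfl

theorem cls_eq {α : Type} {l : List (α × α)} {x y : α} (h : (x, y) ∈ l) : cls l x = cls l y :=
  Quot.sound h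

theorem support_cons {α : Type} (p : α × α) (l : List (α × α)) :
    support (p :: l) = insert p.1 (insert p.2 (support l)) := by
  ext x
  simp only [support, List.exists_mem_cons_iff, Set.mem_ofPred_eq, Set.mem_insert_iff, or_assoc]

theorem support_append {α : Type} (l l' : List (α × α)) :
    support (l ++ l') = support l ∪ support l' := by
  ext x
  simp only [support, List.mem_append, or_and_right, exists_or, Set.mem_ofPred_eq, Set.mem_union]

theorem support_nil {α : Type} : support ([] : List (α × α)) = ∅ := by
  simp [support]

theorem fst_mem_support {α : Type} {l : List (α × α)} {x y : α} (h : (x, y) ∈ l) :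
    x ∈ support l := ⟨_, h, Or.inl rfl⟩

theorem snd_mem_support {α : Type} {l : List (α × α)} {x y : α} (h : (x, y) ∈ l) :
    y ∈ support l := ⟨_, h, Or.inr rfl⟩

theorem finite_support {α : Type} (l : List (α × α)) : (support l).Finite := by
  induction l with
  | nil => simp [support_nil]
  | cons p l ih => rw [support_cons]; exact (ih.insert _).insert _

/-- `f` and `g` descend to the quotients, where they are inverse bijections between the classes that
are counted; on elements they need to be inverse only up to equivalence. -/
theorem numClasses_congr {α β : Type} {l : List (α × α)} {l' : List (β × β)} (f : α → β)
    (g : β → α) (hf : ∀ x y, (x, y) ∈ l → cls l' (f x) = cls l' (f y))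
    (hg : ∀ x y, (x, y) ∈ l' → cls l (g x) = cls l (g y))
    (hfs : ∀ x ∈ support l, f x ∈ support l') (hgs : ∀ x ∈ support l', g x ∈ support l)
    (hgf : ∀ x ∈ support l, cls l (g (f x)) = cls l x)
    (hfg : ∀ x ∈ support l', cls l' (f (g x)) = cls l' x) : numClasses l = numClasses l' := by
  let F : Quot (fun x y => (x, y) ∈ l) → Quot (fun x y => (x, y) ∈ l') :=
    Quot.lift (fun x => cls l' (f x)) hf
  let G : Quot (fun x y => (x, y) ∈ l') → Quot (fun x y => (x, y) ∈ l) :=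
    Quot.lift (fun x => cls l (g x)) hg
  have hF : Set.InjOn F (cls l '' support l) := by
    refine Set.LeftInvOn.injOn (f₁' := G) ?_
    rintro _ ⟨x, hx, rfl⟩
    exact hgf x hx
  have himg : F '' (cls l '' support l) = cls l' '' support l' := by
    ext z
    constructor
    · rintro ⟨_, ⟨x, hx, rfl⟩, rfl⟩
      exact ⟨f x, hfs x hx, rfl⟩
    · rintro ⟨y, hy, rfl⟩
      exact ⟨_, ⟨g y, hgs y hy, rfl⟩, hfg y hy⟩
  rw [numClasses_def, numClasses_def, ← himg, hF.ncard_image]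

theorem numClasses_congr_swap {α : Type} {l l' : List (α × α)}
    (h : ∀ x y, (x, y) ∈ l → (x, y) ∈ l' ∨ (y, x) ∈ l')
    (h' : ∀ x y, (x, y) ∈ l' → (x, y) ∈ l ∨ (y, x) ∈ l) : numClasses l = numClasses l' := by
  have key : ∀ {l l' : List (α × α)}, (∀ x y, (x, y) ∈ l → (x, y) ∈ l' ∨ (y, x) ∈ l') →
      ∀ x ∈ support l, x ∈ support l' := by
    rintro l l' h x ⟨⟨a, b⟩, hp, rfl | rfl⟩
    · exact (h _ _ hp).elim fst_mem_support snd_mem_support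
    · exact (h _ _ hp).elim snd_mem_support fst_mem_support
  exact numClasses_congr id id (fun x y hp => (h x y hp).elim cls_eq fun h => (cls_eq h).symm)
    (fun x y hp => (h' x y hp).elim cls_eq fun h => (cls_eq h).symm) (key h) (key h')
    (fun _ _ => rfl) fun _ _ => rfl

theorem numClasses_congr_mem {α : Type} {l l' : List (α × α)} (h : ∀ p, p ∈ l ↔ p ∈ l') :
    numClasses l = numClasses l' :=
  numClasses_congr_swap (fun _ _ hp => Or.inl ((h _).1 hp)) fun _ _ hp => Or.inl ((h _).2 hp)

theorem numClasses_map {α β : Type} {l : List (α × α)} {f : α → β}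
    (hf : Set.InjOn f (support l)) :
    numClasses (l.map fun p => (f p.1, f p.2)) = numClasses l := by
  rcases l with _ | ⟨⟨a, b⟩, l⟩
  · rw [List.map_nil, numClasses_def, numClasses_def, support_nil, support_nil, Set.image_empty,
      Set.image_empty, Set.ncard_empty, Set.ncard_empty]
  have : Nonempty α := ⟨a⟩
  generalize (a, b) :: l = l at hf
  have hinv : ∀ x ∈ support l, Function.invFunOn f (support l) (f x) = x :=
    fun x hx => hf.leftInvOn_invFunOn hx
  have hsupp : ∀ y ∈ support (l.map fun p => (f p.1, f p.2)), ∃ x ∈ support l, f x = y := by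
    rintro _ ⟨p, hp, h⟩
    obtain ⟨⟨x, y⟩, hq, rfl⟩ := List.mem_map.1 hp
    rcases h with rfl | rfl
    · exact ⟨x, fst_mem_support hq, rfl⟩
    · exact ⟨y, snd_mem_support hq, rfl⟩
  refine (numClasses_congr f (Function.invFunOn f (support l)) ?_ ?_ ?_ ?_ ?_ ?_).symm
  · exact fun x y h => cls_eq (List.mem_map.2 ⟨(x, y), h, rfl⟩)
  · intro x y h
    obtain ⟨⟨x, y⟩, hq, h⟩ := List.mem_map.1 h
    cases h
    rw [hinv _ (fst_mem_support hq), hinv _ (snd_mem_support hq)]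
    exact cls_eq hq
  · rintro x ⟨p, hp, rfl | rfl⟩
    · exact ⟨_, List.mem_map.2 ⟨p, hp, rfl⟩, Or.inl rfl⟩
    · exact ⟨_, List.mem_map.2 ⟨p, hp, rfl⟩, Or.inr rfl⟩
  · intro y hy
    obtain ⟨x, hx, rfl⟩ := hsupp y hy
    rwa [hinv x hx]
  · intro x hx
    rw [hinv x hx]
  · intro y hy
    obtain ⟨x, hx, rfl⟩ := hsupp y hy
    rw [hinv x hx]

/-- An element that occurs in exactly two pairs can be eliminated. -/
theorem numClasses_eliminate {α : Type} {l : List (α × α)} {a b p : α} (hl : a ∉ support l)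
    (hp : p ≠ a) (hb : b ≠ a) :
    numClasses ((a, p) :: (a, b) :: l) = numClasses ((p, b) :: l) := by
  classical
  have h1 : cls ((a, p) :: (a, b) :: l) a = cls ((a, p) :: (a, b) :: l) p := cls_eq (by simp)
  have h2 : cls ((a, p) :: (a, b) :: l) a = cls ((a, p) :: (a, b) :: l) b := cls_eq (by simp)
  have hne : ∀ x ∈ support ((p, b) :: l), x ≠ a := by
    rintro x hx rfl
    rw [support_cons] at hx
    rcases hx with rfl | rfl | hx
    · exact hp rfl
    · exact hb rfl
    · exact hl hx
  -- Contract `a` onto its neighbour `p`; the inclusion is inverse up to classes because `a` and `p`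
  -- are joined.
  refine numClasses_congr (fun x => if x = a then p else x) id ?_ ?_ ?_ ?_ ?_ ?_
  · intro x y h
    simp only [List.mem_cons, Prod.mk.injEq] at h
    rcases h with ⟨rfl, rfl⟩ | ⟨rfl, rfl⟩ | h
    · simp
    · simp only [if_true, if_neg hb]
      exact cls_eq (by simp)
    · rw [if_neg fun h' : x = a => hl (h' ▸ fst_mem_support h),
        if_neg fun h' : y = a => hl (h' ▸ snd_mem_support h)]
      exact cls_eq (List.mem_cons_of_mem _ h)
  · intro x y h
    simp only [List.mem_cons, Prod.mk.injEq] at h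
    rcases h with ⟨rfl, rfl⟩ | h
    · exact h1.symm.trans h2
    · exact cls_eq (by simp [h])
  · intro x hx
    simp only [support_cons] at hx ⊢
    by_cases h : x = a
    · simp [h]
    · rw [if_neg h]
      rcases hx with rfl | rfl | rfl | rfl | hx
      · exact absurd rfl h
      · simp
      · exact absurd rfl h
      · simp
      · exact Or.inr (Or.inr hx)
  · intro x hx
    simp only [support_cons] at hx ⊢
    rcases hx with rfl | rfl | hx
    · simp
    · simp
    · exact Or.inr (Or.inr (Or.inr (Or.inr hx)))
  · intro x _
    by_cases h : x = a
    · simp [h, h1]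
    · simp [h]
  · intro x hx
    simp [hne x hx]

/-- A pair of equal elements that occur nowhere else is a separate class. -/
theorem numClasses_loop {α : Type} {l : List (α × α)} {a : α} (hl : a ∉ support l) :
    numClasses ((a, a) :: l) = numClasses l + 1 := by
  have himg : cls ((a, a) :: l) '' support ((a, a) :: l) =
      insert (cls ((a, a) :: l) a) (cls ((a, a) :: l) '' support l) := by
    rw [support_cons, Set.insert_eq_of_mem (Set.mem_insert a _), Set.image_insert_eq]
  have hnot : cls ((a, a) :: l) a ∉ cls ((a, a) :: l) '' support l := by
    rintro ⟨x, hx, h⟩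
    -- Being equal to `a` is constant on classes, since `a` occurs in no other pair; this separates
    -- the class of `a` from the rest.
    let F : Quot (fun x y => (x, y) ∈ (a, a) :: l) → Prop := Quot.lift (fun x => x = a) (by
      intro x y h
      simp only [List.mem_cons, Prod.mk.injEq] at h
      rcases h with ⟨rfl, rfl⟩ | h
      · rfl
      · refine propext ⟨fun h' => absurd (fst_mem_support h) ?_,
          fun h' => absurd (snd_mem_support h) ?_⟩ <;> rwa [h'])
    have hF : F (cls _ x) = F (cls _ a) := congrArg F h
    have : x = a := hF.mpr rfl
    exact hl (this ▸ hx)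
  let F : Quot (fun x y => (x, y) ∈ l) → Quot (fun x y => (x, y) ∈ (a, a) :: l) :=
    Quot.lift (cls _) fun x y h => cls_eq (List.mem_cons_of_mem _ h)
  let G : Quot (fun x y => (x, y) ∈ (a, a) :: l) → Quot (fun x y => (x, y) ∈ l) :=
    Quot.lift (cls _) fun x y h => by
      simp only [List.mem_cons, Prod.mk.injEq] at h
      rcases h with ⟨rfl, rfl⟩ | h
      · rfl
      · exact cls_eq h
  have hF : Function.Injective F := Function.LeftInverse.injective (g := G) (by rintro ⟨x⟩; rfl)
  have himg' : F '' (cls l '' support l) = cls ((a, a) :: l) '' support l := by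
    rw [Set.image_image]; rfl
  rw [numClasses_def, himg, Set.ncard_insert_of_notMem hnot ((finite_support l).image _), ← himg',
    Set.ncard_image_of_injective _ hF, numClasses_def]

theorem numClasses_le_length {α : Type} (l : List (α × α)) : numClasses l ≤ l.length := by
  have h : cls l '' support l ⊆ (cls l ∘ Prod.fst) '' {p | p ∈ l} := by
    rintro _ ⟨x, ⟨⟨a, b⟩, hp, rfl | rfl⟩, rfl⟩
    · exact ⟨_, hp, rfl⟩
    · exact ⟨_, hp, cls_eq hp⟩
  have hfin : {p | p ∈ l}.Finite := l.finite_toSet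
  refine (Set.ncard_le_ncard h (hfin.image _)).trans ((Set.ncard_image_le hfin).trans ?_)
  classical
  have : {p | p ∈ l} = (l.toFinset : Set (α × α)) := by ext; simp
  rw [this, Set.ncard_coe_finset]
  exact l.toFinset_card_le

theorem numClasses_pos {α : Type} {l : List (α × α)} (h : l ≠ []) : 0 < numClasses l := by
  rcases l with _ | ⟨⟨a, b⟩, l⟩
  · exact absurd rfl h
  rw [numClasses_def, Set.ncard_pos ((finite_support _).image _)]
  exact ⟨_, a, fst_mem_support List.mem_cons_self, rfl⟩

end Classes

/-! ### Partial smoothings as pairings of open ends -/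

section Pairing

/-- The pairs of an involution of the numbers below `n` that are not fixed points. -/
def arcs (n : ℕ) (g : ℕ → ℕ) : List (ℕ × ℕ) :=
  ((List.range n).filter fun c => g c ≠ c).map fun c => (c, g c)

/-- An involution that moves only numbers below `n`. -/
structure IsPairing (n : ℕ) (g : ℕ → ℕ) : Prop where
  invol : ∀ c, g (g c) = c
  lt : ∀ c, g c ≠ c → c < n

theorem mem_arcs {n : ℕ} {g : ℕ → ℕ} (hg : IsPairing n g) {x y : ℕ} :
    (x, y) ∈ arcs n g ↔ g x = y ∧ x ≠ y := by
  simp only [arcs, List.mem_map, List.mem_filter, List.mem_range, decide_eq_true_eq, Prod.mk.injEq]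
  constructor
  · rintro ⟨c, ⟨_, h2⟩, rfl, rfl⟩
    exact ⟨rfl, h2.symm⟩
  · rintro ⟨rfl, h⟩
    exact ⟨x, ⟨hg.lt x h.symm, h.symm⟩, rfl, rfl⟩

theorem mem_support_arcs {n : ℕ} {g : ℕ → ℕ} (hg : IsPairing n g) {x : ℕ} :
    x ∈ support (arcs n g) ↔ g x ≠ x := by
  constructor
  · rintro ⟨⟨a, b⟩, h, h'⟩
    obtain ⟨rfl, hne⟩ := (mem_arcs hg).1 h
    rcases h' with rfl | rfl
    · exact hne.symm
    · rw [hg.invol]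
      exact hne
  · exact fun h => fst_mem_support ((mem_arcs hg).2 ⟨rfl, h.symm⟩)

/-- Forget the pair of `a`. -/
def release (g : ℕ → ℕ) (a : ℕ) : ℕ → ℕ := fun c => if c = a ∨ c = g a then c else g c

/-- Pair `p` and `q`. -/
def link (g : ℕ → ℕ) (p q : ℕ) : ℕ → ℕ := fun c => if c = p then q else if c = q then p else g c

theorem release_self (g : ℕ → ℕ) (a : ℕ) : release g a a = a := by simp [release]

theorem release_fixed {g : ℕ → ℕ} {c : ℕ} (a : ℕ) (h : g c = c) : release g a c = c := by
  simp [release, h]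

theorem release_partner (g : ℕ → ℕ) (a : ℕ) : release g a (g a) = g a := by simp [release]

theorem release_eq_self {g : ℕ → ℕ} {a : ℕ} (h : g a = a) : release g a = g := by
  funext c
  simp only [release, h, or_self]
  split_ifs with h1
  · rw [h1, h]
  · rfl

theorem IsPairing.release {n : ℕ} {g : ℕ → ℕ} (hg : IsPairing n g) (a : ℕ) :
    IsPairing n (release g a) where
  invol c := by
    have h1 := hg.invol c
    have h2 := hg.invol a
    simp only [VirtualKnotTheory.release]
    grind
  lt c h := hg.lt c fun h' => h (release_fixed a h')

theorem IsPairing.link {n : ℕ} {g : ℕ → ℕ} (hg : IsPairing n g) {p q : ℕ} (hp : g p = p)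
    (hq : g q = q) (hpn : p < n) (hqn : q < n) : IsPairing n (link g p q) where
  invol c := by
    have h1 := hg.invol c
    simp only [VirtualKnotTheory.link]
    grind
  lt c h := by
    by_cases h1 : c = p
    · rwa [h1]
    by_cases h2 : c = q
    · rwa [h2]
    · exact hg.lt c (by simpa [VirtualKnotTheory.link, h1, h2] using h)

theorem IsPairing.apply_lt {n : ℕ} {g : ℕ → ℕ} (hg : IsPairing n g) {a : ℕ} (ha : a < n) :
    g a < n := by
  by_cases h : g a = a
  · rwa [h]
  · exact hg.lt _ (by rw [hg.invol]; exact Ne.symm h)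

/-- If `a` already ends an arc, a further pair at `a` extends this arc, and its end moves from `a`
to `b`. Then `a` is used up and can be eliminated. If `a` is fixed by `g`, nothing changes. -/
theorem numClasses_release {n : ℕ} {g : ℕ → ℕ} (hg : IsPairing n g) {a b : ℕ}
    {R : List (ℕ × ℕ)} (ha : g a ≠ a → b ≠ a ∧ a ∉ support R) :
    numClasses ((a, b) :: (arcs n g ++ R)) =
      numClasses ((g a, b) :: (arcs n (release g a) ++ R)) := by
  by_cases h : g a = a
  · rw [release_eq_self h, h]
  obtain ⟨hb, hR⟩ := ha h
  have hr := hg.release a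
  have hsupp : a ∉ support (arcs n (release g a) ++ R) := by
    rw [support_append]
    rintro (h1 | h1)
    · exact (mem_support_arcs hr).1 h1 (release_self g a)
    · exact hR h1
  rw [← numClasses_eliminate hsupp h hb]
  have hinv := hg.invol
  refine numClasses_congr_swap (fun x y hxy => ?_) fun x y hxy => ?_ <;>
    simp only [List.mem_cons, List.mem_append, mem_arcs hg, mem_arcs hr, Prod.mk.injEq,
      release] at hxy ⊢ <;> have := hinv x <;> have := hinv a <;> grind

theorem numClasses_link {n : ℕ} {g : ℕ → ℕ} (hg : IsPairing n g) {p q : ℕ} (hp : g p = p)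
    (hq : g q = q) (hpn : p < n) (hqn : q < n) (hpq : p ≠ q) (R : List (ℕ × ℕ)) :
    numClasses ((p, q) :: (arcs n g ++ R)) = numClasses (arcs n (link g p q) ++ R) := by
  have hl := hg.link hp hq hpn hqn
  refine numClasses_congr_swap (fun x y hxy => ?_) fun x y hxy => ?_ <;>
    simp only [List.mem_cons, List.mem_append, mem_arcs hg, mem_arcs hl, Prod.mk.injEq,
      link] at hxy ⊢ <;> grind

/-- The pairing after `a` and `b` have been joined. -/
def joinPairing (g : ℕ → ℕ) (a b : ℕ) : ℕ → ℕ :=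
  if g a = release g a b then release (release g a) b
  else link (release (release g a) b) (g a) (release g a b)

/-- Each number is used at most twice, in the pairing and in the list `occ`. -/
def AtMostTwice (g : ℕ → ℕ) (occ : List ℕ) : Prop :=
  ∀ c, (if g c ≠ c then 1 else 0) + occ.count c ≤ 2

theorem IsPairing.joinPairing {n : ℕ} {g : ℕ → ℕ} (hg : IsPairing n g) {a b : ℕ} (ha : a < n)
    (hb : b < n) : IsPairing n (joinPairing g a b) := by
  unfold VirtualKnotTheory.joinPairing
  split_ifs with h
  · exact (hg.release a).release b
  · exact ((hg.release a).release b).link (release_fixed _ (release_partner _ _))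
      (release_partner _ _) (hg.apply_lt ha) ((hg.release a).apply_lt hb)

/-- An open end counts as one use of its label. Joining spends an occurrence of `a` and of `b`,
while a label different from both that was fixed before cannot become open. -/
theorem AtMostTwice.joinPairing {g : ℕ → ℕ} (hinv : ∀ c, g (g c) = c) {a b : ℕ} {occ : List ℕ}
    (h : AtMostTwice g (a :: b :: occ)) : AtMostTwice (joinPairing g a b) occ := by
  intro c
  have h1 := h c
  simp only [List.count_cons, beq_iff_eq] at h1
  by_cases hc : a = c ∨ b = c
  · have : List.count c occ ≤ 1 := by
      rcases hc with hc | hc <;> simp only [hc, if_true] at h1 <;> omega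
    split_ifs <;> omega
  · rw [not_or] at hc
    simp only [hc.1, hc.2, if_false, add_zero] at h1
    refine le_trans (Nat.add_le_add_right ?_ _) h1
    by_cases h2 : g c = c
    · have h3 : c ≠ g a := fun h => hc.1 (by rw [← hinv a, ← h, h2])
      have h4 : release g a c = c := release_fixed a h2
      have h5 : c ≠ release g a b := by
        unfold release
        have := hinv b
        grind
      have h6 : VirtualKnotTheory.joinPairing g a b c = c := by
        unfold VirtualKnotTheory.joinPairing
        split_ifs
        · exact release_fixed b h4
        · simp [link, h3, h5, release_fixed b h4]
      simp [h6]
    · simp only [ne_eq, h2, not_false_eq_true, if_true]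
      split_ifs <;> omega

/-- Follow the arcs at `a` and at `b` to their far ends. If these coincide, a curve has closed and
contributes one class that no later pair in `R` can touch; otherwise the far ends bound a single new
arc. The bound of two uses per label guarantees that spent labels do not recur in `R`. -/
theorem numClasses_joinPairing {n : ℕ} {g : ℕ → ℕ} (hg : IsPairing n g) {a b : ℕ} (ha : a < n)
    (hb : b < n) {occ : List ℕ} (h : AtMostTwice g (a :: b :: occ)) {R : List (ℕ × ℕ)}
    (hR : ∀ c ∈ support R, c ∈ occ) :
    numClasses ((a, b) :: (arcs n g ++ R)) =
      numClasses (arcs n (joinPairing g a b) ++ R) + if g a = release g a b then 1 else 0 := by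
  have hcount : ∀ c ∈ support R, 1 ≤ occ.count c := fun c hc => List.count_pos_iff.2 (hR c hc)
  have hA : g a ≠ a → b ≠ a ∧ a ∉ support R := by
    intro h1
    have h2 := h a
    simp only [ne_eq, h1, not_false_eq_true, if_true, List.count_cons, beq_iff_eq] at h2
    refine ⟨fun h3 => ?_, fun h3 => ?_⟩
    · rw [if_pos h3] at h2; omega
    · have := hcount a h3; omega
  have hr := hg.release a
  have hB : release g a b ≠ b → g a ≠ b ∧ b ∉ support R := by
    intro h1
    have h3 : g b ≠ b := fun h3 => h1 (release_fixed a h3)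
    have h2 := h b
    simp only [ne_eq, h3, not_false_eq_true, if_true, List.count_cons, beq_iff_eq] at h2
    refine ⟨fun h4 => h1 ?_, fun h4 => ?_⟩
    · rw [← h4]; exact release_partner g a
    · have := hcount b h4; omega
  rw [numClasses_release hg hA]
  have hswap : numClasses ((g a, b) :: (arcs n (release g a) ++ R)) =
      numClasses ((b, g a) :: (arcs n (release g a) ++ R)) :=
    numClasses_congr_swap (fun x y => by simp only [List.mem_cons, Prod.mk.injEq]; tauto)
      fun x y => by simp only [List.mem_cons, Prod.mk.injEq]; tauto
  rw [hswap, numClasses_release hr hB]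
  have hpf : release (release g a) b (g a) = g a := release_fixed _ (release_partner _ _)
  have hqf : release (release g a) b (release g a b) = release g a b := release_partner _ _
  have hrr := hr.release b
  unfold joinPairing
  split_ifs with hpq
  · rw [← hpq]
    refine numClasses_loop ?_
    rw [support_append]
    rintro (h1 | h1)
    · exact (mem_support_arcs hrr).1 h1 hpf
    · have h2 := h (g a)
      have h3 := hcount _ h1
      have hinv := hg.invol a
      have hinvb := hg.invol b
      -- A curve closes either because both ends of one unused edge are joined (`a = b`) or because
      -- the arc from `a` to `b` is closed up. In both cases `g a` has already been used twice.
      by_cases hab : b = a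
      · by_cases hga : g a = a
        · rw [hga, hab] at h2
          rw [hga] at h3
          simp at h2
          omega
        · exact (hA hga).1 hab
      · have h4 : g a = b ∧ g b ≠ b := by
          simp only [release] at hpq
          grind
        rw [h4.1] at h2 h3
        simp only [ne_eq, h4.2, not_false_eq_true, if_true, List.count_cons, beq_iff_eq] at h2
        omega
  · have hl := numClasses_link hrr hpf hqf (hg.apply_lt ha) (hr.apply_lt hb) hpq R
    rw [← hl, add_zero]
    exact numClasses_congr_swap (fun x y => by simp only [List.mem_cons, Prod.mk.injEq]; tauto)
      fun x y => by simp only [List.mem_cons, Prod.mk.injEq]; tauto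

end Pairing
end VirtualKnotTheory

namespace VirtualKnotTheory

/-! ### Pairings coded as natural numbers -/

section Keys

/-- Apply `k` to `n`. The kernel evaluates `n` to a numeral before it unfolds `k`. -/
def force {R : Type} (n : ℕ) (k : ℕ → R) : R :=
  Nat.rec (motive := fun _ => R) (k 0) (fun m _ => k (Nat.succ m)) n

theorem force_eq {R : Type} (n : ℕ) (k : ℕ → R) : force n k = k n := by
  cases n <;> rfl

/-- A pairing of the numbers below `256` is coded by a number `m`: the `a`-th byte of `m`, after the
first 64 bits, is the bitwise difference of `a` and its partner. -/
def field (m a : ℕ) : ℕ := Nat.mod (Nat.shiftRight m (Nat.add 64 (Nat.mul 8 a))) 256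

/-- Add `f` bitwise to the field of `a`; the first 64 bits are a checksum, which serves as a hash
value in the kernel. -/
def toggle (m a f : ℕ) : ℕ :=
  Nat.xor m (Nat.mul f (Nat.add (Nat.shiftLeft 1 (Nat.add 64 (Nat.mul 8 a)))
    (Nat.shiftLeft 1 (Nat.mod (Nat.mul 13 a) 56))))

/-- The pairing with code `m`. -/
def partner (m a : ℕ) : ℕ := a ^^^ field m a

theorem field_lt (m a : ℕ) : field m a < 256 := Nat.mod_lt _ (by norm_num)

/-- Since `f` is one byte and the checksum part stays below `2 ^ 64`, the number that is added
bitwise has `f` in the field of `a` and zero in all other fields. -/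
theorem field_toggle {f : ℕ} (hf : f < 256) (m a c : ℕ) :
    field (toggle m a f) c = if c = a then field m c ^^^ f else field m c := by
  set k := 13 * a % 56 with hk
  have hk56 : k < 56 := Nat.mod_lt _ (by norm_num)
  have hN : toggle m a f = m ^^^ (f * (2 ^ (64 + 8 * a) + 2 ^ k)) := by
    rw [← Nat.one_shiftLeft, ← Nat.one_shiftLeft]; rfl
  have hfld : ∀ m, field m c = (m >>> (64 + 8 * c)) % 2 ^ 8 := fun _ => rfl
  have hlow : f * 2 ^ k < 2 ^ 64 := by
    calc f * 2 ^ k < 2 ^ 8 * 2 ^ k := Nat.mul_lt_mul_of_pos_right hf (by positivity)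
      _ = 2 ^ (8 + k) := (pow_add _ _ _).symm
      _ ≤ 2 ^ 64 := Nat.pow_le_pow_right (by norm_num) (by omega)
  have hdiv : (f * (2 ^ (64 + 8 * a) + 2 ^ k)) >>> (64 + 8 * c) = f * 2 ^ (8 * a) / 2 ^ (8 * c) := by
    rw [Nat.shiftRight_eq_div_pow, pow_add 2 64 (8 * c), ← Nat.div_div_eq_div_mul]
    congr 1
    rw [pow_add, mul_add, mul_left_comm, Nat.mul_add_div (by positivity), Nat.div_eq_of_lt hlow,
      add_zero]
  rw [hN, hfld, hfld, Nat.shiftRight_xor_distrib, Nat.xor_mod_two_pow, hdiv]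
  split_ifs with h
  · rw [h, Nat.mul_div_cancel _ (by positivity), Nat.mod_eq_of_lt hf]
  · rcases Nat.lt_or_gt_of_ne h with h | h
    · have : f * 2 ^ (8 * a) / 2 ^ (8 * c) % 2 ^ 8 = 0 := by
        obtain ⟨j, rfl⟩ := Nat.exists_eq_add_of_lt h
        have : f * 2 ^ (8 * (c + j + 1)) = f * 2 ^ (8 * j) * 2 ^ 8 * 2 ^ (8 * c) := by ring
        rw [this, Nat.mul_div_cancel _ (by positivity), Nat.mul_mod_left]
      rw [this, Nat.xor_zero]
    · have : f * 2 ^ (8 * a) / 2 ^ (8 * c) = 0 := by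
        refine Nat.div_eq_of_lt ?_
        calc f * 2 ^ (8 * a) < 2 ^ 8 * 2 ^ (8 * a) :=
              Nat.mul_lt_mul_of_pos_right hf (by positivity)
          _ = 2 ^ (8 + 8 * a) := (pow_add _ _ _).symm
          _ ≤ 2 ^ (8 * c) := Nat.pow_le_pow_right (by norm_num) (by omega)
      rw [this, Nat.zero_mod, Nat.xor_zero]

/-- Storing the bitwise difference makes the fields of the two partners equal, so one value erases
both. An unpaired `a` has field zero, so no case distinction is needed. -/
theorem partner_toggle_release {m : ℕ} (hg : IsPairing 256 (partner m)) (a : ℕ) :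
    partner (toggle (toggle m a (field m a)) (partner m a) (field m a)) =
      release (partner m) a := by
  have hf := field_lt m a
  have h1 : field m (partner m a) = field m a := by
    have := hg.invol a
    unfold partner at this ⊢
    rw [Nat.xor_assoc] at this
    have h2 : a ^^^ (field m a ^^^ field m (a ^^^ field m a)) = a ^^^ 0 := by
      rw [this, Nat.xor_zero]
    exact (Nat.xor_eq_zero_iff.1 (Nat.xor_right_inj.1 h2)).symm
  funext c
  rw [partner, field_toggle hf, field_toggle hf, release]
  by_cases hp : c = partner m a
  · subst hp
    by_cases ha : partner m a = a
    · have h0 : field m a = 0 := by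
        have : a ^^^ field m a = a ^^^ 0 := by rw [Nat.xor_zero]; exact ha
        exact Nat.xor_right_inj.1 this
      simp [ha, h0]
    · simp [ha, h1]
  · by_cases ha : c = a
    · subst ha
      simp [hp]
    · rw [if_neg hp, if_neg ha, if_neg (not_or.2 ⟨ha, hp⟩)]
      rfl

/-- For `p = q` the difference is zero and the code stays the same, which is exactly what happens
when a curve closes; thus `join` needs no branch on this. -/
theorem partner_toggle_link {m : ℕ} {p q : ℕ} (hp : partner m p = p) (hq : partner m q = q)
    (hp' : p < 256) (hq' : q < 256) :
    partner (toggle (toggle m p (p ^^^ q)) q (p ^^^ q)) =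
      if p = q then partner m else link (partner m) p q := by
  have hf : p ^^^ q < 256 := Nat.xor_lt_two_pow (n := 8) hp' hq'
  have key : ∀ a, partner m a = a → field m a = 0 := by
    intro a ha
    have : a ^^^ field m a = a ^^^ 0 := by rw [Nat.xor_zero]; exact ha
    exact Nat.xor_right_inj.1 this
  funext c
  rw [partner, field_toggle hf, field_toggle hf]
  by_cases hpq : p = q
  · subst hpq
    by_cases hc : c = p <;> simp [hc, partner]
  · rw [if_neg hpq, link]
    by_cases hcp : c = p
    · subst hcp
      simp [hpq, key _ hp]
    · by_cases hcq : c = q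
      · subst hcq
        simp [hcp, key _ hq, Nat.xor_comm p]
      · simp [hcp, hcq, partner]

/-- Join `a` and `b`; the flag tells whether a closed curve arises. -/
def join {R : Type} (a b m : ℕ) (k : ℕ → Bool → R) : R :=
  force (field m a) fun f => force (Nat.xor a f) fun p =>
  force (toggle (toggle m a f) p f) fun m =>
  force (field m b) fun f => force (Nat.xor b f) fun q =>
  force (toggle (toggle m b f) q f) fun m =>
  force (Nat.xor p q) fun e => force (toggle (toggle m p e) q e) fun m => k m (Nat.beq p q)

/-- Programs written in continuation-passing style are specified by a result that works for all
continuations simultaneously; the later specifications have the same form. -/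
theorem join_eq {a b m : ℕ} (hg : IsPairing 256 (partner m)) (ha : a < 256) (hb : b < 256) :
    ∃ m', partner m' = joinPairing (partner m) a b ∧ ∀ {R : Type} (k : ℕ → Bool → R),
      join a b m k = k m' (decide (partner m a = release (partner m) a b)) := by
  have h1 := partner_toggle_release hg a
  set m₁ := toggle (toggle m a (field m a)) (partner m a) (field m a) with hm₁
  have hr := hg.release a
  have hg₁ : IsPairing 256 (partner m₁) := h1 ▸ hr
  have h2 := partner_toggle_release hg₁ b
  set m₂ := toggle (toggle m₁ b (field m₁ b)) (partner m₁ b) (field m₁ b) with hm₂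
  have hp : partner m₂ (partner m a) = partner m a := by
    rw [h2, h1]
    exact release_fixed _ (release_partner _ _)
  have hq : partner m₂ (partner m₁ b) = partner m₁ b := by
    rw [h2]
    exact release_partner _ _
  have h3 := partner_toggle_link hp hq (hg.apply_lt ha) (hg₁.apply_lt hb)
  refine ⟨_, h3.trans ?_, fun k => ?_⟩
  · rw [h2, h1]
    rfl
  · have : decide (partner m a = release (partner m) a b) =
        Nat.beq (partner m a) (partner m₁ b) := by
      rw [← h1, Bool.eq_iff_iff, decide_eq_true_eq, Nat.beq_eq]
    rw [this]
    simp only [join, force_eq]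
    rfl

end Keys
end VirtualKnotTheory

namespace VirtualKnotTheory

/-! ### The weighted state sum -/

section StateSum

/-- A vertex of a diagram, with the labels of the edges only. -/
inductive Op : Type
  | classical (a b c d : ℕ)
  | virtual (a b c d : ℕ)
  | point (a b : ℕ)
  deriving DecidableEq

def Op.labels : Op → List ℕ
  | .classical a b c d => [a, b, c, d]
  | .virtual a b c d => [a, b, c, d]
  | .point a b => [a, b]

def labels (l : List Op) : List ℕ := l.flatMap Op.labels

/-- The state sum, where a smoothing of type `α` has weight `x` and a curve has weight `w`; the
pairs in `E` are already joined. -/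
noncomputable def stateSum {R : Type} [CommRing R] (x w : R) : List Op → List (ℕ × ℕ) → R
  | [], E => w ^ numClasses E
  | .classical a b c d :: l, E =>
    x * stateSum x w l ((a, b) :: (c, d) :: E) + stateSum x w l ((a, d) :: (b, c) :: E)
  | .virtual a b c d :: l, E => stateSum x w l ((a, c) :: (b, d) :: E)
  | .point a b :: l, E => stateSum x w l ((a, b) :: E)

variable {R : Type} [CommRing R] {x w : R}

/-- The joins made so far influence the rest of the sum only through the class counts after adding
pairs of remaining labels. If these counts differ by a constant `k` in all cases, every term differs
by `w ^ k`. This justifies both merging equal pairings and removing closed curves. -/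
theorem stateSum_shift {l : List Op} {E E' : List (ℕ × ℕ)} {k : ℕ}
    (h : ∀ P : List (ℕ × ℕ), (∀ c ∈ support P, c ∈ labels l) →
      numClasses (E ++ P) = numClasses (E' ++ P) + k) :
    stateSum x w l E = stateSum x w l E' * w ^ k := by
  induction l generalizing E E' k with
  | nil =>
    have := h [] (by simp [support_nil])
    simp only [List.append_nil] at this
    rw [stateSum, stateSum, this, pow_add]
  | cons o l ih =>
    have key : ∀ a b c d : ℕ, a ∈ o.labels → b ∈ o.labels → c ∈ o.labels → d ∈ o.labels →
        stateSum x w l ((a, b) :: (c, d) :: E) =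
          stateSum x w l ((a, b) :: (c, d) :: E') * w ^ k := by
      intro a b c d ha hb hc hd
      refine ih fun P hP => ?_
      have h1 := h ((a, b) :: (c, d) :: P) fun e he => ?_
      · have h2 : ∀ E : List (ℕ × ℕ), numClasses ((a, b) :: (c, d) :: E ++ P) =
            numClasses (E ++ (a, b) :: (c, d) :: P) := fun E =>
          numClasses_congr_mem fun p => by simp only [List.mem_append, List.mem_cons]; tauto
        rw [h2, h2, h1]
      · rw [labels, List.flatMap_cons, List.mem_append]
        simp only [support_cons] at he
        rcases he with rfl | rfl | rfl | rfl | he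
        · exact Or.inl ha
        · exact Or.inl hb
        · exact Or.inl hc
        · exact Or.inl hd
        · exact Or.inr (hP _ he)
    cases o with
    | classical a b c d =>
      rw [stateSum, stateSum, key a b c d (by simp [Op.labels]) (by simp [Op.labels])
        (by simp [Op.labels]) (by simp [Op.labels]), key a d b c (by simp [Op.labels])
        (by simp [Op.labels]) (by simp [Op.labels]) (by simp [Op.labels])]
      ring
    | virtual a b c d =>
      rw [stateSum, stateSum, key a c b d (by simp [Op.labels]) (by simp [Op.labels])
        (by simp [Op.labels]) (by simp [Op.labels])]
    | point a b =>
      rw [stateSum, stateSum]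
      -- Doubling the single pair reduces this case to `key`, which treats two pairs.
      have h2 : ∀ E : List (ℕ × ℕ), stateSum x w l ((a, b) :: (a, b) :: E) =
          stateSum x w l ((a, b) :: E) := by
        intro E
        rw [ih (E' := (a, b) :: E) (k := 0), pow_zero, mul_one]
        intro P _
        exact numClasses_congr_mem fun p => by simp
      rw [← h2, key a b a b (by simp [Op.labels]) (by simp [Op.labels]) (by simp [Op.labels])
        (by simp [Op.labels]), h2]

theorem stateSum_congr {l : List Op} {E E' : List (ℕ × ℕ)} (h : ∀ p, p ∈ E ↔ p ∈ E') :
    stateSum x w l E = stateSum x w l E' := by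
  rw [stateSum_shift (E' := E') (k := 0), pow_zero, mul_one]
  intro P _
  exact numClasses_congr_mem fun p => by simp only [List.mem_append, h]

/-- This leaves the order of smoothing free, so that it can be chosen to keep the number of pairings
small. -/
theorem stateSum_perm {l l' : List Op} (h : l.Perm l') (E : List (ℕ × ℕ)) :
    stateSum x w l E = stateSum x w l' E := by
  induction h generalizing E with
  | nil => rfl
  | cons o _ ih => cases o <;> simp only [stateSum, ih]
  | swap o o' l =>
    have hc : ∀ (p q r s : ℕ × ℕ) (E : List (ℕ × ℕ)), stateSum x w l (p :: q :: r :: s :: E) =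
        stateSum x w l (r :: s :: p :: q :: E) := fun p q r s E =>
      stateSum_congr fun t => by simp only [List.mem_cons]; tauto
    have hc' : ∀ (p q r : ℕ × ℕ) (E : List (ℕ × ℕ)), stateSum x w l (p :: q :: r :: E) =
        stateSum x w l (r :: p :: q :: E) := fun p q r E =>
      stateSum_congr fun t => by simp only [List.mem_cons]; tauto
    have hc'' : ∀ (p q : ℕ × ℕ) (E : List (ℕ × ℕ)), stateSum x w l (p :: q :: E) =
        stateSum x w l (q :: p :: E) := fun p q E =>
      stateSum_congr fun t => by simp only [List.mem_cons]; tauto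
    rcases o with ⟨a, b, c, d⟩ | ⟨a, b, c, d⟩ | ⟨a, b⟩ <;>
      rcases o' with ⟨a', b', c', d'⟩ | ⟨a', b', c', d'⟩ | ⟨a', b'⟩ <;> simp only [stateSum]
    · rw [hc (a, b), hc (a, b), hc (a, d), hc (a, d)]; ring
    · rw [hc (a, b), hc (a, d)]
    · rw [← hc' (a, b), ← hc' (a, d)]
    · rw [hc (a, c), hc (a, c)]
    · rw [hc (a, c)]
    · rw [← hc' (a, c)]
    · rw [hc' (a', b'), hc' (a', d')]
    · rw [hc' (a', c')]
    · rw [hc'']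
  | trans _ _ ih₁ ih₂ => rw [ih₁, ih₂]

theorem map_stateSum {S : Type} [CommRing S] (φ : R →+* S) (l : List Op) (E : List (ℕ × ℕ)) :
    φ (stateSum x w l E) = stateSum (φ x) (φ w) l E := by
  induction l generalizing E with
  | nil => simp [stateSum]
  | cons o l ih => cases o <;> simp [stateSum, ih]

end StateSum

/-! ### Tables of pairings with coefficients -/

section Table

/-- A search tree. A node has a hash value, a key and a coefficient. -/
inductive Table : Type
  | leaf
  | node (h m v : ℕ) (l r : Table)

/-- Add `v` to the coefficient of the key `m` with hash value `h`, modulo `M`. -/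
noncomputable def Table.insert {R : Type} (M h m v : ℕ) (t : Table) : (Table → R) → R :=
  Table.rec (motive := fun _ => (Table → R) → R)
    (fun k => k (.node h m v .leaf .leaf))
    (fun h' m' v' l r il ir k =>
      Bool.rec
        (Bool.rec (ir fun r' => k (.node h' m' v' l r'))
          (force (Nat.mod (Nat.add v v') M) fun w => k (.node h' m' w l r)) (Nat.beq m m'))
        (il fun l' => k (.node h' m' v' l' r)) (Nat.blt h h')) t

noncomputable def Table.fold {R : Type} (f : ℕ → ℕ → Table → (Table → R) → R) (t : Table) :
    Table → (Table → R) → R :=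
  Table.rec (motive := fun _ => Table → (Table → R) → R) (fun s k => k s)
    (fun _ m v _ _ il ir s k => f m v s fun s => il s fun s => ir s k) t

/-- All keys of a table satisfy `p`. -/
def Table.All (p : ℕ → Prop) : Table → Prop
  | .leaf => True
  | .node _ m _ l r => p m ∧ l.All p ∧ r.All p

/-- The linear combination of the values of `F` at the keys. -/
def Table.total {M : ℕ} (F : ℕ → ZMod M) : Table → ZMod M
  | .leaf => 0
  | .node _ m v l r => v * F m + l.total F + r.total F

/-- The total depends on the entries and not on their arrangement, so no ordering invariant of the
tree is needed. The hash affects speed only, and a key stored twice would still give the right sum.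
-/
theorem Table.insert_eq (M h m v : ℕ) (t : Table) :
    ∃ t' : Table, (∀ {R : Type} (k : Table → R), t.insert M h m v k = k t') ∧
      (∀ p : ℕ → Prop, p m → t.All p → t'.All p) ∧
      ∀ F : ℕ → ZMod M, t'.total F = t.total F + v * F m := by
  induction t with
  | leaf =>
    exact ⟨.node h m v .leaf .leaf, fun k => rfl, fun p hp _ => ⟨hp, trivial, trivial⟩,
      fun F => by simp [total]⟩
  | node h' m' v' l r il ir =>
    obtain ⟨l', hl1, hl2, hl3⟩ := il
    obtain ⟨r', hr1, hr2, hr3⟩ := ir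
    by_cases hlt : Nat.blt h h' = true
    · refine ⟨.node h' m' v' l' r, fun k => ?_, fun p hp ht => ⟨ht.1, hl2 p hp ht.2.1, ht.2.2⟩,
        fun F => by rw [total, total, hl3]; ring⟩
      simp only [insert, hlt] at hl1 ⊢
      exact hl1 _
    · by_cases heq : Nat.beq m m' = true
      · have hm : m = m' := Nat.eq_of_beq_eq_true heq
        refine ⟨.node h' m' (Nat.mod (Nat.add v v') M) l r, fun k => ?_, fun p hp ht => ht,
          fun F => ?_⟩
        · simp only [insert, Bool.eq_false_iff.2 hlt, heq, force_eq]
        · have : ((Nat.mod (Nat.add v v') M : ℕ) : ZMod M) = v + v' := by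
            rw [← Nat.cast_add]
            exact ZMod.natCast_mod _ _
          rw [total, total, this, hm]
          ring
      · refine ⟨.node h' m' v' l r', fun k => ?_, fun p hp ht => ⟨ht.1, ht.2.1, hr2 p hp ht.2.2⟩,
          fun F => by rw [total, total, hr3]; ring⟩
        simp only [insert, Bool.eq_false_iff.2 hlt, Bool.eq_false_iff.2 heq] at hr1 ⊢
        exact hr1 _

theorem Table.fold_eq {M : ℕ} {f : ∀ {R : Type}, ℕ → ℕ → Table → (Table → R) → R}
    {p q : ℕ → Prop} {F G : ℕ → ZMod M}
    (hf : ∀ m v s, p m → s.All q → ∃ s' : Table,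
      (∀ {R : Type} (k : Table → R), f m v s k = k s') ∧ s'.All q ∧
      s'.total G = s.total G + v * F m) (t : Table) (ht : t.All p) (s : Table) (hs : s.All q) :
    ∃ s' : Table, (∀ {R : Type} (k : Table → R), t.fold f s k = k s') ∧ s'.All q ∧
      s'.total G = s.total G + t.total F := by
  induction t generalizing s with
  | leaf => exact ⟨s, fun k => rfl, hs, by simp [total]⟩
  | node h m v l r il ir =>
    obtain ⟨s₁, h1, h2, h3⟩ := hf m v s ht.1 hs
    obtain ⟨s₂, h4, h5, h6⟩ := il ht.2.1 s₁ h2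
    obtain ⟨s₃, h7, h8, h9⟩ := ir ht.2.2 s₂ h5
    refine ⟨s₃, fun k => ?_, h8, by rw [h9, h6, h3, total]; ring⟩
    refine (h1 _).trans ((h4 _).trans (h7 _))

/-- Multiply `v` by `w` if `c` is true. -/
def mulIf {R : Type} (M w : ℕ) (c : Bool) (v : ℕ) (k : ℕ → R) : R :=
  Bool.rec (k v) (force (Nat.mod (Nat.mul v w) M) k) c

theorem mulIf_eq (M w : ℕ) (c : Bool) (v : ℕ) : ∃ v' : ℕ,
    (∀ {R : Type} (k : ℕ → R), mulIf M w c v k = k v') ∧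
      (v' : ZMod M) = v * (w : ZMod M) ^ (if c = true then 1 else 0) := by
  cases c with
  | false => exact ⟨v, fun k => rfl, by simp⟩
  | true =>
    refine ⟨Nat.mod (Nat.mul v w) M, fun k => force_eq _ _, ?_⟩
    rw [if_pos rfl, pow_one, ← Nat.cast_mul]
    exact ZMod.natCast_mod _ _

/-- Join `a` to `b` and `c` to `d` in the key `m` and add the result to the table. -/
noncomputable def smooth {R : Type} (M P w a b c d m v : ℕ) (t : Table) (k : Table → R) : R :=
  join a b m fun m l => join c d m fun m l' =>
  mulIf M w l v fun v => mulIf M w l' v fun v =>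
  force (Nat.mod m P) fun h => t.insert M h m v k

/-- The keys that may occur if the operations `l` remain to be done. -/
def IsKey (l : List Op) (m : ℕ) : Prop :=
  IsPairing 256 (partner m) ∧ AtMostTwice (partner m) (labels l)

theorem AtMostTwice.congr {g : ℕ → ℕ} {occ occ' : List ℕ} (h : AtMostTwice g occ)
    (hp : occ'.Perm occ) : AtMostTwice g occ' := fun c => by
  rw [hp.count_eq]; exact h c

/-- `numClasses_joinPairing` is applied to the two joins in turn; each closed curve puts a factor
`w` into the coefficient, which `stateSum_shift` extracts from the state sum. -/
theorem smooth_eq {M P w a b c d m v : ℕ} {x : ZMod M} {l : List Op}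
    (hg : IsPairing 256 (partner m)) (hm : AtMostTwice (partner m) (a :: b :: c :: d :: labels l))
    (ha : a < 256) (hb : b < 256) (hc : c < 256) (hd : d < 256) (t : Table) (ht : t.All (IsKey l)) :
    ∃ t' : Table, (∀ {R : Type} (k : Table → R), smooth M P w a b c d m v t k = k t') ∧
      t'.All (IsKey l) ∧
      t'.total (fun m => stateSum x (w : ZMod M) l (arcs 256 (partner m))) =
        t.total (fun m => stateSum x (w : ZMod M) l (arcs 256 (partner m))) +
          v * stateSum x (w : ZMod M) l ((a, b) :: (c, d) :: arcs 256 (partner m)) := by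
  obtain ⟨m₁, hm₁, hk₁⟩ := join_eq hg ha hb
  have hg₁ : IsPairing 256 (partner m₁) := hm₁ ▸ hg.joinPairing ha hb
  have ha₁ : AtMostTwice (partner m₁) (c :: d :: labels l) := hm₁ ▸ hm.joinPairing hg.invol
  obtain ⟨m₂, hm₂, hk₂⟩ := join_eq hg₁ hc hd
  have hg₂ : IsPairing 256 (partner m₂) := hm₂ ▸ hg₁.joinPairing hc hd
  have ha₂ : AtMostTwice (partner m₂) (labels l) := hm₂ ▸ ha₁.joinPairing hg₁.invol
  obtain ⟨v₁, hv₁, hw₁⟩ := mulIf_eq M w (decide (partner m a = release (partner m) a b)) v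
  obtain ⟨v₂, hv₂, hw₂⟩ := mulIf_eq M w (decide (partner m₁ c = release (partner m₁) c d)) v₁
  obtain ⟨t', h1, h2, h3⟩ := t.insert_eq M (Nat.mod m₂ P) m₂ v₂
  refine ⟨t', fun k => ?_, h2 _ ⟨hg₂, ha₂⟩ ht, ?_⟩
  · rw [smooth, hk₁, hk₂, hv₁, hv₂, force_eq, h1]
  · rw [h3, hw₂, hw₁]
    congr 1
    rw [stateSum_shift (E := (a, b) :: (c, d) :: arcs 256 (partner m))
      (E' := arcs 256 (partner m₂))
      (k := (if partner m a = release (partner m) a b then 1 else 0) +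
        if partner m₁ c = release (partner m₁) c d then 1 else 0)]
    · simp only [decide_eq_true_eq]
      ring
    · intro S hS
      have e1 := numClasses_joinPairing hg ha hb hm (R := (c, d) :: S) (fun e he => by
        rw [support_cons] at he
        rcases he with rfl | rfl | he
        · simp
        · simp
        · exact List.mem_cons_of_mem _ (List.mem_cons_of_mem _ (hS e he)))
      have e2 := numClasses_joinPairing hg₁ hc hd ha₁ (R := S) hS
      rw [← hm₁] at e1
      rw [← hm₂] at e2
      have e3 : numClasses ((a, b) :: (c, d) :: arcs 256 (partner m) ++ S) =
          numClasses ((a, b) :: (arcs 256 (partner m) ++ (c, d) :: S)) :=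
        numClasses_congr_mem fun p => by simp only [List.mem_append, List.mem_cons]; tauto
      have e4 : numClasses (arcs 256 (partner m₁) ++ (c, d) :: S) =
          numClasses ((c, d) :: (arcs 256 (partner m₁) ++ S)) :=
        numClasses_congr_mem fun p => by simp only [List.mem_append, List.mem_cons]; tauto
      rw [e3, e1, e4, e2]
      ring

/-- Process a vertex, with weight `x` for a smoothing of type `α` and weight `w` for a curve. -/
noncomputable def stepOp {R : Type} (M P x w : ℕ) (o : Op) (t : Table) (k : Table → R) : R :=
  Op.rec
    (fun a b c d => force a fun a => force b fun b => force c fun c => force d fun d =>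
      -- The smoothing of type `β` has weight 1 and comes first; the coefficient is then multiplied
      -- by `x` for type `α`.
      t.fold (fun m v s k => smooth M P w a d b c m v s fun s =>
        mulIf M x true v fun v => smooth M P w a b c d m v s k) .leaf k)
    (fun a b c d => force a fun a => force b fun b => force c fun c => force d fun d =>
      t.fold (fun m v s k => smooth M P w a c b d m v s k) .leaf k)
    (fun _ _ => k .leaf) o

/-- Crossings with labels below `256`. -/
def Op.Valid : Op → Prop
  | .classical a b c d => a < 256 ∧ b < 256 ∧ c < 256 ∧ d < 256
  | .virtual a b c d => a < 256 ∧ b < 256 ∧ c < 256 ∧ d < 256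
  | .point _ _ => False

instance : DecidablePred Op.Valid := fun o => by
  cases o <;> unfold Op.Valid <;> infer_instance

theorem stepOp_eq {M P x w : ℕ} {o : Op} {l : List Op} (ho : o.Valid) (t : Table)
    (ht : t.All (IsKey (o :: l))) :
    ∃ t' : Table, (∀ {R : Type} (k : Table → R), stepOp M P x w o t k = k t') ∧
      t'.All (IsKey l) ∧
      t'.total (fun m => stateSum (x : ZMod M) (w : ZMod M) l (arcs 256 (partner m))) =
        t.total fun m => stateSum (x : ZMod M) (w : ZMod M) (o :: l) (arcs 256 (partner m)) := by
  rcases o with ⟨a, b, c, d⟩ | ⟨a, b, c, d⟩ | ⟨a, b⟩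
  · obtain ⟨ha, hb, hc, hd⟩ := ho
    simp only [stepOp, force_eq]
    obtain ⟨t', h1, h2, h3⟩ := Table.fold_eq
      (f := fun m v s k => smooth M P w a d b c m v s fun s =>
        mulIf M x true v fun v => smooth M P w a b c d m v s k)
      (p := IsKey (.classical a b c d :: l)) (q := IsKey l)
      (F := fun m => stateSum (x : ZMod M) (w : ZMod M) (.classical a b c d :: l)
        (arcs 256 (partner m)))
      (G := fun m => stateSum (x : ZMod M) (w : ZMod M) l (arcs 256 (partner m)))
      (fun m v s hm hs => by
        have hm1 : AtMostTwice (partner m) (a :: b :: c :: d :: labels l) := hm.2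
        obtain ⟨s₁, k1, k2, k3⟩ := smooth_eq (M := M) (P := P) (w := w) (v := v)
          (x := (x : ZMod M)) hm.1 (hm1.congr (occ' := a :: d :: b :: c :: labels l)
            (List.perm_iff_count.2 fun e => by simp only [List.count_cons]; ring))
            ha hd hb hc s hs
        obtain ⟨v₁, hv, hw⟩ := mulIf_eq M x true v
        obtain ⟨s₂, k4, k5, k6⟩ := smooth_eq (M := M) (P := P) (w := w) (v := v₁)
          (x := (x : ZMod M)) hm.1 hm1 ha hb hc hd s₁ k2
        refine ⟨s₂, fun k => by rw [k1, hv, k4], k5, ?_⟩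
        rw [k6, k3, hw, if_pos rfl, stateSum]
        ring) t ht .leaf trivial
    exact ⟨t', h1, h2, by rw [h3, Table.total, zero_add]⟩
  · obtain ⟨ha, hb, hc, hd⟩ := ho
    simp only [stepOp, force_eq]
    obtain ⟨t', h1, h2, h3⟩ := Table.fold_eq
      (f := fun m v s k => smooth M P w a c b d m v s k)
      (p := IsKey (.virtual a b c d :: l)) (q := IsKey l)
      (F := fun m => stateSum (x : ZMod M) (w : ZMod M) (.virtual a b c d :: l)
        (arcs 256 (partner m)))
      (G := fun m => stateSum (x : ZMod M) (w : ZMod M) l (arcs 256 (partner m)))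
      (fun m v s hm hs => smooth_eq (M := M) (P := P) (w := w) (v := v)
        (x := (x : ZMod M)) hm.1 (AtMostTwice.congr (occ' := a :: c :: b :: d :: labels l) hm.2
          (List.perm_iff_count.2 fun e => by
            simp only [labels, Op.labels, List.flatMap_cons, List.cons_append, List.nil_append,
              List.count_cons]
            ring)) ha hc hb hd s hs) t ht .leaf trivial
    exact ⟨t', h1, h2, by rw [h3, Table.total, zero_add]⟩
  · exact ho.elim

noncomputable def run {R : Type} (M P x w : ℕ) (l : List Op) : Table → (Table → R) → R :=
  List.rec (motive := fun _ => Table → (Table → R) → R) (fun t k => k t)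
    (fun o _ ih t k => stepOp M P x w o t fun t => ih t k) l

/-- The total of the remaining state sums over all keys is preserved by each step of the
computation. -/
theorem run_eq {M P x w : ℕ} {l : List Op} (hl : ∀ o ∈ l, o.Valid) (t : Table)
    (ht : t.All (IsKey l)) :
    ∃ t' : Table, (∀ {R : Type} (k : Table → R), run M P x w l t k = k t') ∧
      t'.total (fun m => (w : ZMod M) ^ numClasses (arcs 256 (partner m))) =
        t.total fun m => stateSum (x : ZMod M) (w : ZMod M) l (arcs 256 (partner m)) := by
  induction l generalizing t with
  | nil => exact ⟨t, fun k => rfl, rfl⟩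
  | cons o l ih =>
    obtain ⟨t₁, h1, h2, h3⟩ := stepOp_eq (M := M) (P := P) (x := x) (w := w)
      (hl o List.mem_cons_self) t ht
    obtain ⟨t₂, h4, h5⟩ := ih (fun o ho => hl o (List.mem_cons_of_mem _ ho)) t₁ h2
    exact ⟨t₂, fun k => (h1 _).trans (h4 k), h5.trans h3⟩

end Table
end VirtualKnotTheory

namespace VirtualKnotTheory

/-! ### The bracket polynomial as a state sum -/

section Bracket

variable {L : Type}

/-- The vertex with the labels of its ends renamed by `enc`. -/
def Vertex.toOp (enc : L → ℕ) : Vertex L → Op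
  | .classical a b c d => .classical (enc a.1) (enc b.1) (enc c.1) (enc d.1)
  | .virtual a b c d => .virtual (enc a.1) (enc b.1) (enc c.1) (enc d.1)
  | .point a b => .point (enc a.1) (enc b.1)

/-- The number of classical crossings. -/
def numClassical : Diagram L → ℕ
  | [] => 0
  | .classical _ _ _ _ :: D => numClassical D + 1
  | .virtual _ _ _ _ :: D => numClassical D
  | .point _ _ :: D => numClassical D

theorem length_states (D : Diagram L) : (states D).length = 2 ^ numClassical D := by
  induction D with
  | nil => rfl
  | cons v D ih =>
    cases v with
    | classical a b c d =>
      simp only [states, List.length_flatMap, numClassical, pow_succ]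
      rw [← ih]
      generalize states D = S
      induction S with
      | nil => rfl
      | cons s S ihS =>
        simp at ihS ⊢
        omega
    | virtual a b c d => simpa [states, numClassical] using ih
    | point a b => simpa [states, numClassical] using ih

/-- Here `k` is the number of smoothings of type `α`. After the shift by the number of crossings,
all powers of `A` from smoothings are even and non-negative. -/
theorem states_c {D : Diagram L} {s : State L} (hs : s ∈ states D) :
    ∃ k : ℕ, k ≤ numClassical D ∧ s.c + numClassical D = 2 * k := by
  induction D generalizing s with
  | nil =>
    simp only [states, List.mem_singleton] at hs
    exact ⟨0, le_rfl, by simp [hs, numClassical]⟩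
  | cons v D ih =>
    cases v with
    | classical a b c d =>
      simp only [states, List.mem_flatMap, List.mem_cons, List.not_mem_nil, or_false] at hs
      obtain ⟨t, ht, rfl | rfl⟩ := hs <;> obtain ⟨k, hk, h⟩ := ih ht
      · exact ⟨k + 1, by simp only [numClassical]; omega,
          by simp only [numClassical]; push_cast; omega⟩
      · exact ⟨k, by simp only [numClassical]; omega, by simp only [numClassical]; push_cast; omega⟩
    | virtual a b c d =>
      obtain ⟨t, ht, rfl⟩ := List.mem_map.1 hs
      obtain ⟨k, hk, h⟩ := ih ht
      exact ⟨k, hk, h⟩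
    | point a b =>
      obtain ⟨t, ht, rfl⟩ := List.mem_map.1 hs
      obtain ⟨k, hk, h⟩ := ih ht
      exact ⟨k, hk, h⟩

theorem mem_ends_of_mem_joins {D : Diagram L} {s : State L} (hs : s ∈ states D)
    {p : HalfEdge L × HalfEdge L} (hp : p ∈ s.joins) : p.1 ∈ ends D ∧ p.2 ∈ ends D := by
  induction D generalizing s with
  | nil =>
    simp only [states, List.mem_singleton] at hs
    simp [hs] at hp
  | cons v D ih =>
    simp only [ends, List.flatMap_cons, List.mem_append] at ih ⊢
    have key : ∀ {t : State L}, t ∈ states D → p ∈ t.joins →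
        (p.1 ∈ v.ends ∨ p.1 ∈ List.flatMap Vertex.ends D) ∧
          (p.2 ∈ v.ends ∨ p.2 ∈ List.flatMap Vertex.ends D) :=
      fun ht hp => ⟨Or.inr (ih ht hp).1, Or.inr (ih ht hp).2⟩
    cases v with
    | classical a b c d =>
      simp only [states, List.mem_flatMap, List.mem_cons, List.not_mem_nil, or_false] at hs
      obtain ⟨t, ht, rfl | rfl⟩ := hs <;> simp only [List.mem_cons] at hp <;>
        rcases hp with rfl | rfl | hp <;> first | exact key ht hp | simp [Vertex.ends]
    | virtual a b c d =>
      obtain ⟨t, ht, rfl⟩ := List.mem_map.1 hs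
      simp only [List.mem_cons] at hp
      rcases hp with rfl | rfl | hp <;> first | exact key ht hp | simp [Vertex.ends]
    | point a b =>
      obtain ⟨t, ht, rfl⟩ := List.mem_map.1 hs
      simp only [List.mem_cons] at hp
      rcases hp with rfl | hp <;> first | exact key ht hp | simp [Vertex.ends]

theorem length_joins {D : Diagram L} {s : State L} (hs : s ∈ states D) :
    D.length ≤ s.joins.length ∧ s.joins.length ≤ 2 * D.length := by
  induction D generalizing s with
  | nil =>
    simp only [states, List.mem_singleton] at hs
    simp [hs]
  | cons v D ih =>
    cases v with
    | classical a b c d =>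
      simp only [states, List.mem_flatMap, List.mem_cons, List.not_mem_nil, or_false] at hs
      obtain ⟨t, ht, rfl | rfl⟩ := hs <;> have := ih ht <;> simp only [List.length_cons] <;> omega
    | virtual a b c d =>
      obtain ⟨t, ht, rfl⟩ := List.mem_map.1 hs
      have := ih ht
      simp only [List.length_cons]
      omega
    | point a b =>
      obtain ⟨t, ht, rfl⟩ := List.mem_map.1 hs
      have := ih ht
      simp only [List.length_cons]
      omega

/-- The pairs of labels of the joined edges. -/
def labelPairs (enc : L → ℕ) (joins : List (HalfEdge L × HalfEdge L)) : List (ℕ × ℕ) :=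
  joins.map fun p => (enc p.1.1, enc p.2.1)

theorem numClasses_labelPairs {D : Diagram L} {enc : L → ℕ} {dec : ℕ → L}
    (h : ∀ e ∈ ends D, dec (enc e.1) = e.1) {s : State L} (hs : s ∈ states D) :
    numClasses (labelPairs enc s.joins) = numCurves s.joins := by
  have hmap : labelPairs enc s.joins =
      (s.joins.map fun p => (p.1.1, p.2.1)).map fun p => (enc p.1, enc p.2) := by
    simp [labelPairs]
  rw [hmap, numCurves]
  refine numClasses_map (Set.LeftInvOn.injOn (f₁' := dec) ?_)
  rintro x ⟨q, hq, hx⟩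
  obtain ⟨p, hp, rfl⟩ := List.mem_map.1 hq
  have := mem_ends_of_mem_joins hs hp
  rcases hx with rfl | rfl
  · exact h _ this.1
  · exact h _ this.2

open LaurentPolynomial in
-- One factor `A` per crossing turns the weights `A` and `A ^ (-1)` into `A ^ 2` and 1.
theorem sum_states (D : Diagram L) (enc : L → ℕ) (w : LaurentPolynomial ℤ) (E : List (ℕ × ℕ)) :
    ((states D).map fun s => T (s.c + numClassical D) *
      w ^ numClasses (labelPairs enc s.joins ++ E)).sum =
        stateSum (T 2) w (D.map (Vertex.toOp enc)) E := by
  induction D generalizing E with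
  | nil => simp [states, numClassical, labelPairs, stateSum]
  | cons v D ih =>
    have hc : ∀ (p q : ℕ × ℕ) (l E : List (ℕ × ℕ)),
        numClasses (p :: q :: (l ++ E)) = numClasses (l ++ p :: q :: E) := fun p q l E =>
      numClasses_congr_mem fun t => by simp only [List.mem_append, List.mem_cons]; tauto
    have hc' : ∀ (p : ℕ × ℕ) (l E : List (ℕ × ℕ)),
        numClasses (p :: (l ++ E)) = numClasses (l ++ p :: E) := fun p l E =>
      numClasses_congr_mem fun t => by simp only [List.mem_append, List.mem_cons]; tauto
    cases v with
    | classical a b c d =>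
      have h1 : ∀ c : ℤ, (T (c + 1 + (numClassical D + 1 : ℕ)) : LaurentPolynomial ℤ) =
          T 2 * T (c + numClassical D) := fun c => by
        rw [← T_add]; congr 1; push_cast; ring
      have h2 : ∀ c : ℤ, (T (c - 1 + (numClassical D + 1 : ℕ)) : LaurentPolynomial ℤ) =
          T (c + numClassical D) := fun c => by
        congr 1; push_cast; ring
      rw [List.map_cons, Vertex.toOp, stateSum, ← ih, ← ih, ← List.sum_map_mul_left,
        ← List.sum_map_add, states, List.map_flatMap]
      simp only [numClassical, List.map_cons, List.map_nil, labelPairs, List.cons_append,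
        h1, h2, hc, mul_assoc]
      generalize states D = S
      induction S with
      | nil => rfl
      | cons s S ihS =>
        simp only [List.flatMap_cons, List.sum_append, List.map_cons, List.sum_cons, ihS,
          List.sum_nil, add_zero]
    | virtual a b c d =>
      rw [List.map_cons, Vertex.toOp, stateSum, ← ih, states, List.map_map]
      simp only [numClassical, labelPairs, Function.comp_def, List.map_cons, List.cons_append, hc]
    | point a b =>
      rw [List.map_cons, Vertex.toOp, stateSum, ← ih, states, List.map_map]
      simp only [numClassical, labelPairs, Function.comp_def, List.map_cons, List.cons_append, hc']

open LaurentPolynomial in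
-- A non-empty diagram has at least one curve in each state, so the factor `d` undoes the truncated
-- exponent `|s| - 1`.
theorem bracket_eq_sum {D : Diagram L} (hD : D ≠ []) :
    T (numClassical D) * (d * bracket D) =
      ((states D).map fun s => T (s.c + numClassical D) * d ^ numCurves s.joins).sum := by
  rw [bracket, ← mul_assoc, ← List.sum_map_mul_left]
  congr 1
  refine List.map_congr_left fun s hs => ?_
  have hpos : 0 < numCurves s.joins := by
    refine numClasses_pos fun h => ?_
    have h1 := (length_joins hs).1
    rw [List.map_eq_nil_iff.1 h, List.length_nil] at h1
    exact hD (List.length_eq_zero_iff.1 (Nat.le_zero.1 h1))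
  obtain ⟨k, hk⟩ := Nat.exists_eq_succ_of_ne_zero hpos.ne'
  rw [hk, Nat.succ_eq_add_one, Nat.add_sub_cancel, add_comm s.c, T_add, pow_succ]
  ring

open LaurentPolynomial in
theorem bracket_eq_stateSum {D : Diagram L} (hD : D ≠ []) {enc : L → ℕ} {dec : ℕ → L}
    (h : ∀ e ∈ ends D, dec (enc e.1) = e.1) :
    T (numClassical D) * (d * bracket D) = stateSum (T 2) d (D.map (Vertex.toOp enc)) [] := by
  rw [bracket_eq_sum hD, ← sum_states]
  congr 1
  refine List.map_congr_left fun s hs => ?_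
  rw [List.append_nil, numClasses_labelPairs h hs]

end Bracket

/-! ### A priori bounds and recovery of a polynomial from one residue -/

section Bounds

open LaurentPolynomial

/-- All coefficients are at most `C`, and all exponents are even numbers `2 * k` with
`lo ≤ k ≤ hi`. -/
def IsBounded (C : ℕ) (lo hi : ℤ) (P : LaurentPolynomial ℤ) : Prop :=
  ∀ i, |P.coeff i| ≤ C ∧ (P.coeff i ≠ 0 → ∃ k, lo ≤ k ∧ k ≤ hi ∧ i = 2 * k)

theorem IsBounded.mono {C C' : ℕ} {lo hi lo' hi' : ℤ} {P : LaurentPolynomial ℤ}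
    (h : IsBounded C lo hi P) (hC : C ≤ C') (hlo : lo' ≤ lo) (hhi : hi ≤ hi') :
    IsBounded C' lo' hi' P := fun i => by
  refine ⟨(h i).1.trans (by exact_mod_cast hC), fun h0 => ?_⟩
  obtain ⟨k, h1, h2, h3⟩ := (h i).2 h0
  exact ⟨k, hlo.trans h1, h2.trans hhi, h3⟩

theorem isBounded_zero (lo hi : ℤ) : IsBounded 0 lo hi 0 := fun i => by simp

theorem IsBounded.add {C C' : ℕ} {lo hi : ℤ} {P Q : LaurentPolynomial ℤ}
    (h : IsBounded C lo hi P) (h' : IsBounded C' lo hi Q) : IsBounded (C + C') lo hi (P + Q) := by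
  intro i
  have h1 : (P + Q).coeff i = P.coeff i + Q.coeff i := rfl
  rw [h1]
  refine ⟨(abs_add_le _ _).trans (by push_cast; exact add_le_add (h i).1 (h' i).1), fun h0 => ?_⟩
  by_cases hP : P.coeff i = 0
  · exact (h' i).2 fun hQ => h0 (by rw [hP, hQ, add_zero])
  · exact (h i).2 hP

theorem IsBounded.neg {C : ℕ} {lo hi : ℤ} {P : LaurentPolynomial ℤ} (h : IsBounded C lo hi P) :
    IsBounded C lo hi (-P) := by
  intro i
  have h1 : (-P).coeff i = -P.coeff i := rfl
  rw [h1, abs_neg, neg_ne_zero]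
  exact h i

theorem coeff_T_mul (n i : ℤ) (P : LaurentPolynomial ℤ) :
    (T n * P).coeff i = P.coeff (i - n) := by
  rw [T, AddMonoidAlgebra.coeff_single_mul_apply, one_mul, neg_add_eq_sub]

theorem IsBounded.T_mul {C : ℕ} {lo hi : ℤ} {P : LaurentPolynomial ℤ} (h : IsBounded C lo hi P)
    (j : ℤ) : IsBounded C (lo + j) (hi + j) (T (2 * j) * P) := by
  intro i
  rw [coeff_T_mul]
  refine ⟨(h _).1, fun h0 => ?_⟩
  obtain ⟨k, h1, h2, h3⟩ := (h _).2 h0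
  exact ⟨k + j, by omega, by omega, by omega⟩

theorem isBounded_C (c : ℤ) : IsBounded c.natAbs 0 0 (C c) := by
  intro i
  rw [C_apply]
  split_ifs with h
  · exact ⟨by simp, fun _ => ⟨0, le_rfl, le_rfl, by simp [h]⟩⟩
  · exact ⟨by simp, fun h => absurd rfl h⟩

theorem IsBounded.d_mul {C : ℕ} {lo hi : ℤ} {P : LaurentPolynomial ℤ} (h : IsBounded C lo hi P) :
    IsBounded (C + C) (lo - 1) (hi + 1) (d * P) := by
  have h1 : d * P = -(T (2 * (-1)) * P) + -(T (2 * 1) * P) := by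
    rw [d]; norm_num; ring
  rw [h1]
  exact ((h.T_mul (-1)).neg.mono le_rfl (by omega) (by omega)).add
    ((h.T_mul 1).neg.mono le_rfl (by omega) (by omega))

theorem isBounded_d_pow (n : ℕ) : IsBounded (2 ^ n) (-n) n (d ^ n) := by
  induction n with
  | zero =>
    have := isBounded_C 1
    rw [map_one] at this
    simpa using this
  | succ n ih =>
    rw [pow_succ' d]
    exact ih.d_mul.mono (by rw [pow_succ]; omega) (by push_cast; omega) (by push_cast; omega)

theorem isBounded_sum {C : ℕ} {lo hi : ℤ} {ι : Type} (l : List ι) (f : ι → LaurentPolynomial ℤ)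
    (h : ∀ i ∈ l, IsBounded C lo hi (f i)) : IsBounded (l.length * C) lo hi (l.map f).sum := by
  induction l with
  | nil => simpa using isBounded_zero lo hi
  | cons i l ih =>
    rw [List.map_cons, List.sum_cons, List.length_cons, Nat.succ_mul, Nat.add_comm]
    exact (h i List.mem_cons_self).add (ih fun j hj => h j (List.mem_cons_of_mem _ hj))

/-- There are `2 ^ n` states for `n` classical crossings. Each vertex adds at most two joins, hence
a state has at most `2 * D.length` curves, and the coefficients of `d ^ k` are at most `2 ^ k`. -/
theorem isBounded_bracket {L : Type} {D : Diagram L} (hD : D ≠ []) :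
    IsBounded (2 ^ numClassical D * 2 ^ (2 * D.length)) (-(2 * D.length))
      (numClassical D + 2 * D.length) (T (numClassical D) * (d * bracket D)) := by
  rw [bracket_eq_sum hD, ← length_states]
  refine isBounded_sum _ _ fun s hs => ?_
  obtain ⟨k, hk, h⟩ := states_c hs
  have h1 : numCurves s.joins ≤ 2 * D.length :=
    (numClasses_le_length _).trans (by rw [List.length_map]; exact (length_joins hs).2)
  rw [h]
  exact ((isBounded_d_pow _).T_mul k).mono (Nat.pow_le_pow_right (by norm_num) h1)
    (by omega) (by omega)

/-- The value at `x` of the polynomial with the given coefficients. -/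
def horner {R : Type} [CommRing R] (x : R) (cs : List ℤ) : R :=
  cs.foldr (fun c r => c + x * r) 0

theorem map_horner {R S : Type} [CommRing R] [CommRing S] (φ : R →+* S) (x : R) (cs : List ℤ) :
    φ (horner x cs) = horner (φ x) cs := by
  induction cs with
  | nil => simp [horner]
  | cons c cs ih => simpa [horner] using congrArg _ ih

theorem isBounded_horner (cs : List ℤ) :
    IsBounded (cs.map Int.natAbs).sum 0 cs.length (horner (T 2) cs) := by
  induction cs with
  | nil => exact isBounded_zero _ _
  | cons c cs ih =>
    have h1 : horner (T 2) (c :: cs) = C c + T (2 * 1) * horner (T 2) cs := by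
      simp [horner]
    rw [h1, List.map_cons, List.sum_cons, List.length_cons]
    exact ((isBounded_C c).mono le_rfl le_rfl (by omega)).add
      ((ih.T_mul 1).mono le_rfl (by omega) (by push_cast; omega))

/-- Digits smaller than `X / 2` in absolute value are unique: `X` divides the lowest digit, which is
therefore zero, and one divides by `X` and repeats. -/
theorem eq_zero_of_sum_eq_zero {X : ℤ} (n : ℕ) {c : ℕ → ℤ} (hc : ∀ k, 2 * |c k| < X)
    (h : ∑ k ∈ Finset.range n, c k * X ^ k = 0) : ∀ k < n, c k = 0 := by
  induction n generalizing c with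
  | zero => intro k hk; omega
  | succ n ih =>
    rw [Finset.sum_range_succ'] at h
    have h1 : ∑ k ∈ Finset.range n, c (k + 1) * X ^ (k + 1) =
        X * ∑ k ∈ Finset.range n, c (k + 1) * X ^ k := by
      rw [Finset.mul_sum]
      exact Finset.sum_congr rfl fun k _ => by ring
    rw [h1, pow_zero, mul_one] at h
    have h0 : c 0 = 0 := by
      refine Int.eq_zero_of_abs_lt_dvd (m := X) ⟨-∑ k ∈ Finset.range n, c (k + 1) * X ^ k, ?_⟩ ?_
      · linarith
      · have := hc 0
        have := abs_nonneg (c 0)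
        linarith
    have hX : X ≠ 0 := by
      have := hc 0
      have := abs_nonneg (c 0)
      linarith
    rw [h0, add_zero] at h
    intro k hk
    cases k with
    | zero => exact h0
    | succ k =>
      exact ih (c := fun k => c (k + 1)) (fun k => hc _)
        ((mul_eq_zero.1 h).resolve_left hX) k (by omega)

theorem abs_sum_lt {X : ℤ} (n : ℕ) {c : ℕ → ℤ} (hc : ∀ k, 2 * |c k| < X) :
    |∑ k ∈ Finset.range n, c k * X ^ k| < X ^ n := by
  have hX : 0 < X := by
    have := hc 0
    have := abs_nonneg (c 0)
    linarith
  induction n with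
  | zero => simp
  | succ n ih =>
    rw [Finset.sum_range_succ]
    refine (abs_add_le _ _).trans_lt ?_
    rw [abs_mul, abs_of_pos (pow_pos hX n)]
    have h1 : |c n| + 1 ≤ X := by
      have := hc n
      have := abs_nonneg (c n)
      omega
    calc _ < X ^ n + |c n| * X ^ n := by linarith
      _ = (|c n| + 1) * X ^ n := by ring
      _ ≤ X * X ^ n := mul_le_mul_of_nonneg_right h1 (pow_pos hX n).le
      _ = X ^ (n + 1) := by ring

/-- A bounded Laurent polynomial vanishes if its value for a large `X = A ^ 2` is divisible by a
very large number. -/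
theorem IsBounded.eq_zero {B n M X : ℕ} {lo : ℤ} {P : LaurentPolynomial ℤ}
    (h : IsBounded B lo (lo + n) P) (hC : 2 * B < X) (hM : X ^ (n + 1) ≤ M) {u : (ZMod M)ˣ}
    (hu : ((u ^ 2 : (ZMod M)ˣ) : ZMod M) = X) (h0 : eval₂ (Int.castRingHom (ZMod M)) u P = 0) :
    P = 0 := by
  set c : ℕ → ℤ := fun k => P.coeff (2 * (lo + k)) with hc
  have hc2 : ∀ k, 2 * |c k| < (X : ℤ) := fun k => by
    have := (h (2 * (lo + k))).1
    zify at hC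
    linarith
  -- All exponents are even and lie in a known range, so up to a power of `A` this is a polynomial
  -- in `A ^ 2` of degree at most `n`.
  have hP : P = T (2 * lo) * ∑ k ∈ Finset.range (n + 1), C (c k) * T (2 * (k : ℤ)) := by
    ext i
    have h1 : ∀ k : ℕ, (C (c k) * T (2 * (k : ℤ)) : LaurentPolynomial ℤ).coeff (i - 2 * lo) =
        if i = 2 * (lo + k) then c k else 0 := by
      intro k
      rw [mul_comm, coeff_T_mul, C_apply]
      exact if_congr (by constructor <;> intro h <;> linarith) rfl rfl
    have h2 : ∀ s : Finset ℕ, (∑ k ∈ s, (C (c k) * T (2 * (k : ℤ)) :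
        LaurentPolynomial ℤ)).coeff (i - 2 * lo) =
          ∑ k ∈ s, if i = 2 * (lo + k) then c k else 0 := by
      classical
      intro s
      induction s using Finset.induction_on with
      | empty => simp
      | insert k s hk ih =>
        rw [Finset.sum_insert hk, Finset.sum_insert hk, ← h1, ← ih]
        rfl
    rw [coeff_T_mul, h2]
    by_cases hi : P.coeff i = 0
    · rw [hi]
      symm
      refine Finset.sum_eq_zero fun k _ => ?_
      split_ifs with hk
      · rw [hc, ← hi, hk]
      · rfl
    · obtain ⟨k, h3, h4, rfl⟩ := (h i).2 hi
      obtain ⟨j, rfl⟩ := Int.le.dest h3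
      rw [Finset.sum_eq_single_of_mem j (Finset.mem_range.2 (by omega))]
      · rw [if_pos rfl]
      · intro b _ hb
        rw [if_neg]
        omega
  -- The power of the unit `u` cancels. The remaining integer is divisible by `M` but smaller than
  -- `X ^ (n + 1) ≤ M`, so it is zero.
  have hsum : ((∑ k ∈ Finset.range (n + 1), c k * (X : ℤ) ^ k : ℤ) : ZMod M) = 0 := by
    rw [hP, map_mul, map_sum, eval₂_T] at h0
    have := (Units.mul_right_eq_zero _).1 h0
    rw [← this]
    push_cast
    refine Finset.sum_congr rfl fun k _ => ?_
    rw [map_mul, eval₂_C, eval₂_T, zpow_mul, zpow_natCast, Units.val_pow_eq_pow_val]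
    have h2 : (u ^ (2 : ℤ) : (ZMod M)ˣ) = u ^ 2 := by norm_cast
    rw [h2, hu]
    rfl
  have habs := abs_sum_lt (n + 1) hc2
  rw [ZMod.intCast_zmod_eq_zero_iff_dvd] at hsum
  have hz := Int.eq_zero_of_abs_lt_dvd hsum (habs.trans_le (by exact_mod_cast hM))
  have hall := eq_zero_of_sum_eq_zero (n + 1) hc2 hz
  rw [hP, Finset.sum_eq_zero, mul_zero]
  intro k hk
  rw [hall k (Finset.mem_range.1 hk), map_zero, zero_mul]

theorem d_ne_zero : d ≠ 0 := by
  intro h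
  have h1 : d.coeff 2 = -1 := by
    have : d.coeff 2 = -(T (-2) : LaurentPolynomial ℤ).coeff 2 - (T 2 : LaurentPolynomial ℤ).coeff 2 := rfl
    rw [this, T_apply, T_apply]
    norm_num
  rw [h] at h1
  simp at h1

end Bounds
end VirtualKnotTheory

namespace VirtualKnotTheory

/-! ### The numerical check and its consequence -/

section Check

/-- The value at `x` modulo `M` of the polynomial with the given coefficients. -/
noncomputable def hornerMod {R : Type} (M x : ℕ) (cs : List ℤ) : (ℕ → R) → R :=
  List.rec (motive := fun _ => (ℕ → R) → R) (fun k => k 0)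
    (fun c _ ih k => ih fun r => force (Nat.mod (Nat.add (Int.rec (motive := fun _ => ℕ)
      (fun n => n) (fun n => Nat.mul (Nat.succ n) (Nat.sub M 1)) c) (Nat.mul x r)) M) k) cs

theorem hornerMod_eq {M : ℕ} (hM : 0 < M) (x : ℕ) (cs : List ℤ) : ∃ r : ℕ,
    (∀ {R : Type} (k : ℕ → R), hornerMod M x cs k = k r) ∧ (r : ZMod M) = horner (x : ZMod M) cs := by
  induction cs with
  | nil => exact ⟨0, fun k => rfl, by simp [horner]⟩
  | cons c cs ih =>
    obtain ⟨r, h1, h2⟩ := ih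
    refine ⟨_, fun k => (h1 _).trans (force_eq _ _), ?_⟩
    have h3 : ∀ n : ℕ, ((Nat.mod n M : ℕ) : ZMod M) = n := fun n => ZMod.natCast_mod n M
    have h4 : horner (x : ZMod M) (c :: cs) = c + x * horner (x : ZMod M) cs := by simp [horner]
    rw [h3, h4, ← h2]
    cases c with
    | ofNat n =>
      refine (Nat.cast_add _ _).trans (congrArg₂ _ ?_ (Nat.cast_mul _ _))
      exact (Int.cast_natCast n).symm
    -- A negative coefficient is represented by a multiple of `M - 1`.
    | negSucc n =>
      have h5 : ((M - 1 : ℕ) : ZMod M) = -1 := by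
        rw [Nat.cast_sub hM, ZMod.natCast_self]; simp
      refine (Nat.cast_add _ _).trans (congrArg₂ _ ?_ (Nat.cast_mul _ _))
      refine (Nat.cast_mul _ _).trans ?_
      rw [Nat.sub_eq, h5, Int.cast_negSucc]
      simp

/-- Whether the table has the key `0` only, with a coefficient that satisfies `p`. -/
noncomputable def Table.checkRoot (p : ℕ → Bool) : Table → Bool :=
  Table.rec false fun _ m v l r _ _ =>
    (m.beq 0).and ((Table.rec true (fun _ _ _ _ _ _ _ => false) l : Bool).and
      ((Table.rec true (fun _ _ _ _ _ _ _ => false) r : Bool).and (p v)))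

theorem Table.exists_of_checkRoot {p : ℕ → Bool} {t : Table} (h : t.checkRoot p = true) :
    ∃ k v, t = .node k 0 v .leaf .leaf ∧ p v = true := by
  cases t with
  | leaf => cases h
  | node k m v l r =>
    simp only [checkRoot, Bool.and_eq_true, Nat.beq_eq] at h
    obtain ⟨rfl, hl, hr, hp⟩ := h
    cases l with
    | node => cases hl
    | leaf => cases r with
      | node => cases hr
      | leaf => exact ⟨k, v, rfl, hp⟩

/-- Whether the state sum of `l` is `w * x ^ h * y ^ s * horner x cs` for the inverse `y` of `x`
modulo `M = x * y - 1` and `w = -x - y`. The coefficients are multiplied by a large power of `y`,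
so that different numbers in the computation are unlikely to agree in their last digits. -/
noncomputable def check (x y s h : ℕ) (cs : List ℤ) (l : List Op) : Bool :=
  force x fun x => force y fun y => force (Nat.sub (Nat.mul x y) 1) fun M =>
  force (Nat.sub (Nat.sub M x) y) fun w => force (Nat.mod (Nat.pow y 100) M) fun v =>
  run M 2147483647 x w l (.node 0 0 v .leaf .leaf) fun t => hornerMod M x cs fun r =>
  t.checkRoot fun v' => Nat.beq (Nat.mod (Nat.mul v' (Nat.pow x s)) M)
    (Nat.mod (Nat.mul (Nat.mod (Nat.mul v w) M) (Nat.mod (Nat.mul (Nat.pow x h) r) M)) M)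

theorem partner_zero (c : ℕ) : partner 0 c = c := by
  have : field 0 c = 0 := by
    rw [field, Nat.shiftRight_eq, Nat.zero_shiftRight]
  rw [partner, this, Nat.xor_zero]

/-- The run starts with the empty pairing, coded by 0, and the coefficient `y ^ 100`. If only the
key 0 remains, no arc is open and its coefficient is `y ^ 100` times the state sum; `y` is a unit
and cancels. -/
theorem stateSum_of_check {x y s h M : ℕ} {cs : List ℤ} {l : List Op} (hM : x * y = M + 1)
    (hxy : x + y ≤ M) (hl : ∀ o ∈ l, o.Valid) (hcount : ∀ c ∈ labels l, (labels l).count c ≤ 2)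
    (hc : check x y s h cs l = true) :
    stateSum (x : ZMod M) (-x - y) l [] * x ^ s = (-x - y) * (x ^ h * horner (x : ZMod M) cs) := by
  have hMe : Nat.sub (Nat.mul x y) 1 = M := by
    change x * y - 1 = M
    omega
  have hw : ((Nat.sub (Nat.sub M x) y : ℕ) : ZMod M) = -x - y := by
    rw [Nat.sub_eq, Nat.sub_eq, Nat.cast_sub (by omega), Nat.cast_sub (by omega),
      ZMod.natCast_self, zero_sub]
  have hunit : (x : ZMod M) * y = 1 := by
    rw [← Nat.cast_mul, hM, Nat.cast_add, ZMod.natCast_self, zero_add, Nat.cast_one]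
  have hmod : ∀ n : ℕ, ((Nat.mod n M : ℕ) : ZMod M) = n := fun n => ZMod.natCast_mod n M
  have hmul : ∀ m n : ℕ, ((Nat.mul m n : ℕ) : ZMod M) = m * n := fun m n => Nat.cast_mul m n
  have hpow : ∀ m n : ℕ, ((Nat.pow m n : ℕ) : ZMod M) = m ^ n := fun m n => Nat.cast_pow m n
  have hpos : 0 < M := by
    rcases Nat.eq_zero_or_pos M with rfl | h
    · have : x = 0 := by omega
      simp [this] at hM
    · exact h
  simp only [check, force_eq, hMe] at hc
  obtain ⟨r, hr1, hr2⟩ := hornerMod_eq hpos x cs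
  simp only [hr1] at hc
  have harcs : arcs 256 (partner 0) = [] := by simp [arcs, partner_zero]
  have hkey : IsKey l 0 := by
    refine ⟨⟨fun c => by simp [partner_zero], fun c h => absurd (partner_zero c) h⟩, fun c => ?_⟩
    rw [if_neg (not_not.2 (partner_zero c)), zero_add]
    by_cases h : c ∈ labels l
    · exact hcount c h
    · simp [List.count_eq_zero_of_not_mem h]
  obtain ⟨t, ht1, ht2⟩ := run_eq (M := M) (P := 2147483647) (x := x)
    (w := Nat.sub (Nat.sub M x) y) hl
    (.node 0 0 (Nat.mod (Nat.pow y 100) M) .leaf .leaf) ⟨hkey, trivial, trivial⟩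
  rw [ht1] at hc
  obtain ⟨k, v, rfl, hv⟩ := Table.exists_of_checkRoot hc
  have hv' := congrArg (Nat.cast : ℕ → ZMod M) (Nat.eq_of_beq_eq_true hv)
  simp only [hmod, hmul, hpow, hr2, hw] at hv'
  simp only [Table.total, harcs, hmod, hpow, hw, add_zero] at ht2
  have h0 : numClasses ([] : List (ℕ × ℕ)) = 0 := Nat.le_zero.1 (numClasses_le_length _)
  rw [h0, pow_zero, mul_one] at ht2
  rw [ht2] at hv'
  have hy : IsUnit ((y : ZMod M) ^ 100) := (IsUnit.of_mul_eq_one _ ((mul_comm _ _).trans hunit)).pow _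
  refine hy.mul_left_cancel ?_
  linear_combination hv'

open LaurentPolynomial in
set_option exponentiation.threshold 400 in
theorem bracket_eq_of_check {L : Type} {D : Diagram L} {enc : L → ℕ} {dec : ℕ → L} {l : List Op}
    {z y s h M : ℕ} {cs : List ℤ} (hM : z * z * y = M + 1) (hz : 2 ^ 100 ≤ z)
    (hM' : (z * z) ^ 343 ≤ M) (hxy : z * z + y ≤ M) (hD : D ≠ [])
    (hlen : D.length ≤ 72) (hn : numClassical D = 2 * h) (hh : h ≤ 27) (hs : s ≤ 100)
    (hcs : cs.length ≤ 100) (hsum : (cs.map Int.natAbs).sum ≤ 2 ^ 100)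
    (hdec : ∀ e ∈ ends D, dec (enc e.1) = e.1) (hperm : (D.map (Vertex.toOp enc)).Perm l)
    (hl : ∀ o ∈ l, o.Valid) (hcount : ∀ c ∈ labels l, (labels l).count c ≤ 2)
    (hc : check (z * z) y s h cs l = true) :
    bracket D = T (2 * (-s : ℤ)) * horner (T 2) cs := by
  have hunit : (z : ZMod M) * (z * y) = 1 := by
    rw [← mul_assoc, ← Nat.cast_mul, ← Nat.cast_mul, hM, Nat.cast_add, ZMod.natCast_self,
      zero_add, Nat.cast_one]
  -- The evaluation sends `A` to `z`; then `A ^ 2` goes to `z * z`, and `A ^ (-2)` to `y`.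
  set u : (ZMod M)ˣ := ⟨z, z * y, hunit, (mul_comm _ _).trans hunit⟩ with hu
  have hu2 : ((u ^ 2 : (ZMod M)ˣ) : ZMod M) = (z * z : ℕ) := by
    rw [Units.val_pow_eq_pow_val, pow_two, Nat.cast_mul]
  have huy : ((u⁻¹ ^ 2 : (ZMod M)ˣ) : ZMod M) = y := by
    have h1 : ((u⁻¹ : (ZMod M)ˣ) : ZMod M) = z * y := rfl
    rw [Units.val_pow_eq_pow_val, h1]
    linear_combination (y : ZMod M) * hunit
  have hT : ∀ n : ℕ, eval₂ (Int.castRingHom (ZMod M)) u (T (2 * (n : ℤ))) = (z * z : ℕ) ^ n := by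
    intro n
    rw [eval₂_T, zpow_mul, zpow_natCast, Units.val_pow_eq_pow_val, ← hu2]
    rfl
  have hT2 : eval₂ (Int.castRingHom (ZMod M)) u (T 2) = (z * z : ℕ) := by
    simpa using hT 1
  have hTneg : eval₂ (Int.castRingHom (ZMod M)) u (T (-2)) = y := by
    rw [eval₂_T, ← huy]
    congr 1
  have hd : eval₂ (Int.castRingHom (ZMod M)) u d = -(z * z : ℕ) - y := by
    rw [d, map_sub, map_neg, hT2, hTneg]
    ring
  set P := T (numClassical D) * (d * bracket D) with hP
  set Q := T (2 * (h : ℤ)) * (d * (T (2 * (-s : ℤ)) * horner (T 2) cs)) with hQ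
  have hPQ : eval₂ (Int.castRingHom (ZMod M)) u (P + -Q) = 0 := by
    have h1 := stateSum_of_check hM hxy hl hcount hc
    have h2 : eval₂ (Int.castRingHom (ZMod M)) u P =
        stateSum ((z * z : ℕ) : ZMod M) (-(z * z : ℕ) - y) l [] := by
      rw [hP, bracket_eq_stateSum hD hdec, map_stateSum, hT2, hd, stateSum_perm hperm]
    have h3 : eval₂ (Int.castRingHom (ZMod M)) u Q * (z * z : ℕ) ^ s =
        (-(z * z : ℕ) - y) * ((z * z : ℕ) ^ h * horner ((z * z : ℕ) : ZMod M) cs) := by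
      have h4 : (T (2 * (-s : ℤ)) * T (2 * (s : ℤ)) : LaurentPolynomial ℤ) = 1 := by
        rw [← T_add, mul_neg, neg_add_cancel, T_zero]
      have h5 := congrArg (eval₂ (Int.castRingHom (ZMod M)) u) h4
      rw [map_mul, hT, map_one] at h5
      rw [hQ, map_mul, map_mul, map_mul, map_horner, hT, hT2, hd]
      linear_combination ((z * z : ℕ) : ZMod M) ^ h * (-(z * z : ℕ) - y) *
        horner ((z * z : ℕ) : ZMod M) cs * h5
    have hy : IsUnit (((z * z : ℕ) : ZMod M) ^ s) := by
      refine IsUnit.pow _ (IsUnit.of_mul_eq_one (y : ZMod M) ?_)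
      rw [← hunit]
      push_cast
      ring
    rw [map_add, map_neg, add_neg_eq_zero]
    refine hy.mul_right_cancel ?_
    rw [h3, h2, h1]
  -- At most 72 vertices give at most 144 curves, and at most 54 crossings give `2 ^ 54` states:
  -- `198 = 54 + 144`.
  have hbP : IsBounded (2 ^ 198) (-144) 198 P := by
    refine (isBounded_bracket hD).mono ?_ (by omega) (by omega)
    rw [← pow_add]
    exact Nat.pow_le_pow_right (by norm_num) (by omega)
  have hbQ : IsBounded (2 ^ 101) (-144) 198 Q :=
    (((isBounded_horner cs).T_mul (-s)).d_mul.T_mul h).mono (by rw [pow_succ]; omega) (by omega)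
      (by omega)
  have h0 : P + -Q = 0 := by
    -- The range from -144 to 198 has length 342, which explains the exponent 343 in `hM'`.
    refine IsBounded.eq_zero (n := 342) (X := z * z) (hbP.add hbQ.neg) ?_ hM' hu2 hPQ
    calc 2 * (2 ^ 198 + 2 ^ 101) < 2 ^ 100 * 2 ^ 100 := by norm_num
      _ ≤ z * z := Nat.mul_le_mul hz hz
  rw [add_neg_eq_zero, hP, hQ, hn] at h0
  have h6 : IsUnit (T ((2 * h : ℕ) : ℤ) : LaurentPolynomial ℤ) := isUnit_T _
  have h7 := h6.mul_left_cancel (h0.trans (by push_cast; rfl))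
  exact mul_left_cancel₀ d_ne_zero h7

end Check
end VirtualKnotTheory

namespace VirtualKnotTheory

/-! ### The three brackets of `K_m` -/

section Cables

/-- A numbering of the labels of a cable of `kmVertices` with at most three strands. -/
def CableLabel.code : CableLabel ℕ → ℕ
  | .strand e m => 3 * e + m
  | .vertical g i j => 48 + 12 * g.1 + 2 * i + (j - 1)
  | .horizontal g i j => 54 + 12 * g.1 + 2 * j + (i - 1)

/-- The inverse of `CableLabel.code` on the labels that occur. -/
def CableLabel.decode (n : ℕ) : CableLabel ℕ :=
  if n < 48 then .strand (n / 3) (n % 3)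
  else if (n - 48) % 12 < 6 then
    .vertical ((n - 48) / 12, false) ((n - 48) % 12 / 2) (n % 2 + 1)
  else .horizontal ((n - 48) / 12, false) (n % 2 + 1) (((n - 48) % 12 - 6) / 2)

def CableLabel.toProd : CableLabel ℕ → ℕ × HalfEdge ℕ × ℕ × ℕ
  | .strand e m => (0, (e, true), m, 0)
  | .vertical g i j => (1, g, i, j)
  | .horizontal g i j => (2, g, i, j)

theorem CableLabel.toProd_injective : Function.Injective CableLabel.toProd := by
  rintro (_ | _ | _) (_ | _ | _) h <;> simp_all [toProd]

instance : DecidableEq (CableLabel ℕ) := CableLabel.toProd_injective.decidableEq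

/-- The crossings of a cable of `kmVertices` in the order in which they are smoothed. -/
def cableOps (N : ℕ) (order : List ℕ) : List Op :=
  order.map fun i => ((cable N kmVertices).map (Vertex.toOp CableLabel.code)).getD i (.point 0 0)

/-- An order of the crossings for which few pairings arise. -/
def smoothingOrder : List ℕ :=
  [54, 55, 56, 57, 58, 59, 60, 61, 62, 63, 64, 65, 66, 67, 68, 69, 70, 71, 13, 12, 15, 16, 32,
    35, 14, 17, 34, 31, 33, 11, 10, 30, 9, 29, 28, 27, 18, 21, 24, 8, 5, 2, 19, 22, 25, 7, 4, 1,
    0, 3, 6, 20, 26, 23, 39, 36, 42, 53, 50, 47, 52, 49, 46, 45, 48, 51, 43, 44, 37, 38, 41, 40]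

def bracketCoeffs : List ℤ :=
  [-1, 0, 1, 2, 5, 10, 21, 25, 26, 21, 8, -19, -69, -115, -155, -175, -172, -127, -23, 109, 244,
    366, 440, 452, 372, 207, 23, -199, -358, -486, -527, -460, -364, -187, -58, 96, 208, 250, 269,
    222, 200, 131, 71, 21, -15, -29, -54, -51, -48, -36, -28, -22, -10, -6, -2, -1, 0, 1]

open LaurentPolynomial

set_option exponentiation.threshold 50000 in
-- Already `3 ^ 43300` exceeds `2 ^ (200 * 343)`. The existential keeps the numbers opaque, and
-- their values are inserted only for the kernel check.
theorem exists_modulus : ∃ z y M : ℕ, z = 2 ^ 100 ∧ y = 3 ^ 43300 ∧ z * z * y = M + 1 ∧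
    (z * z) ^ 343 ≤ M ∧ z * z + y ≤ M := by
  refine ⟨2 ^ 100, 3 ^ 43300, 2 ^ 100 * 2 ^ 100 * 3 ^ 43300 - 1, rfl, rfl, ?_, ?_, ?_⟩
  · refine (Nat.sub_add_cancel ?_).symm
    exact Nat.mul_pos (Nat.mul_pos (by positivity) (by positivity)) (Nat.pow_pos (by norm_num))
  · exact Nat.le_of_ble_eq_true (by decide +kernel)
  · exact Nat.le_of_ble_eq_true (by decide +kernel)

theorem bracket_km : bracket kmVertices = 1 := by
  obtain ⟨z, y, M, hz, hy, hM, hM', hxy⟩ := exists_modulus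
  have h := bracket_eq_of_check (D := kmVertices) (enc := id) (dec := id) (s := 0) (h := 3)
    (cs := [1]) (l := [6, 7, 0, 1, 2, 3, 4, 5].map fun i =>
      (kmVertices.map (Vertex.toOp id)).getD i (.point 0 0)) hM hz.ge hM' hxy (by decide)
    (by decide) (by decide) (by decide) (by decide) (by decide) (by decide) (fun _ _ => rfl)
    (by decide +kernel) (by decide +kernel) (by decide +kernel) (by rw [hz, hy]; decide +kernel)
  rw [h]
  simp [horner]

theorem bracket_cable_two_km : bracket (cable 2 kmVertices) = d := by
  obtain ⟨z, y, M, hz, hy, hM, hM', hxy⟩ := exists_modulus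
  have h := bracket_eq_of_check (D := cable 2 kmVertices) (enc := CableLabel.code)
    -- The coefficients express `d = A ^ (-2) * (-1 - A ^ 4)`. The virtual crossings, numbered 24 to
    -- 31, are processed first.
    (dec := CableLabel.decode) (s := 1) (h := 12) (cs := [-1, 0, -1])
    (l := cableOps 2 (List.range' 24 8 ++ List.range 24)) hM hz.ge hM' hxy
    (fun h => nomatch congrArg List.length h)
    (by decide +kernel) (by decide +kernel) (by decide) (by decide) (by decide) (by decide +kernel)
    (by decide +kernel)
    (by decide +kernel) (by decide +kernel) (by decide +kernel) (by rw [hz, hy]; decide +kernel)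
  rw [h]
  have h1 : (T (-2) * (T 2 * T 2) : LaurentPolynomial ℤ) = T 2 := by
    rw [← T_add, ← T_add]
    norm_num
  simp only [horner, d]
  norm_num
  linear_combination -h1

theorem bracket_cable_three_km :
    bracket (cable 3 kmVertices) = T (2 * (-30 : ℤ)) * horner (T 2) bracketCoeffs := by
  obtain ⟨z, y, M, hz, hy, hM, hM', hxy⟩ := exists_modulus
  exact bracket_eq_of_check (D := cable 3 kmVertices) (enc := CableLabel.code)
    (dec := CableLabel.decode) (s := 30) (h := 27) (cs := bracketCoeffs)
    (l := cableOps 3 smoothingOrder) hM hz.ge hM' hxy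
    (fun h => nomatch congrArg List.length h)
    (by decide +kernel) (by decide +kernel) (by decide) (by decide) (by decide) (by decide +kernel)
    (by decide +kernel)
    (by decide +kernel) (by decide +kernel) (by decide +kernel) (by rw [hz, hy]; decide +kernel)

end Cables
end VirtualKnotTheory

namespace VirtualKnotTheory
-- The brackets of the unknot and the comparison
open LaurentPolynomial

theorem bracket_unknot : bracket unknotVertices = 1 := by
  have h : numCurves [(((0 : ℕ), true), ((0 : ℕ), false))] = 1 :=
    numClasses_eq _ id 0 1 (by decide) (by decide) (by decide)
  simp [bracket, unknotVertices, states, h]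

theorem bracket_cable_two_unknot : bracket (cable 2 unknotVertices) = d := by
  have h : numCurves [((CableLabel.strand 0 0, true), (CableLabel.strand 0 0, false)),
      ((CableLabel.strand 0 1, true), ((CableLabel.strand 0 1 : CableLabel ℕ), false))] = 2 :=
    numClasses_eq _ id 0 2 (by decide) (by decide) (by decide)
  simp [bracket, unknotVertices, cable, cableVertex, copy, List.range, List.range.loop, states, h]

theorem bracket_cable_three_unknot : bracket (cable 3 unknotVertices) = d ^ 2 := by
  have h : numCurves [((CableLabel.strand 0 0, true), (CableLabel.strand 0 0, false)),
      ((CableLabel.strand 0 1, true), (CableLabel.strand 0 1, false)),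
      ((CableLabel.strand 0 2, true), ((CableLabel.strand 0 2 : CableLabel ℕ), false))] = 3 :=
    numClasses_eq _ id 0 3 (by decide) (by decide) (by decide)
  simp [bracket, unknotVertices, cable, cableVertex, copy, List.range, List.range.loop, states, h]

theorem T_mul_horner_cons (n c : ℤ) (cs : List ℤ) :
    (T n * horner (T 2) (c :: cs) : LaurentPolynomial ℤ) =
      (c : LaurentPolynomial ℤ) * T n + T (n + 2) * horner (T 2) cs := by
  have h : (horner (T 2) (c :: cs) : LaurentPolynomial ℤ) = (c : LaurentPolynomial ℤ) +
      T 2 * horner (T 2) cs := rfl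
  rw [T_add, h]
  ring

theorem T_mul_horner_bracketCoeffs : (T (2 * (-30 : ℤ)) * horner (T 2) bracketCoeffs :
    LaurentPolynomial ℤ) =
        (-T (-60) + T (-56) + 2 * T (-54) + 5 * T (-52) + 10 * T (-50) + 21 * T (-48) + 25 * T (-46)) +
        (26 * T (-44) + 21 * T (-42) + 8 * T (-40) - 19 * T (-38) - 69 * T (-36) - 115 * T (-34) - 155 * T (-32)) +
        (-175 * T (-30) - 172 * T (-28) - 127 * T (-26) - 23 * T (-24) + 109 * T (-22) + 244 * T (-20) + 366 * T (-18)) +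
        (440 * T (-16) + 452 * T (-14) + 372 * T (-12) + 207 * T (-10) + 23 * T (-8) - 199 * T (-6) - 358 * T (-4)) +
        (-486 * T (-2) - 527 - 460 * T 2 - 364 * T 4 - 187 * T 6 - 58 * T 8 + 96 * T 10) +
        (208 * T 12 + 250 * T 14 + 269 * T 16 + 222 * T 18 + 200 * T 20 + 131 * T 22 + 71 * T 24) +
        (21 * T 26 - 15 * T 28 - 29 * T 30 - 54 * T 32 - 51 * T 34 - 48 * T 36 - 36 * T 38) +
        (-28 * T 40 - 22 * T 42 - 10 * T 44 - 6 * T 46 - 2 * T 48 - T 50 + T 54) := by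
  have h : ∀ n : ℤ, (T n * horner (T 2) [] : LaurentPolynomial ℤ) = 0 := fun n => mul_zero _
  rw [bracketCoeffs, show 2 * (-30 : ℤ) = -60 from rfl]
  simp only [T_mul_horner_cons, h, Int.reduceAdd, Int.reduceNeg]
  simp only [Int.cast_neg, Int.cast_ofNat, Int.cast_one, Int.cast_zero, T_zero]
  ring

theorem T_mul_horner_ne : (T (2 * (-30 : ℤ)) * horner (T 2) bracketCoeffs :
    LaurentPolynomial ℤ) ≠ d ^ 2 := by
  intro h
  -- The substitution `A = 2` modulo 11, with inverse 6, already separates the two polynomials.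
  have h1 := congrArg (eval₂ (Int.castRingHom (ZMod 11)) ⟨2, 6, rfl, rfl⟩) h
  rw [map_mul, map_horner, map_pow, d, map_sub, map_neg, eval₂_T, eval₂_T, eval₂_T] at h1
  revert h1
  decide +kernel

end VirtualKnotTheory
open LaurentPolynomial in
theorem mainTheorem6 :
    (VirtualKnotTheory.Km.bracket = 1 ∧ VirtualKnotTheory.unknot.bracket = 1) ∧
    (VirtualKnotTheory.Km.bracketN 2 = VirtualKnotTheory.d ∧
      VirtualKnotTheory.unknot.bracketN 2 = VirtualKnotTheory.d) ∧
    (VirtualKnotTheory.Km.bracketN 3 =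
        (-T (-60) + T (-56) + 2 * T (-54) + 5 * T (-52) + 10 * T (-50) + 21 * T (-48) + 25 * T (-46)) +
        (26 * T (-44) + 21 * T (-42) + 8 * T (-40) - 19 * T (-38) - 69 * T (-36) - 115 * T (-34) - 155 * T (-32)) +
        (-175 * T (-30) - 172 * T (-28) - 127 * T (-26) - 23 * T (-24) + 109 * T (-22) + 244 * T (-20) + 366 * T (-18)) +
        (440 * T (-16) + 452 * T (-14) + 372 * T (-12) + 207 * T (-10) + 23 * T (-8) - 199 * T (-6) - 358 * T (-4)) +
        (-486 * T (-2) - 527 - 460 * T 2 - 364 * T 4 - 187 * T 6 - 58 * T 8 + 96 * T 10) +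
        (208 * T 12 + 250 * T 14 + 269 * T 16 + 222 * T 18 + 200 * T 20 + 131 * T 22 + 71 * T 24) +
        (21 * T 26 - 15 * T 28 - 29 * T 30 - 54 * T 32 - 51 * T 34 - 48 * T 36 - 36 * T 38) +
        (-28 * T 40 - 22 * T 42 - 10 * T 44 - 6 * T 46 - 2 * T 48 - T 50 + T 54) ∧
      VirtualKnotTheory.unknot.bracketN 3 = VirtualKnotTheory.d ^ 2 ∧
      VirtualKnotTheory.Km.bracketN 3 ≠ VirtualKnotTheory.unknot.bracketN 3) ∧
    ¬ VirtualKnotTheory.VirtuallyEquivalent VirtualKnotTheory.Km VirtualKnotTheory.unknot := by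
  open VirtualKnotTheory in
  have h3 : Km.bracketN 3 = T (2 * (-30 : ℤ)) * horner (T 2) bracketCoeffs := bracket_cable_three_km
  exact ⟨⟨bracket_km, bracket_unknot⟩, ⟨bracket_cable_two_km, bracket_cable_two_unknot⟩,
    ⟨h3.trans T_mul_horner_bracketCoeffs, bracket_cable_three_unknot, fun h =>
      T_mul_horner_ne (h3.symm.trans (h.trans bracket_cable_three_unknot))⟩,
    not_virtuallyEquivalent⟩
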